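/- Let $0<q<1$, $n\ge 0$. Let $\hat V$ be the algebra of formal power series over $\mathbb C$ in $x_1,\dots,x_n$ with $x_ix_j=q\,x_jx_i$ for $i>j$, and $V$ the algebra of formal power series in $\partial_1,\dots,\partial_n$ with $\partial_i\partial_j=q\,\partial_j\partial_i$ for $i<j$. Write $x^E=x_1^{e_1}\cdots x_n^{e_n}$, $\partial^E=\partial_n^{e_n}\cdots\partial_1^{e_1}$, $|E|=\sum_je_j$. Let $(p;p)_k=\prod_{l=1}^k(1-p^l)$, $e_p(z)=\sum_k z^k/(p;p)_k$, $E_p(z)=\sum_k p^{k(k-1)/2}z^k/(p;p)_k$, $g_{q^2}=e_{q^4}(-\sum_jx_j^2)$ and $G_{q^2}(q^2\partial)=E_{q^4}(-\sum_j(q^2\partial_j)^2)$. *Integral on $\hat V$.* For $f=\sum c_Ex^E$ put $f_{\cdot1}(z)=\sum c_Ez^E$ (commuting $z_j$). Call $f$ integrable if $f_{\cdot1}$ converges absolutely near $0$, continues analytically to $\mathbb R^n+iU$ for some open $U\ni0$, and is absolutely $q^2$-Jackson integrable over the two-sided lattice $\{(\pm q^{2k_1}z_1,\dots,\pm q^{2k_n}z_n)\}$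 for every $z\in(\mathbb R\setminus0)^n$. Then for $s\in\mathbb Z_{\ge0}^n$ the integral $\int_{-q^{s_n}x_n\cdot\infty}^{q^{s_n}x_n\cdot\infty}\cdots\int_{-q^{s_1}x_1\cdot\infty}^{q^{s_1}x_1\cdot\infty}f$ is the function of $z\in(\mathbb R\setminus0)^n$ given by the $n$-fold $q^2$-Jackson integral of $f_{\cdot1}$ with bounds $\pm q^{n-j+s_j}z_j\cdot\infty$, $j=1,\dots,n$. Let $I$ be the case $s=0$, $\Pi_0$ the projection on the series even in every variable, $I'=I\circ\Pi_0$, and let $\mathcal R$ be the set of $f$ such that $\Pi_0(fx^E)$ is integrable for all $E$. *Lattice order integral on $V$.* For $g=\sum c_E\partial^E$ put ${}_{1\cdot}g(z)=\sum c_Ez^E$; $g$ is entire if this converges for all $z\in\mathbb C^n$. For $\sigma\in S_n$ and $\gamma\in\mathbb R_{>0}^n$, $J''_{(\sigma,\gamma)}(g)$ is obtained by integrating out $\partial_{\sigma(1)},\dots,\partial_{\sigma(n)}$ successively: the step for $l=\sigma(k)$ requires the current series $g$ to be entire, takes its part $P_0g$ even in every variable, and forms $$(1-q^2)\sum_{h\in\mathbb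 Z}\sum_{\varepsilon=\pm1}q^{2h}\;{}_{1\cdot}\Big[(P_0g)(\partial_n,\dots,\partial_{l+1},\varepsilon q^{2h}\partial_l,q^{-2}\partial_{l-1},\dots,q^{-2}\partial_1)\,\partial_l\Big]\Big|_{z_l=\gamma_l},$$ which has to converge absolutely for all values of the remaining $z_j$ and to be an entire power series in them; that power series, read in the remaining $\partial_j$ (decreasing order), is the next series. If all steps are possible, $g$ is called lattice order integrable for $(\sigma,\gamma)$ and $J''_{(\sigma,\gamma)}(g)$ is the constant that is left. Let $\mathcal S_{(\sigma,\gamma)}$ be the set of $g$ such that $\partial^Eg$ is lattice order integrable for $(\sigma,\gamma)$ for all $E$. *Transforms.* With $\exp(x|t_1\partial_1,\dots,t_n\partial_n)=\sum_E\prod_j\frac{t_j^{e_j}}{[e_j]_{q^2}!}\,x^E\otimes\partial^E$, $[m]_p=\frac{p^m-1}{p-1}$, and $S(\partial^E)=(-1)^{|E|}q^{|E|^2-|E|}\partial^E$, let $$F_S=(I'\otimes S)(m\otimes\mathrm{id})\big(\mathrm{id}\otimes\exp(x|\tfrac{iq^2}{1-q^2}(q^{n-1}\partial_1,\dots,q^{n-j}\partial_j,\dots,\partial_n))\big)\quad\text{on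 }\mathcal R,$$ $$G''(\sigma,\gamma)=\big[(\mathrm{id}\otimes m)(\exp(x|\tfrac{i}{1-q^2}(\partial_1,\dots,q^{1-j}\partial_j,\dots,q^{1-n}\partial_n))\otimes\mathrm{id})\big]\leftharpoonup(\mathrm{id}\otimes J''_{(\sigma,\gamma)})\quad\text{on }\mathcal S_{(\sigma,\gamma)}.$$ Thus $F_S(f)$ is a series in $V$ whose coefficients are functions of $z\in(\mathbb R\setminus0)^n$, and $G''(\sigma,\gamma)(g)\in\hat V$. **Statement.** Let $\beta\in(\mathbb Z/2)^n$ with representatives $b_j\in\{0,1\}$, $B(\beta)_j=\sum_{i<j}b_i$, $B(\beta)^j=\sum_{i>j}b_i$, let $\sigma\in S_n$, and $$\gamma_{\sigma(k)}=q^{B(\beta)^{\sigma(k)}+k-1+\#\{j<k\,|\,\sigma(j)>\sigma(k)\}},\qquad \tilde\gamma_{\sigma(k)}=\gamma_{\sigma(k)}q^{B(\beta)^{\sigma(k)}}.$$ Then $g_{q^2}$ is integrable, $G_{q^2}(q^2\partial)$ is lattice order integrable for $(\sigma,\tilde\gamma)$, and with $$c_{\beta}=\Big[\int_{-q^{B(\beta)_n}x_n\cdot\infty}^{q^{B(\beta)_n}x_n\cdot\infty}\cdots\int_{-q^{B(\beta)_1}x_1\cdot\infty}^{q^{B(\beta)_1}x_1\cdot\infty}g_{q^2}\Big]\;J''_{(\sigma,\tilde\gamma)}\big(G_{q^2}(q^2\partial)\big)$$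 (a function of $z\in(\mathbb R\setminus0)^n$) the following hold for all complex polynomials $p_1,\dots,p_n$ of parities $\beta_1,\dots,\beta_n$. 1. The series $g=E_{q^4}(-q^4\partial_1^2)p_1(\partial_1)\cdots E_{q^4}(-q^4\partial_n^2)p_n(\partial_n)$ lies in $\mathcal S_{(\sigma,\gamma)}$, $G''(\sigma,\gamma)(g)$ lies in $\mathcal R$, and $F_S(G''(\sigma,\gamma)(g))=c_\beta\otimes g$. 2. The series $f=p_1(x_1)e_{q^4}(-x_1^2)\cdots p_n(x_n)e_{q^4}(-x_n^2)$ lies in $\mathcal R$, for every $z\in(\mathbb R\setminus0)^n$ the value of $F_S(f)$ at $z$ lies in $\mathcal S_{(\sigma,\gamma)}$, and $(\mathrm{id}\otimes G''(\sigma,\gamma))F_S(f)=c_\beta\otimes f$. 3. If $n\ge2$, the constant depends on the parity: for every $\beta$ there is $\beta'\in(\mathbb Z/2)^n$ with $c_{\beta'}\ne c_\beta$ as functions of $z$. -/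

import Mathlib

noncomputable section

namespace BraidedFourier

/-! ### The two algebras of formal power series

A formal power series in `n` noncommuting variables with a fixed normal form for monomials is its
family of coefficients.  For `x₁, …, xₙ` (relations `xᵢ xⱼ = q xⱼ xᵢ`, `i > j`) the normal form of
a monomial is `x^E = x₁^{e₁} ⋯ xₙ^{eₙ}` (increasing); for `∂₁, …, ∂ₙ` (relations
`∂ᵢ ∂ⱼ = q ∂ⱼ ∂ᵢ`, `i < j`) it is `∂^E = ∂ₙ^{eₙ} ⋯ ∂₁^{e₁}` (decreasing).
The indices `1, …, n` are represented by `Fin n`, so the index `j` is represented by `j - 1`. -/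

/-- Multi-indices. -/
abbrev Exps (n : ℕ) := Fin n → ℕ

/-- Formal power series, given by their coefficients with respect to the normal form. -/
abbrev Series (n : ℕ) := Exps n → ℂ

/-- `x^K x^L = xWeight q K L • x^(K+L)`: for `j < i` each `x_i` in `x^K` is moved past each `x_j`
in `x^L`. -/
def xWeight {n : ℕ} (q : ℝ) (K L : Exps n) : ℂ :=
  (q : ℂ) ^ (∑ i, ∑ j ∈ Finset.Iio i, K i * L j)

/-- `∂^K ∂^L = dWeight q K L • ∂^(K+L)`: for `j < i` each `∂_j` in `∂^K` is moved past each `∂_i`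
in `∂^L`. -/
def dWeight {n : ℕ} (q : ℝ) (K L : Exps n) : ℂ :=
  (q : ℂ) ^ (∑ i, ∑ j ∈ Finset.Iio i, K j * L i)

/-- Product of formal power series when normal monomials multiply by `m^K m^L = w K L • m^(K+L)`. -/
def mulW {n : ℕ} (w : Exps n → Exps n → ℂ) (c d : Series n) : Series n :=
  fun M => ∑ K ∈ Finset.Iic M, w K (M - K) * c K * d (M - K)

/-- The normal monomial with exponent `E`. -/
def mono {n : ℕ} (E : Exps n) : Series n := fun M => if M = E then 1 else 0

/-- The `j`-th generator. -/
def gen {n : ℕ} (j : Fin n) : Series n := mono (Pi.single j 1)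

/-- Powers. -/
def powW {n : ℕ} (w : Exps n → Exps n → ℂ) (a : Series n) : ℕ → Series n
  | 0 => mono 0
  | k + 1 => mulW w (powW w a k) a

/-- `φ(a) = ∑ₖ φₖ aᵏ` for a series `a` without constant term; only the powers `aᵏ` with
`k ≤ |M|` contribute to the coefficient of the monomial of exponent `M`. -/
def compW {n : ℕ} (w : Exps n → Exps n → ℂ) (φ : PowerSeries ℂ) (a : Series n) : Series n :=
  fun M => ∑ k ∈ Finset.range (∑ j, M j + 1), PowerSeries.coeff k φ * powW w a k M

/-- The ordered product `F₁ F₂ ⋯ Fₙ` (increasing order of the indices). -/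
def prodW {n : ℕ} (w : Exps n → Exps n → ℂ) (F : Fin n → Series n) : Series n :=
  (List.ofFn F).foldr (mulW w) (mono 0)

theorem mulW_mono {n : ℕ} (w : Exps n → Exps n → ℂ) (K L : Exps n) :
    mulW w (mono K) (mono L) = w K L • mono (K + L) := by
  funext M
  simp only [mulW, mono, Pi.smul_apply, smul_eq_mul]
  by_cases h : M = K + L
  · subst h
    rw [Finset.sum_eq_single K]
    · simp
    · intro b _ hb
      simp [hb]
    · intro hK
      exact absurd (Finset.mem_Iic.2 (le_self_add)) hK
  · rw [if_neg h, mul_zero]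
    refine Finset.sum_eq_zero fun b hb => ?_
    by_cases hbK : b = K
    · subst hbK
      have : M - b ≠ L := by
        intro h'
        apply h
        rw [← h', add_tsub_cancel_of_le (Finset.mem_Iic.1 hb)]
      simp [this]
    · simp [hbK]

/-- The defining relations `xᵢ xⱼ = q xⱼ xᵢ`, `i > j`. -/
theorem x_relation {n : ℕ} (q : ℝ) (i j : Fin n) (h : j < i) :
    mulW (xWeight q) (gen i) (gen j) = (q : ℂ) • mulW (xWeight q) (gen j) (gen i) := by
  have e1 : xWeight q (Pi.single i 1 : Exps n) (Pi.single j 1) = q := by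
    unfold xWeight
    rw [Finset.sum_eq_single i, Finset.sum_eq_single j]
    · simp
    · intro b _ hb
      simp [hb]
    · intro hj
      exact absurd (Finset.mem_Iio.2 h) hj
    · intro b _ hb
      simp [Pi.single_apply, hb]
    · simp
  have e2 : xWeight q (Pi.single j 1 : Exps n) (Pi.single i 1) = 1 := by
    unfold xWeight
    rw [Finset.sum_eq_zero, pow_zero]
    intro a _
    refine Finset.sum_eq_zero fun b hb => ?_
    have hb' := Finset.mem_Iio.1 hb
    by_cases ha : a = j
    · subst ha
      have : b ≠ i := (hb'.trans h).ne
      simp [this]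
    · simp [Pi.single_apply, ha]
  simp only [gen]
  rw [mulW_mono, mulW_mono, e1, e2, add_comm, one_smul]

/-- The defining relations `∂ᵢ ∂ⱼ = q ∂ⱼ ∂ᵢ`, `i < j`. -/
theorem d_relation {n : ℕ} (q : ℝ) (i j : Fin n) (h : i < j) :
    mulW (dWeight q) (gen i) (gen j) = (q : ℂ) • mulW (dWeight q) (gen j) (gen i) := by
  have e : ∀ K L : Exps n, dWeight q K L = xWeight q L K := by
    intro K L
    simp only [dWeight, xWeight, mul_comm]
  have e1 : xWeight q (Pi.single j 1 : Exps n) (Pi.single i 1) = q := by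
    unfold xWeight
    rw [Finset.sum_eq_single j, Finset.sum_eq_single i]
    · simp
    · intro b _ hb
      simp [hb]
    · intro hj
      exact absurd (Finset.mem_Iio.2 h) hj
    · intro b _ hb
      simp [Pi.single_apply, hb]
    · simp
  have e2 : xWeight q (Pi.single i 1 : Exps n) (Pi.single j 1) = 1 := by
    unfold xWeight
    rw [Finset.sum_eq_zero, pow_zero]
    intro a _
    refine Finset.sum_eq_zero fun b hb => ?_
    have hb' := Finset.mem_Iio.1 hb
    by_cases ha : a = i
    · subst ha
      have : b ≠ j := (hb'.trans h).ne
      simp [this]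
    · simp [Pi.single_apply, ha]
  simp only [gen]
  rw [mulW_mono, mulW_mono, e, e, e1, e2, add_comm, one_smul]

/-! ### Shifted factorials, `q`-exponentials and Gaussians -/

/-- `(p;p)ₖ = ∏_{l=1}^{k} (1 - p^l)`. -/
def qPoch (p : ℝ) (k : ℕ) : ℝ := ∏ l ∈ Finset.range k, (1 - p ^ (l + 1))

/-- `[m]_p = (p^m - 1)/(p - 1)`. -/
def qNumber (p : ℝ) (m : ℕ) : ℝ := (p ^ m - 1) / (p - 1)

/-- `[m]_p! = [1]_p ⋯ [m]_p`. -/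
def qFactorial (p : ℝ) (m : ℕ) : ℝ := ∏ l ∈ Finset.range m, qNumber p (l + 1)

/-- `e_p(z) = ∑ₖ z^k / (p;p)ₖ`. -/
def eSeries (p : ℝ) : PowerSeries ℂ := PowerSeries.mk fun k => ((1 / qPoch p k : ℝ) : ℂ)

/-- `E_p(z) = ∑ₖ p^{k(k-1)/2} z^k / (p;p)ₖ`. -/
def ESeries (p : ℝ) : PowerSeries ℂ :=
  PowerSeries.mk fun k => ((p ^ (k * (k - 1) / 2) / qPoch p k : ℝ) : ℂ)

/-- The Gaussian `g_{q²}(x) = e_{q⁴}(-∑ⱼ xⱼ²)`. -/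
def gaussX (n : ℕ) (q : ℝ) : Series n :=
  compW (xWeight q) (eSeries (q ^ 4)) (-∑ j, powW (xWeight q) (gen j) 2)

/-- The rescaled Gaussian `G_{q²}(q²∂) = E_{q⁴}(-∑ⱼ (q²∂ⱼ)²)`. -/
def gaussD (n : ℕ) (q : ℝ) : Series n :=
  compW (dWeight q) (ESeries (q ^ 4)) (-∑ j, powW (dWeight q) (((q : ℂ) ^ 2) • gen j) 2)

/-- `E_{q⁴}(-q⁴∂₁²) p₁(∂₁) ⋯ E_{q⁴}(-q⁴∂ₙ²) pₙ(∂ₙ)`. -/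
def dClass {n : ℕ} (q : ℝ) (p : Fin n → Polynomial ℂ) : Series n :=
  prodW (dWeight q) fun j =>
    mulW (dWeight q)
      (compW (dWeight q) (ESeries (q ^ 4)) (-((q : ℂ) ^ 4) • powW (dWeight q) (gen j) 2))
      (compW (dWeight q) (p j : PowerSeries ℂ) (gen j))

/-- `p₁(x₁) e_{q⁴}(-x₁²) ⋯ pₙ(xₙ) e_{q⁴}(-xₙ²)`. -/
def xClass {n : ℕ} (q : ℝ) (p : Fin n → Polynomial ℂ) : Series n :=
  prodW (xWeight q) fun j =>
    mulW (xWeight q)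
      (compW (xWeight q) (p j : PowerSeries ℂ) (gen j))
      (compW (xWeight q) (eSeries (q ^ 4)) (-powW (xWeight q) (gen j) 2))

/-- `p` has parity `b`: it is even if `b = 0` and odd if `b = 1`. -/
def HasParity (p : Polynomial ℂ) (b : ZMod 2) : Prop := ∀ k, p.coeff k ≠ 0 → (k : ZMod 2) = b

/-! ### Realization on commuting variables, parity projection, rescaling -/

/-- The term of exponent `M` of the power series `f ▷ 1` (resp. `1 ◁ f`) in commuting variables:
the action on `1` sends a normal monomial to the monomial in `z` with the same exponents. -/
def term {n : ℕ} (f : Series n) (z : Fin n → ℂ) (M : Exps n) : ℂ := f M * ∏ j, z j ^ M j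

/-- The sum of `f ▷ 1` (resp. `1 ◁ f`) at `z`. -/
def eval {n : ℕ} (f : Series n) (z : Fin n → ℂ) : ℂ := ∑' M, term f z M

/-- The realization of `f` is an entire power series. -/
def Entire {n : ℕ} (f : Series n) : Prop := ∀ z : Fin n → ℂ, Summable (term f z)

/-- The projection `Π₀` (resp. `P₀`) on the series that are even in every variable. -/
def evenPart {n : ℕ} (f : Series n) : Series n := fun M => if ∀ j, Even (M j) then f M else 0

/-- `f(s₁ x₁, …, sₙ xₙ)`. -/
def rescale {n : ℕ} (s : Fin n → ℂ) (f : Series n) : Series n := fun M => f M * ∏ j, s j ^ M j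

/-! ### Integration in the variables `x` -/

/-- `φ` is an analytic continuation of the realization `f ▷ 1` (which has to converge absolutely
near `0`) to `ℝⁿ + iU` for some open neighbourhood `U` of `0`. -/
def IsContinuation {n : ℕ} (f : Series n) (φ : (Fin n → ℂ) → ℂ) : Prop :=
  (∃ r : ℝ, 0 < r ∧ ∀ z : Fin n → ℂ, (∀ j, ‖z j‖ < r) → HasSum (term f z) (φ z)) ∧
  ∃ U : Set (Fin n → ℝ), IsOpen U ∧ (0 : Fin n → ℝ) ∈ U ∧
    AnalyticOnNhd ℂ φ {z | (fun j => (z j).im) ∈ U}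

/-- The point `(ε₁ q^{2k₁} z₁, …, εₙ q^{2kₙ} zₙ)` of the two-sided `q²`-lattice through `z`. -/
def latticePoint {n : ℕ} (q : ℝ) (z : Fin n → ℝ) (k : Fin n → ℤ) (ε : Fin n → ℤˣ) :
    Fin n → ℂ :=
  fun j => (((ε j : ℤ) : ℝ) * q ^ (2 * k j) * z j : ℝ)

/-- The `k`-th term (summed over the signs) of the `n`-fold `q²`-Jackson integral
`∫_{-z₁·∞}^{z₁·∞} ⋯ ∫_{-zₙ·∞}^{zₙ·∞} φ(t) d_{q²}t`. -/
def jacksonTerm {n : ℕ} (q : ℝ) (φ : (Fin n → ℂ) → ℂ) (z : Fin n → ℝ) (k : Fin n → ℤ) : ℂ :=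
  ∑ ε : Fin n → ℤˣ,
    ((1 - q ^ 2) ^ n * q ^ (2 * ∑ j, k j) * ∏ j, z j : ℝ) * φ (latticePoint q z k ε)

/-- The `n`-fold `q²`-Jackson integral over the two-sided lattice through `z`. -/
def jackson {n : ℕ} (q : ℝ) (φ : (Fin n → ℂ) → ℂ) (z : Fin n → ℝ) : ℂ :=
  ∑' k : Fin n → ℤ, jacksonTerm q φ z k

/-- Absolute `q²`-integrability of `φ` over the two-sided lattice through `z`. -/
def JacksonIntegrable {n : ℕ} (q : ℝ) (φ : (Fin n → ℂ) → ℂ) (z : Fin n → ℝ) : Prop :=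
  ∀ ε : Fin n → ℤˣ, Summable fun k : Fin n → ℤ =>
    (1 - q ^ 2) ^ n * q ^ (2 * ∑ j, k j) * (∏ j, |z j|) * ‖φ (latticePoint q z k ε)‖

/-- `φ` continues `f ▷ 1` analytically and is absolutely `q²`-integrable over every lattice
outside the coordinate hyperplanes. -/
def IsIntegrableContinuation {n : ℕ} (q : ℝ) (f : Series n) (φ : (Fin n → ℂ) → ℂ) : Prop :=
  IsContinuation f φ ∧ ∀ z : Fin n → ℝ, (∀ j, z j ≠ 0) → JacksonIntegrable q φ z

/-- The class of integrable series in `x₁, …, xₙ`. -/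
def XIntegrable {n : ℕ} (q : ℝ) (f : Series n) : Prop := ∃ φ, IsIntegrableContinuation q f φ

open Classical in
/-- The realization at `z` of
`∫_{-q^{s_n} xₙ·∞}^{q^{s_n} xₙ·∞} ⋯ ∫_{-q^{s_1} x₁·∞}^{q^{s_1} x₁·∞} f`.
The formal expression is `(1-q²)ⁿ ∑_k ∑_ε q^{2|k|+|s|+n(n-1)/2} x₁⋯xₙ f(…, ε_j q^{2k_j+s_j} x_j, …)`;
acting with `x₁ ⋯ xₙ` rescales `z_j` by `q^{n-j}`, so that its action on `1` is the Jackson integral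
of the continued realization of `f` with bounds `q^{n-j+s_j} z_j`. -/
def xIntegral {n : ℕ} (q : ℝ) (s : Fin n → ℕ) (f : Series n) (z : Fin n → ℝ) : ℂ :=
  if h : XIntegrable q f then
    jackson q (Classical.choose h) fun j => q ^ (n - 1 - (j : ℕ) + s j) * z j
  else 0

/-- The integral `I' = I ∘ Π₀`, realized at `z`. -/
def xIntegral' {n : ℕ} (q : ℝ) (f : Series n) (z : Fin n → ℝ) : ℂ :=
  xIntegral q (fun _ => 0) (evenPart f) z

/-! ### Lattice order integration in the variables `∂` -/

/-- The scaling `∂_l ↦ ε q^{2h} ∂_l`, `∂_j ↦ q^{-2} ∂_j` for `j < l`. -/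
def stepScale {n : ℕ} (q : ℝ) (l : Fin n) (h : ℤ) (ε : ℤˣ) : Fin n → ℂ :=
  fun j => if j = l then ((ε : ℤ) : ℂ) * (q : ℂ) ^ (2 * h) else if j < l then (q : ℂ) ^ (-2 : ℤ)
    else 1

/-- The `h`-th term of the realization at `z`, with `z_l = γ_l`, of the one-variable integral
`P₀g ↼ ∫_{-∂_l·∞}^{∂_l·∞} = (1-q²) ∑_h ∑_ε q^{2h} (P₀g)(∂ₙ, …, εq^{2h}∂_l, q^{-2}∂_{l-1}, …, q^{-2}∂₁) ∂_l`. -/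
def stepTerm {n : ℕ} (q : ℝ) (l : Fin n) (γl : ℝ) (g : Series n) (z : Fin n → ℂ) (h : ℤ) : ℂ :=
  ∑ ε : ℤˣ, (1 - (q : ℂ) ^ 2) * (q : ℂ) ^ (2 * h) *
    eval (mulW (dWeight q) (rescale (stepScale q l h ε) (evenPart g)) (gen l))
      (Function.update z l (γl : ℂ))

/-- The one-variable integral of the entire series `g` over the lattice through `γ_l` converges
absolutely for all values of the other variables, and is the realization of the entire power
series `g'`.  (As the integral does not depend on `z_l`, neither does `g'` contain `∂_l`.) -/
def IsStep {n : ℕ} (q : ℝ) (l : Fin n) (γl : ℝ) (g g' : Series n) : Prop :=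
  Entire g ∧ ∀ z : Fin n → ℂ,
    Summable (stepTerm q l γl g z) ∧ HasSum (term g' z) (∑' h : ℤ, stepTerm q l γl g z h)

/-- `v` is the lattice order integral of `g` for the order `σ` and the lattice of `γ`: the
variables `∂_{σ(1)}, …, ∂_{σ(n)}` are integrated out successively, and the constant `v` is left. -/
def HasLOIntegral {n : ℕ} (q : ℝ) (σ : Equiv.Perm (Fin n)) (γ : Fin n → ℝ) (g : Series n)
    (v : ℂ) : Prop :=
  ∃ c : Fin (n + 1) → Series n, c 0 = g ∧
    (∀ k : Fin n, IsStep q (σ k) (γ (σ k)) (c k.castSucc) (c k.succ)) ∧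
    c (Fin.last n) 0 = v

/-- Lattice order integrability for `σ` and `γ`. -/
def LOIntegrable {n : ℕ} (q : ℝ) (σ : Equiv.Perm (Fin n)) (γ : Fin n → ℝ) (g : Series n) : Prop :=
  ∃ v, HasLOIntegral q σ γ g v

open Classical in
/-- The lattice order integral `J''_{(σ,γ)}`. -/
def loIntegral {n : ℕ} (q : ℝ) (σ : Equiv.Perm (Fin n)) (γ : Fin n → ℝ) (g : Series n) : ℂ :=
  if h : LOIntegrable q σ γ g then Classical.choose h else 0

/-! ### The transforms -/

/-- The coefficients of `exp(x | (t₁∂₁, …, tₙ∂ₙ)) = ∑_E expCoeff E • x^E ⊗ ∂^E`. -/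
def expCoeff {n : ℕ} (q : ℝ) (t : Fin n → ℂ) (E : Exps n) : ℂ :=
  ∏ j, t j ^ E j / (qFactorial (q ^ 2) (E j) : ℂ)

/-- The braided antipode, `S(∂^E) = (-1)^{|E|} q^{|E|²-|E|} ∂^E`. -/
def antipode {n : ℕ} (q : ℝ) (g : Series n) : Series n := fun E =>
  (-1) ^ (∑ j, E j) * (q : ℂ) ^ ((∑ j, E j) ^ 2 - ∑ j, E j) * g E

/-- The class `R`: all `f x^E` are `I'`-integrable. -/
def ClassR {n : ℕ} (q : ℝ) (f : Series n) : Prop :=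
  ∀ E : Exps n, XIntegrable q (evenPart (mulW (xWeight q) f (mono E)))

/-- `F_S = (I' ⊗ S)(m ⊗ id)(id ⊗ exp(x | iq²/(1-q²) (q^{n-1}∂₁, …, q^{n-j}∂ⱼ, …, ∂ₙ)))`, a series in
the `∂ⱼ` whose coefficients are integrals in the `xⱼ`, realized at `z`. -/
def transformFS {n : ℕ} (q : ℝ) (f : Series n) (z : Fin n → ℝ) : Series n :=
  antipode q fun E =>
    expCoeff q
      (fun j => Complex.I * (q : ℂ) ^ 2 / (1 - (q : ℂ) ^ 2) * (q : ℂ) ^ (n - 1 - (j : ℕ))) E *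
    xIntegral' q (mulW (xWeight q) f (mono E)) z

/-- The class `S_{(σ,γ)}`: all `∂^E g` are lattice order integrable for `σ` and `γ`. -/
def ClassS {n : ℕ} (q : ℝ) (σ : Equiv.Perm (Fin n)) (γ : Fin n → ℝ) (g : Series n) : Prop :=
  ∀ E : Exps n, LOIntegrable q σ γ (mulW (dWeight q) (mono E) g)

/-- `G''(σ,γ) = [(id ⊗ m)(exp(x | i/(1-q²) (∂₁, …, q^{1-j}∂ⱼ, …, q^{1-n}∂ₙ)) ⊗ id)] ↼ (id ⊗ J'')`, a
series in the `xⱼ`. -/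
def transformG {n : ℕ} (q : ℝ) (σ : Equiv.Perm (Fin n)) (γ : Fin n → ℝ) (g : Series n) :
    Series n := fun E =>
  expCoeff q (fun j => Complex.I / (1 - (q : ℂ) ^ 2) * (q : ℂ) ^ (-((j : ℕ) : ℤ))) E *
    loIntegral q σ γ (mulW (dWeight q) (mono E) g)

/-! ### The lattices and the Plancherel constant -/

/-- `B(β)_j = ∑_{i<j} b(β)_i`. -/
def lowerSum {n : ℕ} (β : Fin n → ZMod 2) (j : Fin n) : ℕ := ∑ i ∈ Finset.Iio j, (β i).val

/-- `B(β)^j = ∑_{i>j} b(β)_i`. -/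
def upperSum {n : ℕ} (β : Fin n → ZMod 2) (j : Fin n) : ℕ := ∑ i ∈ Finset.Ioi j, (β i).val

/-- `γ_{σ(k)} = q^{B(β)^{σ(k)} + k - 1 + #{j < k | σ(j) > σ(k)}}`, as a function of `i = σ(k)`. -/
def latticeGamma {n : ℕ} (q : ℝ) (β : Fin n → ZMod 2) (σ : Equiv.Perm (Fin n)) (i : Fin n) : ℝ :=
  q ^ (upperSum β i + (σ.symm i : ℕ) + (Finset.univ.filter fun j => j < σ.symm i ∧ i < σ j).card)

/-- `γ̃_i = γ_i q^{B(β)^i}`. -/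
def latticeGammaTilde {n : ℕ} (q : ℝ) (β : Fin n → ZMod 2) (σ : Equiv.Perm (Fin n)) (i : Fin n) :
    ℝ :=
  latticeGamma q β σ i * q ^ upperSum β i

/-- The product of `∫_{-q^{B(β)_n} xₙ·∞}^{q^{B(β)_n} xₙ·∞} ⋯ ∫_{-q^{B(β)_1} x₁·∞}^{q^{B(β)_1} x₁·∞} g_{q²}`,
realized at `z`, and of `J''_{(σ,γ̃)}(G_{q²}(q²∂))`. -/
def plancherel {n : ℕ} (q : ℝ) (β : Fin n → ZMod 2) (σ : Equiv.Perm (Fin n)) (z : Fin n → ℝ) : ℂ :=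
  xIntegral q (lowerSum β) (gaussX n q) z *
    loIntegral q σ (latticeGammaTilde q β σ) (gaussD n q)

end BraidedFourier

end

/-! In normal order the coefficients of both classes are products of one-variable coefficients, up
to one power of `q` (`xClass_apply`, `dClass_apply`). The theorem thus reduces to a pair of inverse
transforms in one variable, plus control of the powers of `q` and of the lattices that reordering
produces.

One variable. Let `w = e_{q⁴}(-t²)` and `W = E_{q⁴}(-q⁴t²)`. Since `w(q²t) = (1+t²)w(t)`, the
difference operator `f ↦ -i(f(t)-f(q²t))/t` maps `P w` to `raise(P) w`. It is the counterpart of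
multiplication by `∂`, so `polyMap` sends `p` to `p(raise)1`. The functional equations of `w` and
`W` give two-term recurrences for their moments. By these, the moments of `W p` are, up to
normalization, the coefficients of `polyMap(p) w` (`momD_transform`), and the moments of `polyMap(p)
w` are those of `W p` (`mom_transform`). As `polyMap` is onto and compatible with parity
(`exists_polyMap_eq`), these two formulas yield both compositions.

The variables `x`. Reordering `f x^E` rescales `x_j` in `f` by `q^{∑_{i<j} E_i}`, hence moves the
lattice of the `j`-th Jackson integral. A lattice is unchanged under `q²`, and only `E` of parity
`β` contributes, so the integral always runs over the lattice shifted by `q^{B(β)_j}`. Every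
coefficient acquires the same product of Gaussian integrals (`transformFS_xClass`).

The variables `∂`. Here the Gaussian does not split: normal order leaves a factor `q^{2|K|²}` that
couples the variables. All series that occur belong to the family `famD`, and integrating out one
variable stays in the family (`isStep_famD`). Summing over the exponent of `∂_l` gives a value of
`E_{q⁴}` whose argument depends on the sum `S` of the other indices only through `q^{4S}`. If the
lattice has the right parity, `S` is absorbed by a shift of the lattice index and survives as a
geometric factor, while the zeros of `E_{q⁴}` cut the lattice sum off on the side of large
arguments. The exponents of `γ` and `γ̃` are chosen so that this parity holds at every step. The
accumulated power of `q` depends on `σ` only through its inversions (`sum_lamAt`), so the same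
constant `loConst` occurs for the Gaussian and for the whole class (`hasLOIntegral_gaussD`,
`transformG_dClass`).

Dependence on `β`. Expanding `1/E_{q⁴}` in partial fractions identifies the Gaussian integral over
the lattice of `ζ`, up to a nonzero constant, with `∑_h w_h/(1+w_h²)`, `w_h = q^{2h}ζ`
(`gaussInt_eq`). Continued to `ζ = i`, this has a pole, while the sum for `qζ` has none, so the two
lattices give different integrals (`exists_gaussInt_ne`). Changing the first parity switches the
lattice in all later variables. -/

noncomputable section

namespace BraidedFourier

/-! ### Multiple sums -/

/-- Absolute summability of a product over an index type, with the value of its sum. -/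
def PiProdSums (ι : Type) [Fintype ι] (β : Type) : Prop :=
  ∀ f : ι → β → ℂ, (∀ i, Summable fun b => ‖f i b‖) →
    (Summable fun x : ι → β => ‖∏ i, f i (x i)‖) ∧
      HasSum (fun x : ι → β => ∏ i, f i (x i)) (∏ i, ∑' b, f i b)

theorem PiProdSums.of_equiv {β α γ : Type} [Fintype α] [Fintype γ] (e : α ≃ γ)
    (ih : PiProdSums α β) : PiProdSums γ β := by
  intro f hf
  obtain ⟨h1, h2⟩ := ih (fun a => f (e a)) fun a => hf (e a)
  let E : (α → β) ≃ (γ → β) := e.arrowCongr (Equiv.refl β)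
  have key : ∀ x : α → β, ∏ i, f i (E x i) = ∏ a, f (e a) (x a) := by
    intro x
    refine (Fintype.prod_equiv e _ _ fun a => ?_).symm
    simp [E, Equiv.arrowCongr]
  have key2 : ∏ i, ∑' b, f i b = ∏ a, ∑' b, f (e a) b :=
    (Fintype.prod_equiv e _ _ fun a => rfl).symm
  constructor
  · rw [← E.summable_iff]
    refine h1.congr fun x => ?_
    simp only [Function.comp, key]
  · rw [← E.hasSum_iff, key2]
    simp only [Function.comp_def, key]
    exact h2

theorem PiProdSums.option {β α : Type} [Fintype α] (ih : PiProdSums α β) :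
    PiProdSums (Option α) β := by
  intro f hf
  obtain ⟨h1, h2⟩ := ih (fun a => f (some a)) fun a => hf (some a)
  let E : (Option α → β) ≃ β × (α → β) := Equiv.piOptionEquivProd
  have hs := summable_mul_of_summable_norm (hf none) h1
  have hn := Summable.mul_norm (hf none) h1
  have hE : ∀ x : β × (α → β), ∏ i, f i (E.symm x i) = f none x.1 * ∏ a, f (some a) (x.2 a) := by
    intro x
    simp [E, Equiv.piOptionEquivProd, Fintype.prod_option]
  constructor
  · rw [← E.symm.summable_iff]
    refine hn.congr fun x => ?_
    simp only [Function.comp, hE]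
  · rw [← E.symm.hasSum_iff, Fintype.prod_option]
    have := HasSum.mul (hf none).of_norm.hasSum h2 hs
    simp only [Function.comp_def, hE]
    exact this

/-- Arbitrary finite index types are needed, since the products run over `Fin n` and also over the
indices different from a given one; hence the induction by adjoining a point instead of one on `n`.
-/
theorem piProdSums (ι : Type) [Fintype ι] (β : Type) : PiProdSums ι β := by
  refine Fintype.induction_empty_option (P := fun ι _ => PiProdSums ι β) ?_ ?_ ?_ ι
  · intro α γ _ e ih
    let := Fintype.ofEquiv γ e.symm
    exact ih.of_equiv e
  · intro f _
    simp only [Fintype.univ_pempty, Finset.prod_empty]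
    exact ⟨Summable.of_finite, hasSum_unique (fun _ : PEmpty → β => (1 : ℂ))⟩
  · intro α _ ih
    exact ih.option

theorem summable_norm_pi_prod {ι : Type} [Fintype ι] {β : Type} {f : ι → β → ℂ}
    (hf : ∀ i, Summable fun b => ‖f i b‖) : Summable fun x : ι → β => ‖∏ i, f i (x i)‖ :=
  (piProdSums ι β f hf).1

theorem hasSum_pi_prod {ι : Type} [Fintype ι] {β : Type} {f : ι → β → ℂ}
    (hf : ∀ i, Summable fun b => ‖f i b‖) :
    HasSum (fun x : ι → β => ∏ i, f i (x i)) (∏ i, ∑' b, f i b) :=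
  (piProdSums ι β f hf).2

/-! ### Uniqueness of the coefficients of an entire series -/

theorem coeff_eq_zero_of_hasSum_pow {c : ℕ → ℂ} (h : ∀ s : ℂ, HasSum (fun k => s ^ k * c k) 0)
    (k : ℕ) : c k = 0 := by
  have hp : HasFPowerSeriesAt (fun _ : ℂ => (0 : ℂ)) (FormalMultilinearSeries.ofScalars ℂ c) 0 := by
    rw [hasFPowerSeriesAt_iff]
    refine Filter.Eventually.of_forall fun s => ?_
    simpa [FormalMultilinearSeries.coeff_ofScalars] using h s
  have := hp.eq_zero
  have h2 := congrArg (fun p => FormalMultilinearSeries.coeff p k) this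
  simp only [FormalMultilinearSeries.coeff_ofScalars] at h2
  exact h2

/-- Replacing `z` by `s z` and collecting powers of `s` gives a one-variable power series that
vanishes identically. So each homogeneous component is a polynomial vanishing at every point. This
is what makes the result of an integration step unique. -/
theorem eq_zero_of_hasSum_term {n : ℕ} {d : Series n} (h : ∀ z, HasSum (term d z) 0) : d = 0 := by
  have hk : ∀ (k : ℕ) (z : Fin n → ℂ),
      ∑ M ∈ Finset.piAntidiag Finset.univ k, term d z M = 0 := by
    intro k z
    refine coeff_eq_zero_of_hasSum_pow
      (c := fun k => ∑ M ∈ Finset.piAntidiag Finset.univ k, term d z M) (fun s => ?_) k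
    have h1 : HasSum (fun M : Exps n => s ^ (∑ j, M j) * term d z M) 0 := by
      convert h (fun j => s * z j) using 2
      rename_i M
      simp only [term, mul_pow, Finset.prod_mul_distrib, Finset.prod_pow_eq_pow_sum]
      ring
    rw [← (Equiv.sigmaFiberEquiv fun M : Exps n => ∑ j, M j).hasSum_iff] at h1
    refine h1.sigma fun k => ?_
    have h3 := hasSum_fintype (fun M : (Finset.piAntidiag (Finset.univ : Finset (Fin n)) k) =>
      s ^ k * term d z M)
    rw [Finset.sum_coe_sort (Finset.piAntidiag Finset.univ k) (fun M => s ^ k * term d z M),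
      ← Finset.mul_sum] at h3
    let e : {M : Exps n // ∑ j, M j = k} ≃ (Finset.piAntidiag (Finset.univ : Finset (Fin n)) k) :=
      Equiv.subtypeEquivRight fun M => by simp
    rw [← e.hasSum_iff] at h3
    convert h3 using 2
    rename_i M
    obtain ⟨M, rfl⟩ := M
    rfl
  funext M
  let P : MvPolynomial (Fin n) ℂ := ∑ N ∈ Finset.piAntidiag Finset.univ (∑ j, M j),
    MvPolynomial.monomial (Finsupp.equivFunOnFinite.symm N) (d N)
  have hP : P = 0 := by
    refine MvPolynomial.funext fun z => ?_
    rw [map_zero, ← hk (∑ j, M j) z]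
    simp only [P, map_sum, MvPolynomial.eval_monomial, term]
    refine Finset.sum_congr rfl fun N _ => ?_
    congr 1
    rw [Finsupp.prod_fintype _ _ (fun i => pow_zero _)]
    rfl
  have hc := congrArg (MvPolynomial.coeff (Finsupp.equivFunOnFinite.symm M)) hP
  simp only [P, MvPolynomial.coeff_sum, MvPolynomial.coeff_monomial, MvPolynomial.coeff_zero,
    EmbeddingLike.apply_eq_iff_eq] at hc
  rw [Finset.sum_ite_eq' _ M, if_pos (by simp)] at hc
  exact hc

theorem eq_of_hasSum_term {n : ℕ} {f g : Series n} {v : (Fin n → ℂ) → ℂ}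
    (hf : ∀ z, HasSum (term f z) (v z)) (hg : ∀ z, HasSum (term g z) (v z)) : f = g := by
  have : f - g = 0 := by
    refine eq_zero_of_hasSum_term fun z => ?_
    have h1 := (hf z).sub (hg z)
    rw [sub_self] at h1
    have h2 : term (f - g) z = fun M => term f z M - term g z M := by
      funext M
      simp [term, sub_mul]
    rw [h2]
    exact h1
  exact sub_eq_zero.1 this

end BraidedFourier

end

noncomputable section

namespace BraidedFourier

/-! ### Products with monomials and linearity -/

theorem mulW_mono_right {n : ℕ} (w : Exps n → Exps n → ℂ) (F : Series n) (L M : Exps n) :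
    mulW w F (mono L) M = if ∀ i, L i ≤ M i then w (M - L) L * F (M - L) else 0 := by
  simp only [mulW, mono]
  split_ifs with h
  · rw [Finset.sum_eq_single (M - L)]
    · simp [tsub_tsub_cancel_of_le (show L ≤ M from h)]
    · intro K hK hne
      rw [if_neg, mul_zero]
      intro h'
      apply hne
      rw [← h', tsub_tsub_cancel_of_le (Finset.mem_Iic.1 hK)]
    · intro h'
      exact absurd (Finset.mem_Iic.2 tsub_le_self) h'
  · refine Finset.sum_eq_zero fun K hK => ?_
    rw [if_neg, mul_zero]
    rintro rfl
    exact h fun i => Nat.sub_le _ _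

theorem mulW_mono_left {n : ℕ} (w : Exps n → Exps n → ℂ) (F : Series n) (L M : Exps n) :
    mulW w (mono L) F M = if ∀ i, L i ≤ M i then w L (M - L) * F (M - L) else 0 := by
  simp only [mulW, mono]
  split_ifs with h
  · rw [Finset.sum_eq_single L]
    · simp
    · intro K hK hne
      simp [hne]
    · intro h'
      exact absurd (Finset.mem_Iic.2 h) h'
  · refine Finset.sum_eq_zero fun K hK => ?_
    rw [if_neg, mul_zero, zero_mul]
    rintro rfl
    exact h (Finset.mem_Iic.1 hK)

theorem mulW_smul_right {n : ℕ} (w : Exps n → Exps n → ℂ) (c : ℂ) (F G : Series n) :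
    mulW w F (c • G) = c • mulW w F G := by
  funext M
  simp only [mulW, Pi.smul_apply, smul_eq_mul, Finset.mul_sum]
  exact Finset.sum_congr rfl fun K _ => by ring

theorem mulW_smul_left {n : ℕ} (w : Exps n → Exps n → ℂ) (c : ℂ) (F G : Series n) :
    mulW w (c • F) G = c • mulW w F G := by
  funext M
  simp only [mulW, Pi.smul_apply, smul_eq_mul, Finset.mul_sum]
  exact Finset.sum_congr rfl fun K _ => by ring

theorem mulW_sum_right {n : ℕ} {ι : Type} (w : Exps n → Exps n → ℂ) (s : Finset ι)
    (F : Series n) (G : ι → Series n) :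
    mulW w F (∑ i ∈ s, G i) = ∑ i ∈ s, mulW w F (G i) := by
  funext M
  simp only [mulW, Finset.sum_apply, Finset.mul_sum]
  exact Finset.sum_comm

/-! ### Series in one of the variables -/

/-- The series `a(x_j)`. -/
def oneVar {n : ℕ} (j : Fin n) (a : PowerSeries ℂ) : Series n :=
  fun M => if ∀ i, i ≠ j → M i = 0 then PowerSeries.coeff (M j) a else 0

theorem eq_single_of_forall_ne {n : ℕ} {j : Fin n} {M : Exps n} (h : ∀ i, i ≠ j → M i = 0) :
    M = Pi.single j (M j) := by
  funext i
  by_cases hi : i = j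
  · subst hi; simp
  · simp [hi, h i hi]

theorem oneVar_single {n : ℕ} (j : Fin n) (a : PowerSeries ℂ) (m : ℕ) :
    oneVar j a (Pi.single j m) = PowerSeries.coeff m a := by
  unfold oneVar
  rw [if_pos]
  · simp
  · intro i hi; simp [hi]

theorem oneVar_eq_zero {n : ℕ} {j i : Fin n} {a : PowerSeries ℂ} {M : Exps n} (hi : i ≠ j)
    (hM : M i ≠ 0) : oneVar j a M = 0 := by
  unfold oneVar
  rw [if_neg]
  intro h
  exact hM (h i hi)

theorem mono_zero_eq_oneVar {n : ℕ} (j : Fin n) : (mono 0 : Series n) = oneVar j 1 := by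
  funext M
  simp only [mono, oneVar, PowerSeries.coeff_one]
  by_cases h : M = 0
  · subst h; simp
  · rw [if_neg h]
    split_ifs with h1 h2
    · exact absurd (by rw [eq_single_of_forall_ne h1, h2, Pi.single_zero]) h
    · rfl
    · rfl

theorem gen_eq_oneVar {n : ℕ} (j : Fin n) : (gen j : Series n) = oneVar j PowerSeries.X := by
  funext M
  simp only [gen, mono, oneVar, PowerSeries.coeff_X]
  by_cases h : M = Pi.single j 1
  · subst h
    rw [if_pos rfl, if_pos (fun i hi => by simp [hi])]
    simp
  · rw [if_neg h]
    split_ifs with h1 h2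
    · exact absurd (by rw [eq_single_of_forall_ne h1, h2]) h
    · rfl
    · rfl

theorem smul_oneVar {n : ℕ} (j : Fin n) (c : ℂ) (a : PowerSeries ℂ) :
    c • (oneVar j a : Series n) = oneVar j (c • a) := by
  funext M
  simp only [oneVar, Pi.smul_apply, smul_eq_mul, mul_ite, mul_zero, PowerSeries.coeff_smul]

theorem mulW_oneVar {n : ℕ} {w : Exps n → Exps n → ℂ} {j : Fin n}
    (hw : ∀ s t : ℕ, w (Pi.single j s) (Pi.single j t) = 1) (a b : PowerSeries ℂ) :
    mulW w (oneVar j a) (oneVar j b) = oneVar j (a * b) := by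
  funext M
  by_cases h : ∀ i, i ≠ j → M i = 0
  · rw [eq_single_of_forall_ne h, oneVar_single, PowerSeries.coeff_mul,
      Finset.Nat.sum_antidiagonal_eq_sum_range_succ
        (fun k l => PowerSeries.coeff k a * PowerSeries.coeff l b)]
    unfold mulW
    symm
    refine Finset.sum_bij' (fun k _ => Pi.single j k) (fun K _ => K j) ?_ ?_ ?_ ?_ ?_
    · intro k hk
      rw [Finset.mem_Iic]
      exact Pi.single_mono (f := fun _ => ℕ) j (Nat.lt_succ_iff.1 (Finset.mem_range.1 hk))
    · intro K hK
      have := Finset.mem_Iic.1 hK j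
      simp only [Pi.single_eq_same] at this
      exact Finset.mem_range.2 (Nat.lt_succ_of_le this)
    · intro k _
      simp
    · intro K hK
      refine (eq_single_of_forall_ne fun i hi => ?_).symm
      have := Finset.mem_Iic.1 hK i
      simpa [hi] using this
    · intro k _
      have : (Pi.single j (M j) - Pi.single j k : Exps n) = Pi.single j (M j - k) := by
        funext i
        by_cases hi : i = j
        · subst hi; simp
        · simp [hi]
      rw [this, hw, oneVar_single, oneVar_single, one_mul]
  · push Not at h
    obtain ⟨i, hi, hM⟩ := h
    rw [oneVar_eq_zero hi hM]
    refine Finset.sum_eq_zero fun K hK => ?_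
    by_cases hK0 : K i = 0
    · rw [oneVar_eq_zero (M := M - K) hi (by simpa [hK0] using hM), mul_zero]
    · rw [oneVar_eq_zero (M := K) hi hK0, mul_zero, zero_mul]

theorem powW_oneVar {n : ℕ} {w : Exps n → Exps n → ℂ} {j : Fin n}
    (hw : ∀ s t : ℕ, w (Pi.single j s) (Pi.single j t) = 1) (a : PowerSeries ℂ) (k : ℕ) :
    powW w (oneVar j a) k = oneVar j (a ^ k) := by
  induction k with
  | zero => rw [powW, pow_zero, mono_zero_eq_oneVar j]
  | succ k ih => rw [powW, ih, mulW_oneVar hw, pow_succ]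

theorem compW_oneVar {n : ℕ} {w : Exps n → Exps n → ℂ} {j : Fin n}
    (hw : ∀ s t : ℕ, w (Pi.single j s) (Pi.single j t) = 1) (φ a b : PowerSeries ℂ)
    (hb : ∀ m, PowerSeries.coeff m b =
      ∑ k ∈ Finset.range (m + 1), PowerSeries.coeff k φ * PowerSeries.coeff m (a ^ k)) :
    compW w φ (oneVar j a) = oneVar j b := by
  funext M
  simp only [compW, powW_oneVar hw]
  by_cases h : ∀ i, i ≠ j → M i = 0
  · rw [eq_single_of_forall_ne h]
    simp only [oneVar_single, Finset.sum_pi_single', Finset.mem_univ, if_true, hb]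
  · push Not at h
    obtain ⟨i, hi, hM⟩ := h
    simp only [oneVar_eq_zero hi hM, mul_zero, Finset.sum_const_zero]

theorem compW_gen {n : ℕ} {w : Exps n → Exps n → ℂ} {j : Fin n}
    (hw : ∀ s t : ℕ, w (Pi.single j s) (Pi.single j t) = 1) (φ : PowerSeries ℂ) :
    compW w φ (gen j) = oneVar j φ := by
  rw [gen_eq_oneVar]
  refine compW_oneVar hw _ _ _ fun m => ?_
  simp [PowerSeries.coeff_X_pow]

/-- The series `φ(c t²)`. -/
def sqSubst (φ : PowerSeries ℂ) (c : ℂ) : PowerSeries ℂ :=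
  PowerSeries.mk fun m => if Even m then PowerSeries.coeff (m / 2) φ * c ^ (m / 2) else 0

theorem compW_smul_sq {n : ℕ} {w : Exps n → Exps n → ℂ} {j : Fin n}
    (hw : ∀ s t : ℕ, w (Pi.single j s) (Pi.single j t) = 1) (φ : PowerSeries ℂ) (c : ℂ) :
    compW w φ (c • powW w (gen j) 2) = oneVar j (sqSubst φ c) := by
  rw [gen_eq_oneVar, powW_oneVar hw, smul_oneVar]
  refine compW_oneVar hw _ _ _ fun m => ?_
  simp only [sqSubst, PowerSeries.coeff_mk, smul_pow, PowerSeries.coeff_smul, smul_eq_mul,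
    ← pow_mul, PowerSeries.coeff_X_pow]
  split_ifs with h
  · obtain ⟨r, rfl⟩ := h
    rw [Finset.sum_eq_single r]
    · rw [if_pos (by ring), mul_one, show (r + r) / 2 = r by omega]
    · intro k _ hk
      rw [if_neg (by omega), mul_zero, mul_zero]
    · intro h
      exact absurd (Finset.mem_range.2 (by omega)) h
  · symm
    refine Finset.sum_eq_zero fun k _ => ?_
    rw [if_neg, mul_zero, mul_zero]
    rintro rfl
    exact h (even_two_mul k)

/-- `W` is the total reordering factor of an increasing product of powers; `hW` builds it up one
variable at a time from the left. In the convolution only the splitting that gives the whole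
exponent of `j` to the first factor survives, since the tail does not contain that variable. -/
theorem foldr_mulW_oneVar {n : ℕ} {w : Exps n → Exps n → ℂ} {W : Exps n → ℂ} (hW0 : W 0 = 1)
    (hW : ∀ (j : Fin n) (m : ℕ) (L : Exps n), (∀ i, i ≤ j → L i = 0) →
      W (Pi.single j m + L) = w (Pi.single j m) L * W L)
    (a : Fin n → PowerSeries ℂ) (l : List (Fin n)) (hl : l.Pairwise (· < ·)) (M : Exps n) :
    (l.map fun j => oneVar j (a j)).foldr (mulW w) (mono 0) M =
      if ∀ i, i ∉ l → M i = 0 then W M * (l.map fun j => PowerSeries.coeff (M j) (a j)).prod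
      else 0 := by
  induction l generalizing M with
  | nil =>
    simp only [List.map_nil, List.foldr_nil, mono, List.not_mem_nil, not_false_eq_true,
      forall_const, List.prod_nil, mul_one]
    by_cases h : M = 0
    · subst h; simp [hW0]
    · rw [if_neg h, if_neg]
      intro h'
      exact h (funext h')
  | cons j l ih =>
    rw [List.pairwise_cons] at hl
    have ih' := ih hl.2
    rw [List.map_cons, List.foldr_cons]
    have hjl : j ∉ l := fun h => lt_irrefl j (hl.1 j h)
    change ∑ K ∈ Finset.Iic M, w K (M - K) * oneVar j (a j) K *
      (l.map fun j => oneVar j (a j)).foldr (mulW w) (mono 0) (M - K) = _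
    rw [Finset.sum_eq_single (Pi.single j (M j))]
    · rw [oneVar_single, ih']
      have hsub : ∀ i, i ≠ j → (M - Pi.single j (M j) : Exps n) i = M i := by
        intro i hi; simp [hi]
      have hsubj : (M - Pi.single j (M j) : Exps n) j = 0 := by simp
      by_cases h : ∀ i, i ∉ j :: l → M i = 0
      · have h2 : ∀ i, i ∉ l → (M - Pi.single j (M j) : Exps n) i = 0 := by
          intro i hi
          by_cases hij : i = j
          · subst hij; exact hsubj
          · rw [hsub i hij]
            exact h i (by simp [hij, hi])
        rw [if_pos h, if_pos h2]
        have hM : Pi.single j (M j) + (M - Pi.single j (M j)) = M := by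
          refine add_tsub_cancel_of_le fun i => ?_
          by_cases hij : i = j
          · subst hij; simp
          · simp [hij]
        have h3 := hW j (M j) (M - Pi.single j (M j)) (by
          intro i hi
          refine h2 i fun hil => ?_
          exact absurd (hl.1 i hil) (not_lt.2 hi))
        rw [hM] at h3
        rw [h3, List.map_cons, List.prod_cons]
        have h4 : (l.map fun i => PowerSeries.coeff ((M - Pi.single j (M j) : Exps n) i) (a i)) =
            l.map fun i => PowerSeries.coeff (M i) (a i) := by
          refine List.map_congr_left fun i hi => ?_
          rw [hsub i]
          rintro rfl
          exact hjl hi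
        rw [h4]
        ring
      · rw [if_neg h, if_neg, mul_zero]
        intro h'
        apply h
        intro i hi
        rw [← hsub i (fun hij => hi (by simp [hij]))]
        exact h' i (fun hil => hi (by simp [hil]))
    · intro K hK hne
      by_cases hKs : ∀ i, i ≠ j → K i = 0
      · have hKj : K j ≠ M j := by
          intro h
          apply hne
          rw [← h]
          exact eq_single_of_forall_ne hKs
        have hle : K j ≤ M j := Finset.mem_Iic.1 hK j
        have := ih' (M - K)
        rw [if_neg] at this
        · rw [this, mul_zero]
        · intro h'
          have := h' j hjl
          simp only [Pi.sub_apply] at this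
          omega
      · push Not at hKs
        obtain ⟨i, hi, hK0⟩ := hKs
        rw [oneVar_eq_zero (M := K) hi hK0, mul_zero, zero_mul]
    · intro h
      refine absurd (Finset.mem_Iic.2 ?_) h
      intro i
      by_cases hij : i = j
      · subst hij; simp
      · simp [hij]

theorem prodW_oneVar {n : ℕ} {w : Exps n → Exps n → ℂ} {W : Exps n → ℂ} (hW0 : W 0 = 1)
    (hW : ∀ (j : Fin n) (m : ℕ) (L : Exps n), (∀ i, i ≤ j → L i = 0) →
      W (Pi.single j m + L) = w (Pi.single j m) L * W L)
    (a : Fin n → PowerSeries ℂ) (M : Exps n) :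
    prodW w (fun j => oneVar j (a j)) M = W M * ∏ j, PowerSeries.coeff (M j) (a j) := by
  unfold prodW
  rw [List.ofFn_eq_map, foldr_mulW_oneVar hW0 hW a _ (List.pairwise_lt_finRange n), if_pos,
    ← List.ofFn_eq_map, List.prod_ofFn]
  intro i hi
  exact absurd (List.mem_finRange i) hi

/-! ### The weights -/

theorem xWeight_single_single {n : ℕ} (q : ℝ) (j : Fin n) (s t : ℕ) :
    xWeight q (Pi.single j s : Exps n) (Pi.single j t) = 1 := by
  unfold xWeight
  rw [Finset.sum_eq_zero, pow_zero]
  intro i _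
  refine Finset.sum_eq_zero fun k hk => ?_
  have := Finset.mem_Iio.1 hk
  by_cases hi : i = j
  · subst hi; simp [this.ne]
  · simp [hi]

theorem dWeight_eq_xWeight {n : ℕ} (q : ℝ) (K L : Exps n) : dWeight q K L = xWeight q L K := by
  simp only [dWeight, xWeight, mul_comm]

theorem dWeight_single_single {n : ℕ} (q : ℝ) (j : Fin n) (s t : ℕ) :
    dWeight q (Pi.single j s : Exps n) (Pi.single j t) = 1 := by
  rw [dWeight_eq_xWeight, xWeight_single_single]

theorem xWeight_single_left {n : ℕ} (q : ℝ) (j : Fin n) (m : ℕ) (L : Exps n) :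
    xWeight q (Pi.single j m) L = (q : ℂ) ^ (m * ∑ i ∈ Finset.Iio j, L i) := by
  unfold xWeight
  rw [Finset.sum_eq_single j]
  · simp [Finset.mul_sum]
  · intro i _ hi
    simp [hi]
  · simp

theorem xWeight_single_right {n : ℕ} (q : ℝ) (j : Fin n) (m : ℕ) (L : Exps n) :
    xWeight q L (Pi.single j m) = (q : ℂ) ^ (m * ∑ i ∈ Finset.Ioi j, L i) := by
  unfold xWeight
  rw [Finset.sum_comm' (t' := Finset.univ) (s' := fun i => Finset.Ioi i) (by simp),
    Finset.sum_eq_single j]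
  · simp [Finset.mul_sum, mul_comm]
  · intro i _ hi
    simp [hi]
  · simp

theorem dWeight_single_left {n : ℕ} (q : ℝ) (j : Fin n) (m : ℕ) (L : Exps n) :
    dWeight q (Pi.single j m) L = (q : ℂ) ^ (m * ∑ i ∈ Finset.Ioi j, L i) := by
  rw [dWeight_eq_xWeight, xWeight_single_right]

theorem dWeight_single_right {n : ℕ} (q : ℝ) (j : Fin n) (m : ℕ) (L : Exps n) :
    dWeight q L (Pi.single j m) = (q : ℂ) ^ (m * ∑ i ∈ Finset.Iio j, L i) := by
  rw [dWeight_eq_xWeight, xWeight_single_left]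

/-- `∑_{i<j} MᵢMⱼ`. -/
def pairSum {n : ℕ} (M : Exps n) : ℕ := ∑ i, ∑ j ∈ Finset.Iio i, M j * M i

theorem pairSum_single_add {n : ℕ} (j : Fin n) (m : ℕ) (L : Exps n) (hL : ∀ i, i ≤ j → L i = 0) :
    pairSum (Pi.single j m + L) = m * ∑ i ∈ Finset.Ioi j, L i + pairSum L := by
  unfold pairSum
  have h : ∀ i, ∑ k ∈ Finset.Iio i, (Pi.single j m + L : Exps n) k * (Pi.single j m + L : Exps n) i =
      (if j < i then m * L i else 0) + ∑ k ∈ Finset.Iio i, L k * L i := by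
    intro i
    by_cases hi : j < i
    · have hLi : (Pi.single j m + L : Exps n) i = L i := by simp [hi.ne']
      rw [hLi, if_pos hi]
      simp only [Pi.add_apply, add_mul, Finset.sum_add_distrib]
      congr 1
      rw [Finset.sum_eq_single j]
      · simp
      · intro k _ hk; simp [hk]
      · intro h; exact absurd (Finset.mem_Iio.2 hi) h
    · rw [if_neg hi, zero_add]
      refine Finset.sum_congr rfl fun k hk => ?_
      have hk' := (Finset.mem_Iio.1 hk).trans_le (not_lt.1 hi)
      simp [hk'.ne, hL k hk'.le]
  rw [Finset.sum_congr rfl fun i _ => h i, Finset.sum_add_distrib, ← Finset.sum_filter,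
    ← Finset.mul_sum]
  congr 3
  ext i
  simp

theorem prodW_xWeight_oneVar {n : ℕ} (q : ℝ) (a : Fin n → PowerSeries ℂ) (M : Exps n) :
    prodW (xWeight q) (fun j => oneVar j (a j)) M = ∏ j, PowerSeries.coeff (M j) (a j) := by
  rw [prodW_oneVar (W := fun _ => 1) rfl, one_mul]
  intro j m L hL
  rw [xWeight_single_left, Finset.sum_eq_zero]
  · simp
  · intro i hi
    exact hL i (Finset.mem_Iio.1 hi).le

/-- The product is increasing but the normal form in the `∂ⱼ` is decreasing, so every pair of
variables must be exchanged, at the cost of `q^{MᵢMⱼ}`. For the `xⱼ` both orders agree and no factor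
appears. -/
theorem prodW_dWeight_oneVar {n : ℕ} (q : ℝ) (a : Fin n → PowerSeries ℂ) (M : Exps n) :
    prodW (dWeight q) (fun j => oneVar j (a j)) M =
      (q : ℂ) ^ pairSum M * ∏ j, PowerSeries.coeff (M j) (a j) := by
  rw [prodW_oneVar (W := fun M => (q : ℂ) ^ pairSum M)]
  · simp [pairSum]
  · intro j m L hL
    rw [dWeight_single_left, pairSum_single_add j m L hL, pow_add]

/-! ### The classes in normal order -/

/-- `e_{q⁴}(-t²)`. -/
def gaussSmall (q : ℝ) : PowerSeries ℂ := sqSubst (eSeries (q ^ 4)) (-1)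

/-- `E_{q⁴}(-q⁴t²)`. -/
def gaussBig (q : ℝ) : PowerSeries ℂ := sqSubst (ESeries (q ^ 4)) (-(q : ℂ) ^ 4)

theorem xClass_apply {n : ℕ} (q : ℝ) (p : Fin n → Polynomial ℂ) (M : Exps n) :
    xClass q p M = ∏ j, PowerSeries.coeff (M j) ((p j : PowerSeries ℂ) * gaussSmall q) := by
  unfold xClass
  rw [← prodW_xWeight_oneVar q]
  congr 2
  funext j
  rw [compW_gen (xWeight_single_single q j), ← neg_one_smul ℂ (powW _ _ _),
    compW_smul_sq (xWeight_single_single q j), mulW_oneVar (xWeight_single_single q j)]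
  rfl

theorem dClass_apply {n : ℕ} (q : ℝ) (p : Fin n → Polynomial ℂ) (M : Exps n) :
    dClass q p M = (q : ℂ) ^ pairSum M *
      ∏ j, PowerSeries.coeff (M j) (gaussBig q * (p j : PowerSeries ℂ)) := by
  unfold dClass
  rw [← prodW_dWeight_oneVar q]
  congr 2
  funext j
  rw [compW_gen (dWeight_single_single q j), compW_smul_sq (dWeight_single_single q j),
    mulW_oneVar (dWeight_single_single q j)]
  rfl

end BraidedFourier

end

noncomputable section

namespace BraidedFourier

/-! ### The Gaussians in normal order -/

theorem qPoch_succ (p : ℝ) (k : ℕ) : qPoch p (k + 1) = qPoch p k * (1 - p ^ (k + 1)) :=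
  Finset.prod_range_succ _ _

theorem qPoch_zero (p : ℝ) : qPoch p 0 = 1 := Finset.prod_range_zero _

theorem qPoch_pos {p : ℝ} (h0 : 0 < p) (h1 : p < 1) (k : ℕ) : 0 < qPoch p k :=
  Finset.prod_pos fun l _ => sub_pos.2 (pow_lt_one₀ h0.le h1 l.succ_ne_zero)

theorem qPoch_ne_zero {p : ℝ} (h0 : 0 < p) (h1 : p < 1) (k : ℕ) : (qPoch p k : ℂ) ≠ 0 :=
  Complex.ofReal_ne_zero.2 (qPoch_pos h0 h1 k).ne'

/-- Powers of `c ∑ⱼ yⱼ²` when the squares of the generators `q`-commute. -/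
theorem powW_sum_sq {n : ℕ} {p : ℝ} (h0 : 0 < p) (h1 : p < 1) {w : Exps n → Exps n → ℂ}
    {T : Exps n → Fin n → ℕ} (c : ℂ)
    (hw : ∀ (K : Exps n) j, w (fun i => 2 * K i) (Pi.single j 2) = (p : ℂ) ^ T K j)
    (hT : ∀ (K : Exps n) j, T (K - Pi.single j 1) j = T K j)
    (htel : ∀ K : Exps n, ∑ j, p ^ T K j * (1 - p ^ K j) = 1 - p ^ ∑ j, K j) (k : ℕ) (M : Exps n) :
    powW w (c • ∑ j, mono (Pi.single j 2)) k M =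
      if (∀ j, Even (M j)) ∧ ∑ j, M j / 2 = k then
        c ^ k * (qPoch p k * ∏ j, (qPoch p (M j / 2) : ℂ)⁻¹) else 0 := by
  induction k generalizing M with
  | zero =>
    simp only [powW, mono, pow_zero, qPoch_zero, Complex.ofReal_one, one_mul]
    by_cases h : M = 0
    · subst h; simp [qPoch_zero]
    · rw [if_neg h, if_neg]
      rintro ⟨he, hs⟩
      apply h
      funext j
      have := (Finset.sum_eq_zero_iff.1 hs) j (Finset.mem_univ j)
      obtain ⟨r, hr⟩ := he j
      simp only [Pi.zero_apply]
      omega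
  | succ k ih =>
    rw [powW, mulW_smul_right, mulW_sum_right, Pi.smul_apply, Finset.sum_apply, smul_eq_mul]
    simp only [mulW_mono_right]
    by_cases he : (∀ j, Even (M j)) ∧ ∑ j, M j / 2 = k + 1
    · rw [if_pos he]
      obtain ⟨he, hs⟩ := he
      choose K hK using he
      have hM : M = fun i => 2 * K i := by funext i; rw [hK i]; ring
      have hMK : ∀ j, M j / 2 = K j := by intro j; have := hK j; omega
      simp only [hMK] at hs ⊢
      -- The `p`-multinomial theorem: the `j`-th summand is the multinomial coefficient of `K` times
      -- a weight, and `htel`, the Pascal rule, sums the weights.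
      have key : ∀ j, (if ∀ i, (Pi.single j 2 : Exps n) i ≤ M i then
          w (M - Pi.single j 2) (Pi.single j 2) *
            powW w (c • ∑ j, mono (Pi.single j 2)) k (M - Pi.single j 2) else 0) =
          c ^ k * (qPoch p k * ∏ j, (qPoch p (K j) : ℂ)⁻¹) *
            ((p ^ T K j * (1 - p ^ K j) : ℝ) : ℂ) := by
        intro j
        split_ifs with hle
        · have hj : 1 ≤ K j := by
            have h2 := hle j
            have h3 := hK j
            simp only [Pi.single_eq_same] at h2
            omega
          have hsub : M - Pi.single j 2 = fun i => 2 * (K - Pi.single j 1 : Exps n) i := by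
            funext i
            by_cases hi : i = j
            · subst hi
              have h3 := hK i
              simp only [Pi.sub_apply, Pi.single_eq_same]
              omega
            · have h3 := hK i
              simp only [Pi.sub_apply, Pi.single_eq_of_ne hi]
              omega
          rw [hsub, hw, hT, ih]
          have hd : ∀ i, 2 * (K - Pi.single j 1 : Exps n) i / 2 = (K - Pi.single j 1 : Exps n) i :=
            fun i => by omega
          simp only [hd]
          have hone : ∀ i, (Pi.single j 1 : Exps n) i ≤ K i := by
            intro i
            by_cases hi : i = j
            · subst hi; simpa using hj
            · simp [hi]
          have hsum : ∑ i, (K - Pi.single j 1 : Exps n) i = k := by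
            have h4 : ∑ i, ((K - Pi.single j 1 : Exps n) i + (Pi.single j 1 : Exps n) i) =
                ∑ i, K i := by
              refine Finset.sum_congr rfl fun i _ => ?_
              exact Nat.sub_add_cancel (hone i)
            rw [Finset.sum_add_distrib] at h4
            simp only [Finset.sum_pi_single', Finset.mem_univ, if_true] at h4
            omega
          rw [if_pos ⟨fun i => even_two_mul _, hsum⟩]
          have hprod : ∏ i, (qPoch p ((K - Pi.single j 1 : Exps n) i) : ℂ)⁻¹ =
              (1 - (p : ℂ) ^ K j) * ∏ i, (qPoch p (K i) : ℂ)⁻¹ := by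
            rw [← Finset.mul_prod_erase _ _ (Finset.mem_univ j),
              ← Finset.mul_prod_erase _ (fun i => (qPoch p (K i) : ℂ)⁻¹) (Finset.mem_univ j),
              ← mul_assoc]
            congr 1
            · obtain ⟨r, hr⟩ : ∃ r, K j = r + 1 := ⟨K j - 1, by omega⟩
              have h5 := qPoch_ne_zero h0 h1 (r + 1)
              rw [qPoch_succ] at h5
              simp only [Pi.sub_apply, Pi.single_eq_same, hr, Nat.add_sub_cancel, qPoch_succ]
              push_cast at h5 ⊢
              field_simp [left_ne_zero_of_mul h5, right_ne_zero_of_mul h5]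
            · refine Finset.prod_congr rfl fun i hi => ?_
              simp [Finset.ne_of_mem_erase hi]
          rw [hprod]
          push_cast
          ring
        -- A variable that does not occur contributes nothing, in accordance with the weight `1 -
        -- p^0 = 0`.
        · have hj : K j = 0 := by
            by_contra hne
            apply hle
            intro i
            by_cases hi : i = j
            · subst hi
              have h3 := hK i
              simp only [Pi.single_eq_same]
              omega
            · simp [hi]
          simp [hj]
      rw [Finset.sum_congr rfl fun j _ => key j, ← Finset.mul_sum, ← Complex.ofReal_sum, htel, hs,
        qPoch_succ]
      push_cast
      ring
    · rw [if_neg he, Finset.sum_eq_zero, mul_zero]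
      intro j _
      split_ifs with hle
      · rw [ih, if_neg, mul_zero]
        rintro ⟨h2, h3⟩
        apply he
        have hj : 2 ≤ M j := by simpa using hle j
        have hM : ∀ i, M i = (M - Pi.single j 2 : Exps n) i + (Pi.single j 2 : Exps n) i :=
          fun i => (Nat.sub_add_cancel (hle i)).symm
        constructor
        · intro i
          rw [hM i]
          refine (h2 i).add ?_
          by_cases hi : i = j
          · subst hi; simp
          · simp [hi]
        · have h4 : ∀ i, M i / 2 = (M - Pi.single j 2 : Exps n) i / 2 + (Pi.single j 1 : Exps n) i := by
            intro i
            by_cases hi : i = j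
            · subst hi
              simp only [Pi.sub_apply, Pi.single_eq_same]
              omega
            · simp [hi]
          rw [Finset.sum_congr rfl fun i _ => h4 i, Finset.sum_add_distrib, h3]
          simp
      · rfl

theorem sum_telescope_Ioi {n : ℕ} (p : ℝ) (K : Exps n) :
    ∑ j, p ^ (∑ i ∈ Finset.Ioi j, K i) * (1 - p ^ K j) = 1 - p ^ ∑ j, K j := by
  have h := Finset.prod_add_ordered (Finset.univ : Finset (Fin n)) (fun j => p ^ K j)
    (fun j => 1 - p ^ K j)
  simp only [add_sub_cancel, Finset.prod_const_one, mul_one, Finset.prod_pow_eq_pow_sum] at h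
  rw [eq_sub_iff_add_eq, add_comm]
  symm
  convert h using 2
  refine Finset.sum_congr rfl fun j _ => ?_
  rw [mul_comm]
  congr 3
  ext i
  simp

theorem sum_telescope_Iio {n : ℕ} (p : ℝ) (K : Exps n) :
    ∑ j, p ^ (∑ i ∈ Finset.Iio j, K i) * (1 - p ^ K j) = 1 - p ^ ∑ j, K j := by
  have h := Finset.prod_one_sub_ordered (Finset.univ : Finset (Fin n)) (fun j => 1 - p ^ K j)
  simp only [sub_sub_cancel, Finset.prod_pow_eq_pow_sum] at h
  rw [h, sub_sub_cancel]
  refine Finset.sum_congr rfl fun j _ => ?_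
  rw [mul_comm]
  congr 3
  ext i
  simp

theorem compW_sum_sq {n : ℕ} {p : ℝ} (h0 : 0 < p) (h1 : p < 1) {w : Exps n → Exps n → ℂ}
    {T : Exps n → Fin n → ℕ} (c : ℂ)
    (hw : ∀ (K : Exps n) j, w (fun i => 2 * K i) (Pi.single j 2) = (p : ℂ) ^ T K j)
    (hT : ∀ (K : Exps n) j, T (K - Pi.single j 1) j = T K j)
    (htel : ∀ K : Exps n, ∑ j, p ^ T K j * (1 - p ^ K j) = 1 - p ^ ∑ j, K j)
    (φ : PowerSeries ℂ) (M : Exps n) :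
    compW w φ (c • ∑ j, mono (Pi.single j 2)) M =
      if ∀ j, Even (M j) then PowerSeries.coeff (∑ j, M j / 2) φ * (c ^ (∑ j, M j / 2) *
        (qPoch p (∑ j, M j / 2) * ∏ j, (qPoch p (M j / 2) : ℂ)⁻¹)) else 0 := by
  unfold compW
  simp only [powW_sum_sq h0 h1 c hw hT htel]
  split_ifs with he
  · rw [Finset.sum_eq_single (∑ j, M j / 2)]
    · rw [if_pos ⟨he, rfl⟩]
    · intro k _ hk
      rw [if_neg (fun h => hk h.2.symm), mul_zero]
    · intro h
      refine absurd (Finset.mem_range.2 (Nat.lt_succ_of_le ?_)) h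
      exact Finset.sum_le_sum fun j _ => Nat.div_le_self _ _
  · refine Finset.sum_eq_zero fun k _ => ?_
    rw [if_neg (fun h => he h.1), mul_zero]

theorem oneVar_X_sq {n : ℕ} (j : Fin n) : (oneVar j (PowerSeries.X ^ 2) : Series n) =
    mono (Pi.single j 2) := by
  funext M
  simp only [mono, oneVar, PowerSeries.coeff_X_pow]
  by_cases h : M = Pi.single j 2
  · subst h
    rw [if_pos rfl, if_pos (fun i hi => by simp [hi])]
    simp
  · rw [if_neg h]
    split_ifs with h1 h2
    · exact absurd (by rw [eq_single_of_forall_ne h1, h2]) h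
    · rfl
    · rfl

/-- The squares `xⱼ²` commute up to `q⁴`, so the `k`-th power of their sum carries `(q⁴;q⁴)ₖ`. This
cancels the denominator of `e_{q⁴}`, and the exponential of the sum factorizes. -/
theorem gaussX_apply {n : ℕ} {q : ℝ} (hq0 : 0 < q) (hq1 : q < 1) (M : Exps n) :
    gaussX n q M = ∏ j, PowerSeries.coeff (M j) (gaussSmall q) := by
  have h0 : 0 < q ^ 4 := by positivity
  have h1 : q ^ 4 < 1 := pow_lt_one₀ hq0.le hq1 (by norm_num)
  unfold gaussX
  have ha : -∑ j, powW (xWeight q) (gen j) 2 = (-1 : ℂ) • ∑ j : Fin n, mono (Pi.single j 2) := by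
    rw [neg_one_smul]
    congr 1
    refine Finset.sum_congr rfl fun j _ => ?_
    rw [gen_eq_oneVar, powW_oneVar (xWeight_single_single q j), oneVar_X_sq]
  rw [ha, compW_sum_sq h0 h1 (T := fun K j => ∑ i ∈ Finset.Ioi j, K i)]
  · simp only [gaussSmall, sqSubst, PowerSeries.coeff_mk, eSeries]
    split_ifs with he
    · rw [Finset.prod_congr rfl fun j _ => if_pos (he j), Finset.prod_mul_distrib,
        Finset.prod_pow_eq_pow_sum]
      have := qPoch_ne_zero h0 h1 (∑ j, M j / 2)
      push_cast at this ⊢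
      simp only [one_div]
      field_simp
    · push Not at he
      obtain ⟨j, hj⟩ := he
      symm
      exact Finset.prod_eq_zero (Finset.mem_univ j) (if_neg (by simpa using hj))
  · intro K j
    rw [xWeight_single_right, Complex.ofReal_pow, ← pow_mul, ← Finset.mul_sum]
    congr 1
    ring
  · intro K j
    refine Finset.sum_congr rfl fun i hi => ?_
    simp [(Finset.mem_Ioi.1 hi).ne']
  · exact sum_telescope_Ioi _

theorem two_mul_sq_add_two_mul (k : ℕ) : 2 * k ^ 2 + 2 * k = 4 * (k * (k - 1) / 2) + 4 * k := by
  obtain ⟨r, hr⟩ := (Nat.even_mul_pred_self k).two_dvd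
  rw [hr, Nat.mul_div_cancel_left _ two_pos]
  cases k with
  | zero => simp at hr; simp [hr]
  | succ k => simp only [Nat.add_sub_cancel] at hr; nlinarith

/-- The same cancellation as for `gaussX_apply`, but the numerator `q^{2k(k-1)}` of `E_{q⁴}`
remains, with `k` the total degree in the squares. Together with `q^{4k}` it gives the coupling
`q^{2k²+2k}`. -/
theorem gaussD_apply {n : ℕ} {q : ℝ} (hq0 : 0 < q) (hq1 : q < 1) (M : Exps n) :
    gaussD n q M = if ∀ j, Even (M j) then (-1) ^ (∑ j, M j / 2) *
      (q : ℂ) ^ (2 * (∑ j, M j / 2) ^ 2 + 2 * ∑ j, M j / 2) *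
        ∏ j, (qPoch (q ^ 4) (M j / 2) : ℂ)⁻¹ else 0 := by
  have h0 : 0 < q ^ 4 := by positivity
  have h1 : q ^ 4 < 1 := pow_lt_one₀ hq0.le hq1 (by norm_num)
  unfold gaussD
  have ha : -∑ j, powW (dWeight q) (((q : ℂ) ^ 2) • gen j) 2 =
      (-(q : ℂ) ^ 4) • ∑ j : Fin n, mono (Pi.single j 2) := by
    rw [neg_smul, Finset.smul_sum]
    congr 1
    refine Finset.sum_congr rfl fun j _ => ?_
    rw [gen_eq_oneVar, smul_oneVar, powW_oneVar (dWeight_single_single q j), ← oneVar_X_sq,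
      smul_oneVar, smul_pow, ← pow_mul]
  rw [ha, compW_sum_sq h0 h1 (T := fun K j => ∑ i ∈ Finset.Iio j, K i)]
  · split_ifs with he
    · set k := ∑ j, M j / 2
      have := qPoch_ne_zero h0 h1 k
      have hk : (q : ℂ) ^ (2 * k ^ 2 + 2 * k) = ((q : ℂ) ^ 4) ^ (k * (k - 1) / 2) * ((q : ℂ) ^ 4) ^ k := by
        rw [← pow_mul, ← pow_mul, ← pow_add]
        congr 1
        exact two_mul_sq_add_two_mul k
      rw [hk, neg_pow]
      simp only [ESeries, PowerSeries.coeff_mk]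
      push_cast at this ⊢
      field_simp
    · rfl
  · intro K j
    rw [dWeight_single_right, Complex.ofReal_pow, ← pow_mul, ← Finset.mul_sum]
    congr 1
    ring
  · intro K j
    refine Finset.sum_congr rfl fun i hi => ?_
    simp [(Finset.mem_Iio.1 hi).ne]
  · exact sum_telescope_Iio _

end BraidedFourier

end

noncomputable section

namespace BraidedFourier

open Filter Topology

/-! ### The entire function `E_p` -/

/-- The coefficients of `E_p`. -/
def bigCoeff (p : ℝ) (k : ℕ) : ℝ := p ^ (k * (k - 1) / 2) / qPoch p k

/-- The sum of the series `E_p`. -/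
def bigE (p : ℝ) (w : ℂ) : ℂ := ∑' k, (bigCoeff p k : ℂ) * w ^ k

section
variable {p : ℝ} (h0 : 0 < p) (h1 : p < 1)
include h0 h1

theorem bigCoeff_pos (k : ℕ) : 0 < bigCoeff p k := div_pos (pow_pos h0 _) (qPoch_pos h0 h1 k)

theorem bigCoeff_succ (k : ℕ) : bigCoeff p (k + 1) * (1 - p ^ (k + 1)) = p ^ k * bigCoeff p k := by
  have h2 := (qPoch_pos h0 h1 k).ne'
  have h3 : 1 - p ^ (k + 1) ≠ 0 := (sub_pos.2 (pow_lt_one₀ h0.le h1 k.succ_ne_zero)).ne'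
  have h4 : (k + 1) * (k + 1 - 1) / 2 = k + k * (k - 1) / 2 := by
    rw [Nat.add_sub_cancel]
    have := Nat.triangle_succ k
    rw [Nat.add_sub_cancel] at this
    omega
  unfold bigCoeff
  rw [qPoch_succ, h4, pow_add]
  field_simp

theorem summable_bigCoeff (R : ℝ) : Summable fun k => bigCoeff p k * R ^ k := by
  by_cases hR : R = 0
  · subst hR
    refine summable_of_ne_finset_zero (s := {0}) fun k hk => ?_
    simp only [Finset.mem_singleton] at hk
    simp [hk]
  refine summable_of_ratio_test_tendsto_lt_one (l := 0) one_pos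
    (Eventually.of_forall fun k => mul_ne_zero (bigCoeff_pos h0 h1 k).ne' (pow_ne_zero _ hR)) ?_
  have hlim : Tendsto (fun k : ℕ => p ^ k / (1 - p ^ (k + 1)) * |R|) atTop (𝓝 0) := by
    have ha := tendsto_pow_atTop_nhds_zero_of_lt_one h0.le h1
    have hb := (tendsto_add_atTop_iff_nat 1).2 ha
    have hc := (ha.div (tendsto_const_nhds.sub hb) (by norm_num : (1 : ℝ) - 0 ≠ 0)).mul_const |R|
    simpa using hc
  refine hlim.congr fun k => ?_
  have h3 : 0 < 1 - p ^ (k + 1) := sub_pos.2 (pow_lt_one₀ h0.le h1 k.succ_ne_zero)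
  have h4 := bigCoeff_succ h0 h1 k
  have h5 := bigCoeff_pos h0 h1 k
  have h6 : bigCoeff p (k + 1) = p ^ k / (1 - p ^ (k + 1)) * bigCoeff p k := by
    rw [div_mul_eq_mul_div, eq_div_iff h3.ne', h4]
  rw [h6, Real.norm_eq_abs, Real.norm_eq_abs, abs_mul, abs_mul, abs_mul, pow_succ R, abs_mul,
    abs_of_pos h5, abs_of_pos (div_pos (pow_pos h0 _) h3)]
  have : |R ^ k| ≠ 0 := abs_ne_zero.2 (pow_ne_zero _ hR)
  field_simp

theorem summable_norm_bigE (w : ℂ) : Summable fun k => ‖(bigCoeff p k : ℂ) * w ^ k‖ := by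
  refine (summable_bigCoeff h0 h1 ‖w‖).congr fun k => ?_
  rw [norm_mul, norm_pow, Complex.norm_real, Real.norm_of_nonneg (bigCoeff_pos h0 h1 k).le]

theorem hasSum_bigE (w : ℂ) : HasSum (fun k => (bigCoeff p k : ℂ) * w ^ k) (bigE p w) :=
  (summable_norm_bigE h0 h1 w).of_norm.hasSum

theorem differentiable_bigE : Differentiable ℂ (bigE p) := by
  intro w
  have hd : DifferentiableOn ℂ (bigE p) (Metric.ball 0 (‖w‖ + 1)) := by
    refine Complex.differentiableOn_tsum_of_summable_norm (summable_bigCoeff h0 h1 (‖w‖ + 1))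
      (fun k => (by fun_prop)) Metric.isOpen_ball fun k v hv => ?_
    rw [norm_mul, norm_pow, Complex.norm_real, Real.norm_of_nonneg (bigCoeff_pos h0 h1 k).le]
    have := mem_ball_zero_iff.1 hv
    have h5 := (bigCoeff_pos h0 h1 k).le
    gcongr
  refine hd.differentiableAt (Metric.isOpen_ball.mem_nhds ?_)
  simp

omit h0 h1 in
theorem bigE_zero : bigE p 0 = 1 := by
  unfold bigE
  rw [tsum_eq_single 0]
  · simp [bigCoeff, qPoch_zero]
  · intro k hk
    simp [hk]

/-- Comparison of coefficients through `bigCoeff_succ`. The zeros, the positivity, the inverse and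
the moments all come from this functional equation. -/
theorem bigE_eq (w : ℂ) : bigE p w = (1 + w) * bigE p (p * w) := by
  have hs := (summable_norm_bigE h0 h1 w).of_norm
  have hs' := (summable_norm_bigE h0 h1 (p * w)).of_norm
  have e1 : bigE p w = 1 + ∑' k, (bigCoeff p (k + 1) : ℂ) * w ^ (k + 1) := by
    unfold bigE
    rw [hs.tsum_eq_zero_add]
    simp [bigCoeff, qPoch_zero]
  have e2 : bigE p (p * w) = 1 + ∑' k, (bigCoeff p (k + 1) : ℂ) * (p * w) ^ (k + 1) := by
    unfold bigE
    rw [hs'.tsum_eq_zero_add]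
    simp [bigCoeff, qPoch_zero]
  have e3 : w * bigE p (p * w) = ∑' k, w * ((bigCoeff p k : ℂ) * (p * w) ^ k) := by
    unfold bigE
    rw [tsum_mul_left]
  rw [add_mul, one_mul, e3, e2, add_assoc, ← Summable.tsum_add
    ((summable_nat_add_iff 1).2 hs') (hs'.mul_left w), e1]
  congr 1
  refine tsum_congr fun k => ?_
  have h4 : (bigCoeff p (k + 1) : ℂ) * (1 - (p : ℂ) ^ (k + 1)) = (p : ℂ) ^ k * bigCoeff p k := by
    exact_mod_cast congrArg (Complex.ofReal) (bigCoeff_succ h0 h1 k)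
  linear_combination w ^ (k + 1) * h4

theorem bigE_eq_prod (w : ℂ) (m : ℕ) :
    bigE p w = (∏ k ∈ Finset.range m, (1 + (p : ℂ) ^ k * w)) * bigE p ((p : ℂ) ^ m * w) := by
  induction m with
  | zero => simp
  | succ m ih =>
    rw [ih, Finset.prod_range_succ, bigE_eq h0 h1 ((p : ℂ) ^ m * w), pow_succ']
    ring_nf

theorem tendsto_bigE_pow_mul (w : ℂ) :
    Tendsto (fun m : ℕ => bigE p ((p : ℂ) ^ m * w)) atTop (𝓝 1) := by
  have h2 : Tendsto (fun m : ℕ => (p : ℂ) ^ m * w) atTop (𝓝 0) := by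
    have := (tendsto_pow_atTop_nhds_zero_of_norm_lt_one (x := (p : ℂ)) (by
      rwa [Complex.norm_real, Real.norm_of_nonneg h0.le])).mul_const w
    simpa using this
  have h3 := ((differentiable_bigE h0 h1).continuous.tendsto 0).comp h2
  rwa [bigE_zero] at h3

/-- A finite piece of the product suffices: the remaining factor is a value at a point so close to
`0` that it is near `1`. -/
theorem bigE_ne_zero {w : ℂ} (hw : ∀ k : ℕ, 1 + (p : ℂ) ^ k * w ≠ 0) : bigE p w ≠ 0 := by
  obtain ⟨m, hm⟩ := ((tendsto_bigE_pow_mul h0 h1 w).eventually_ne one_ne_zero).exists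
  rw [bigE_eq_prod h0 h1 w m]
  exact mul_ne_zero (Finset.prod_ne_zero_iff.2 fun k _ => hw k) hm

theorem bigE_neg_zpow_eq_zero {j : ℤ} (hj : j ≤ 0) : bigE p (-(p : ℂ) ^ j) = 0 := by
  obtain ⟨k, rfl⟩ : ∃ k : ℕ, j = -k := ⟨j.natAbs, by omega⟩
  rw [bigE_eq_prod h0 h1 _ (k + 1), Finset.prod_range_succ]
  have hp : (p : ℂ) ≠ 0 := Complex.ofReal_ne_zero.2 h0.ne'
  rw [mul_neg, zpow_neg, zpow_natCast, mul_inv_cancel₀ (pow_ne_zero _ hp), add_neg_cancel, mul_zero,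
    zero_mul]

theorem norm_bigE_le {w : ℂ} (hw : ‖w‖ ≤ 1) : ‖bigE p w‖ ≤ ∑' k, bigCoeff p k := by
  have hs := summable_bigCoeff h0 h1 1
  simp only [one_pow, mul_one] at hs
  refine tsum_of_norm_bounded hs.hasSum fun k => ?_
  rw [norm_mul, norm_pow, Complex.norm_real, Real.norm_of_nonneg (bigCoeff_pos h0 h1 k).le]
  exact mul_le_of_le_one_right (bigCoeff_pos h0 h1 k).le (pow_le_one₀ (norm_nonneg _) hw)

omit h0 h1 in
theorem bigE_ofReal (x : ℝ) : bigE p x = ((∑' k, bigCoeff p k * x ^ k : ℝ) : ℂ) := by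
  unfold bigE
  push_cast
  rfl

theorem bigE_re_pos {x : ℝ} (hx : -1 < x) : 0 < (bigE p x).re := by
  have hre : ∀ y : ℝ, bigE p y = ((bigE p y).re : ℂ) := by
    intro y
    rw [bigE_ofReal, Complex.ofReal_re]
  have hlim := (Complex.continuous_re.tendsto 1).comp (tendsto_bigE_pow_mul h0 h1 x)
  obtain ⟨m, hm⟩ := (hlim.eventually (lt_mem_nhds (by norm_num : (0 : ℝ) < (1 : ℂ).re))).exists
  have h2 := bigE_eq_prod h0 h1 (x : ℂ) m
  have h3 : ((p : ℂ) ^ m * x) = ((p ^ m * x : ℝ) : ℂ) := by push_cast; rfl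
  have h4 : (∏ k ∈ Finset.range m, (1 + (p : ℂ) ^ k * x)) =
      ((∏ k ∈ Finset.range m, (1 + p ^ k * x) : ℝ) : ℂ) := by push_cast; rfl
  simp only [Function.comp_apply] at hm
  rw [h3] at h2 hm
  rw [h2, hre (p ^ m * x), h4, ← Complex.ofReal_mul, Complex.ofReal_re]
  refine mul_pos (Finset.prod_pos fun k _ => ?_) hm
  have h5 : p ^ k ≤ 1 := pow_le_one₀ h0.le h1.le
  have h6 : 0 < p ^ k := pow_pos h0 k
  nlinarith

/-- All terms are nonnegative, so each is below the sum. Hence `1/E_p` decays faster than every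
power on the positive axis. -/
theorem bigCoeff_mul_pow_le {x : ℝ} (hx : 0 ≤ x) (k : ℕ) : bigCoeff p k * x ^ k ≤ ‖bigE p x‖ := by
  rw [bigE_ofReal, Complex.norm_real]
  refine le_trans ?_ (le_abs_self _)
  exact (summable_bigCoeff h0 h1 x).le_tsum k fun j _ =>
    mul_nonneg (bigCoeff_pos h0 h1 j).le (pow_nonneg hx j)

theorem summable_norm_eSeries {w : ℂ} (hw : ‖w‖ < 1) :
    Summable fun k => ‖PowerSeries.coeff k (eSeries p) * w ^ k‖ := by
  by_cases hw0 : w = 0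
  · subst hw0
    refine summable_of_ne_finset_zero (s := {0}) fun k hk => ?_
    simp only [Finset.mem_singleton] at hk
    simp [hk]
  refine summable_of_ratio_test_tendsto_lt_one (l := ‖w‖) hw (Eventually.of_forall fun k => ?_) ?_
  · have := (qPoch_pos h0 h1 k).ne'
    simp [eSeries, this, hw0]
  · have hlim : Tendsto (fun k : ℕ => (1 - p ^ (k + 1))⁻¹ * ‖w‖) atTop (𝓝 ‖w‖) := by
      have hb := (tendsto_add_atTop_iff_nat 1).2 (tendsto_pow_atTop_nhds_zero_of_lt_one h0.le h1)
      have hc := ((tendsto_const_nhds (x := (1 : ℝ))).sub hb).inv₀ (by norm_num)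
      simpa using hc.mul_const ‖w‖
    refine hlim.congr fun k => ?_
    have h3 : 0 < 1 - p ^ (k + 1) := sub_pos.2 (pow_lt_one₀ h0.le h1 k.succ_ne_zero)
    have h4 := qPoch_pos h0 h1 k
    have h5 : ‖w‖ ≠ 0 := norm_ne_zero_iff.2 hw0
    have h6 : ∀ m, ‖PowerSeries.coeff m (eSeries p) * w ^ m‖ = (qPoch p m)⁻¹ * ‖w‖ ^ m := by
      intro m
      rw [eSeries, PowerSeries.coeff_mk, one_div, norm_mul, norm_pow, Complex.norm_real,
        Real.norm_of_nonneg (inv_pos.2 (qPoch_pos h0 h1 m)).le]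
    rw [norm_norm, norm_norm, h6, h6, qPoch_succ]
    field_simp
    ring

/-- The sum `f` of `e_p` satisfies `f(pv) = (1-v)f(v)`, the equation inverse to that of `E_p(-v)`.
So `E_p(-v)f(v)` is invariant under `v ↦ pv`, and letting `v` shrink to `0` shows that it equals
`1`. -/
theorem hasSum_eSeries {w : ℂ} (hw : ‖w‖ < 1) :
    HasSum (fun k => PowerSeries.coeff k (eSeries p) * w ^ k) (bigE p (-w))⁻¹ := by
  let f : ℂ → ℂ := fun v => ∑' k, PowerSeries.coeff k (eSeries p) * v ^ k
  have hf : ∀ {v : ℂ}, ‖v‖ < 1 → f (p * v) = (1 - v) * f v := by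
    intro v hv
    have hpv : ‖(p : ℂ) * v‖ < 1 := by
      rw [norm_mul, Complex.norm_real, Real.norm_of_nonneg h0.le]
      have := norm_nonneg v
      nlinarith
    have hs := (summable_norm_eSeries h0 h1 hv).of_norm
    have hs' := (summable_norm_eSeries h0 h1 hpv).of_norm
    have e1 : f v = 1 + ∑' k, PowerSeries.coeff (k + 1) (eSeries p) * v ^ (k + 1) := by
      simp only [f]
      rw [hs.tsum_eq_zero_add]
      simp [eSeries, qPoch_zero]
    have e2 : f (p * v) = 1 + ∑' k, PowerSeries.coeff (k + 1) (eSeries p) * (p * v) ^ (k + 1) := by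
      simp only [f]
      rw [hs'.tsum_eq_zero_add]
      simp [eSeries, qPoch_zero]
    have e3 : v * f v = ∑' k, v * (PowerSeries.coeff k (eSeries p) * v ^ k) := by
      simp only [f]
      rw [tsum_mul_left]
    rw [sub_mul, one_mul, e3, e1, e2, add_sub_assoc, ← Summable.tsum_sub
      ((summable_nat_add_iff 1).2 hs) (hs.mul_left v)]
    congr 1
    refine tsum_congr fun k => ?_
    have h4 := qPoch_ne_zero h0 h1 k
    have h3 : (1 : ℂ) - (p : ℂ) ^ (k + 1) ≠ 0 := by
      have : 1 - p ^ (k + 1) ≠ 0 := (sub_pos.2 (pow_lt_one₀ h0.le h1 k.succ_ne_zero)).ne'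
      exact_mod_cast this
    simp only [eSeries, PowerSeries.coeff_mk, qPoch_succ]
    push_cast at h3 h4 ⊢
    field_simp
    ring
  have hcont : ContinuousAt f 0 := by
    have hd : DifferentiableOn ℂ f (Metric.ball 0 (1 / 2)) := by
      have hs := summable_norm_eSeries h0 h1 (w := ((1 / 2 : ℝ) : ℂ)) (by
        rw [Complex.norm_real]; norm_num)
      refine Complex.differentiableOn_tsum_of_summable_norm hs
        (fun k => (by fun_prop)) Metric.isOpen_ball fun k v hv => ?_
      have hv' := mem_ball_zero_iff.1 hv
      rw [norm_mul, norm_mul, norm_pow, norm_pow, Complex.norm_real]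
      have : ‖v‖ ≤ ‖(1 / 2 : ℝ)‖ := by rw [Real.norm_of_nonneg (by norm_num)]; exact hv'.le
      gcongr
    exact (hd.differentiableAt (Metric.isOpen_ball.mem_nhds (by simp))).continuousAt
  have hf0 : f 0 = 1 := by
    simp only [f]
    rw [tsum_eq_single 0]
    · simp [eSeries, qPoch_zero]
    · intro k hk
      simp [hk]
  have hnorm : ∀ m : ℕ, ‖(p : ℂ) ^ m * w‖ < 1 := by
    intro m
    rw [norm_mul, norm_pow, Complex.norm_real, Real.norm_of_nonneg h0.le]
    have h5 : p ^ m ≤ 1 := pow_le_one₀ h0.le h1.le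
    have := norm_nonneg w
    have h6 : 0 < p ^ m := pow_pos h0 m
    nlinarith
  have hconst : ∀ m : ℕ, bigE p (-w) * f w = bigE p ((p : ℂ) ^ m * -w) * f ((p : ℂ) ^ m * w) := by
    intro m
    induction m with
    | zero => simp
    | succ m ih =>
      rw [ih, pow_succ', mul_assoc, mul_assoc, hf (hnorm m), bigE_eq h0 h1 ((p : ℂ) ^ m * -w)]
      ring
  have hlim : Tendsto (fun m : ℕ => bigE p ((p : ℂ) ^ m * -w) * f ((p : ℂ) ^ m * w)) atTop
      (𝓝 (1 * 1)) := by
    refine (tendsto_bigE_pow_mul h0 h1 (-w)).mul ?_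
    have h2 : Tendsto (fun m : ℕ => (p : ℂ) ^ m * w) atTop (𝓝 0) := by
      have := (tendsto_pow_atTop_nhds_zero_of_norm_lt_one (x := (p : ℂ)) (by
        rwa [Complex.norm_real, Real.norm_of_nonneg h0.le])).mul_const w
      simpa using this
    have h3 := hcont.tendsto.comp h2
    rwa [hf0] at h3
  have hone : bigE p (-w) * f w = 1 := by
    rw [one_mul] at hlim
    exact tendsto_nhds_unique (tendsto_const_nhds.congr hconst) hlim
  rw [← eq_inv_of_mul_eq_one_right hone]
  exact (summable_norm_eSeries h0 h1 hw).of_norm.hasSum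

end

end BraidedFourier

end

noncomputable section

namespace BraidedFourier

open Filter Topology

/-! ### Integration in one variable -/

/-- The lattice point `ε q^{2h} ζ`. -/
def pt (q ζ : ℝ) (ε : ℤˣ) (h : ℤ) : ℝ := ((ε : ℤ) : ℝ) * q ^ (2 * h) * ζ

/-- Absolute `q²`-integrability on all lattices of `ℝ ∖ 0`. -/
def AbsInt (q : ℝ) (φ : ℂ → ℂ) : Prop :=
  ∀ ζ : ℝ, ζ ≠ 0 → ∀ ε : ℤˣ, Summable fun h : ℤ => q ^ (2 * h) * ‖φ (pt q ζ ε h)‖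

/-- The terms of the one-variable Jackson integral. -/
def jackTerm (q : ℝ) (φ : ℂ → ℂ) (ζ : ℝ) (h : ℤ) : ℂ :=
  ∑ ε : ℤˣ, ((1 - q ^ 2) * q ^ (2 * h) * ζ : ℝ) * φ (pt q ζ ε h)

/-- The one-variable Jackson integral `∫_{-ζ·∞}^{ζ·∞} φ`. -/
def jack (q : ℝ) (φ : ℂ → ℂ) (ζ : ℝ) : ℂ := ∑' h : ℤ, jackTerm q φ ζ h

section
variable {q : ℝ} {φ ψ : ℂ → ℂ}

theorem sum_signs (f : ℤˣ → ℂ) : ∑ ε : ℤˣ, f ε = f 1 + f (-1) := by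
  rw [show (Finset.univ : Finset ℤˣ) = {1, -1} from rfl, Finset.sum_pair (by decide)]

theorem pt_neg (ζ : ℝ) (ε : ℤˣ) (h : ℤ) : pt q ζ (-ε) h = -pt q ζ ε h := by
  simp [pt]

theorem abs_pt (hq0 : 0 < q) (ζ : ℝ) (ε : ℤˣ) (h : ℤ) : |pt q ζ ε h| = q ^ (2 * h) * |ζ| := by
  have h1 : |((ε : ℤ) : ℝ)| = 1 := by
    rcases Int.units_eq_one_or ε with rfl | rfl <;> simp
  rw [pt, abs_mul, abs_mul, h1, one_mul, abs_of_pos (zpow_pos hq0 _)]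

theorem AbsInt.add (h1 : AbsInt q φ) (h2 : AbsInt q ψ) (hq0 : 0 < q) :
    AbsInt q fun z => φ z + ψ z := by
  intro ζ hζ ε
  refine Summable.of_nonneg_of_le (fun h => mul_nonneg (zpow_pos hq0 _).le (norm_nonneg _))
    (fun h => ?_) ((h1 ζ hζ ε).add (h2 ζ hζ ε))
  rw [← mul_add]
  exact mul_le_mul_of_nonneg_left (norm_add_le _ _) (zpow_pos hq0 _).le

theorem AbsInt.const_mul (h1 : AbsInt q φ) (c : ℂ) : AbsInt q fun z => c * φ z := by
  intro ζ hζ ε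
  refine ((h1 ζ hζ ε).mul_left ‖c‖).congr fun h => ?_
  rw [norm_mul]; ring

theorem AbsInt.zero : AbsInt q fun _ => 0 := by
  intro ζ _ ε
  simp

theorem AbsInt.sum {ι : Type} (s : Finset ι) {φ : ι → ℂ → ℂ} (hq0 : 0 < q)
    (h : ∀ i ∈ s, AbsInt q (φ i)) : AbsInt q fun z => ∑ i ∈ s, φ i z := by
  classical
  induction s using Finset.induction_on with
  | empty => simpa using AbsInt.zero
  | insert i s hi ih =>
    have := (h i (by simp)).add (ih fun j hj => h j (by simp [hj])) hq0
    simpa [Finset.sum_insert hi] using this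

theorem AbsInt.comp_mul (h1 : AbsInt q φ) {c : ℝ} (hc : c ≠ 0) : AbsInt q fun z => φ (c * z) := by
  intro ζ hζ ε
  refine (h1 (c * ζ) (mul_ne_zero hc hζ) ε).congr fun h => ?_
  congr 3
  simp only [pt]
  push_cast
  ring

theorem AbsInt.comp_neg (h1 : AbsInt q φ) : AbsInt q fun z => φ (-z) := by
  intro ζ hζ ε
  refine (h1 ζ hζ (-ε)).congr fun h => ?_
  rw [pt_neg, Complex.ofReal_neg]

theorem AbsInt.summable_jackTerm (h1 : AbsInt q φ) {ζ : ℝ} (hζ : ζ ≠ 0) (hq0 : 0 < q) :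
    Summable fun h => ‖jackTerm q φ ζ h‖ := by
  have : Summable fun h : ℤ => ∑ ε : ℤˣ, |1 - q ^ 2| * |ζ| * (q ^ (2 * h) * ‖φ (pt q ζ ε h)‖) :=
    summable_sum fun ε _ => (h1 ζ hζ ε).mul_left _
  refine Summable.of_nonneg_of_le (fun h => norm_nonneg _) (fun h => ?_) this
  refine (norm_sum_le _ _).trans (Finset.sum_le_sum fun ε _ => le_of_eq ?_)
  rw [norm_mul, Complex.norm_real, Real.norm_eq_abs, abs_mul, abs_mul, abs_of_pos (zpow_pos hq0 _)]
  ring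

theorem jack_add (h1 : AbsInt q φ) (h2 : AbsInt q ψ) (hq0 : 0 < q) {ζ : ℝ} (hζ : ζ ≠ 0) :
    jack q (fun z => φ z + ψ z) ζ = jack q φ ζ + jack q ψ ζ := by
  unfold jack
  rw [← Summable.tsum_add (h1.summable_jackTerm hζ hq0).of_norm
    (h2.summable_jackTerm hζ hq0).of_norm]
  refine tsum_congr fun h => ?_
  simp only [jackTerm, mul_add, Finset.sum_add_distrib]

theorem jack_const_mul (c : ℂ) (ζ : ℝ) : jack q (fun z => c * φ z) ζ = c * jack q φ ζ := by
  unfold jack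
  rw [← tsum_mul_left]
  refine tsum_congr fun h => ?_
  simp only [jackTerm, Finset.mul_sum]
  exact Finset.sum_congr rfl fun _ _ => by ring

theorem jack_sum {ι : Type} (s : Finset ι) {φ : ι → ℂ → ℂ} (hq0 : 0 < q)
    (h : ∀ i ∈ s, AbsInt q (φ i)) {ζ : ℝ} (hζ : ζ ≠ 0) :
    jack q (fun z => ∑ i ∈ s, φ i z) ζ = ∑ i ∈ s, jack q (φ i) ζ := by
  classical
  induction s using Finset.induction_on with
  | empty => simp [jack, jackTerm]
  | insert i s hi ih =>
    have := jack_add (h i (by simp)) (AbsInt.sum s hq0 fun j hj => h j (by simp [hj])) hq0 hζ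
    simp only [Finset.sum_insert hi]
    rw [this, ih fun j hj => h j (by simp [hj])]

theorem jack_comp_mul {c : ℝ} (hc : c ≠ 0) (ζ : ℝ) :
    jack q (fun z => φ (c * z)) ζ = (c : ℂ)⁻¹ * jack q φ (c * ζ) := by
  unfold jack
  rw [← tsum_mul_left]
  refine tsum_congr fun h => ?_
  simp only [jackTerm, Finset.mul_sum]
  refine Finset.sum_congr rfl fun ε _ => ?_
  have : (c : ℂ) * (pt q ζ ε h : ℂ) = (pt q (c * ζ) ε h : ℂ) := by
    simp only [pt]; push_cast; ring
  have hc' : (c : ℂ) ≠ 0 := Complex.ofReal_ne_zero.2 hc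
  rw [this]
  push_cast
  field_simp

/-- Both points lie on the same lattice. Therefore only the parity of a power of `q` in front of `ζ`
matters. -/
theorem jack_mul_sq (hq0 : 0 < q) (ζ : ℝ) : jack q φ (q ^ 2 * ζ) = jack q φ ζ := by
  unfold jack
  rw [← (Equiv.addRight (1 : ℤ)).tsum_eq (jackTerm q φ ζ)]
  refine tsum_congr fun h => ?_
  have h1 : q ^ (2 * (h + 1)) = q ^ (2 * h) * q ^ 2 := by
    rw [mul_add, zpow_add₀ hq0.ne']; norm_cast
  simp only [jackTerm, Equiv.coe_addRight, pt, h1]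
  refine Finset.sum_congr rfl fun ε _ => ?_
  congr 2
  · ring
  · congr 1; ring

theorem jack_comp_neg (ζ : ℝ) : jack q (fun z => φ (-z)) ζ = jack q φ ζ := by
  unfold jack
  refine tsum_congr fun h => ?_
  simp only [jackTerm, sum_signs, pt_neg, ← Complex.ofReal_neg, neg_neg]
  rw [add_comm]

/-! ### The Gaussian `e_{q⁴}(-z²)` on the strip -/

/-- The open strip `|Im z| < 1`. -/
def strip : Set ℂ := {z | |z.im| < 1}

/-- The continuation of `e_{q⁴}(-z²)`. -/
def gaussFun (q : ℝ) (z : ℂ) : ℂ := (bigE (q ^ 4) (z ^ 2))⁻¹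

/-- The real part is `1 + c(x² - y²)`, positive because `y² < 1` and `c ≤ 1`. So `E_{q⁴}(z²)` has no
zeros on the strip. -/
theorem one_add_mul_sq_ne_zero {z : ℂ} (hz : z ∈ strip) {c : ℝ} (hc : 0 < c) (hc1 : c ≤ 1) :
    1 + (c : ℂ) * z ^ 2 ≠ 0 := by
  intro h
  have hre := congrArg Complex.re h
  simp only [Complex.add_re, Complex.one_re, pow_two, Complex.mul_re,
    Complex.zero_re, Complex.ofReal_re, Complex.ofReal_im, zero_mul, sub_zero] at hre
  have hz2 : z.im ^ 2 < 1 := (sq_lt_one_iff_abs_lt_one _).2 hz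
  nlinarith [sq_nonneg z.re, mul_nonneg hc.le (sq_nonneg z.re)]

theorem ofReal_mem_strip (t : ℝ) : (t : ℂ) ∈ strip := by simp [strip]

variable (hq0 : 0 < q) (hq1 : q < 1)
include hq0 hq1

theorem pow_four_lt_one : q ^ 4 < 1 := pow_lt_one₀ hq0.le hq1 (by norm_num)

theorem bigE_sq_ne_zero {z : ℂ} (hz : z ∈ strip) : bigE (q ^ 4) (z ^ 2) ≠ 0 := by
  refine bigE_ne_zero (pow_pos hq0 4) (pow_four_lt_one hq0 hq1) fun k => ?_
  have h1 : (q ^ 4) ^ k ≤ 1 := pow_le_one₀ (by positivity) (pow_four_lt_one hq0 hq1).le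
  have := one_add_mul_sq_ne_zero hz (pow_pos (pow_pos hq0 4) k) h1
  rwa [Complex.ofReal_pow] at this

theorem analyticOnNhd_gaussFun : AnalyticOnNhd ℂ (gaussFun q) strip := by
  intro z hz
  have h1 : AnalyticAt ℂ (fun z => bigE (q ^ 4) (z ^ 2)) z :=
    ((differentiable_bigE (pow_pos hq0 4) (pow_four_lt_one hq0 hq1)).comp
      (differentiable_id.pow 2)).analyticAt z
  exact h1.inv (bigE_sq_ne_zero hq0 hq1 hz)

theorem gaussFun_sq_mul {z : ℂ} (hz : z ∈ strip) :
    gaussFun q ((q : ℂ) ^ 2 * z) = (1 + z ^ 2) * gaussFun q z := by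
  unfold gaussFun
  have h := bigE_eq (pow_pos hq0 4) (pow_four_lt_one hq0 hq1) (z ^ 2)
  have h1 : 1 + z ^ 2 ≠ 0 := by
    have := one_add_mul_sq_ne_zero hz one_pos le_rfl
    simpa using this
  have h2 : ((q : ℂ) ^ 2 * z) ^ 2 = ((q ^ 4 : ℝ) : ℂ) * z ^ 2 := by push_cast; ring
  rw [h, h2, mul_inv, mul_inv_cancel_left₀ h1]

theorem hasSum_gaussSmall {z : ℂ} (hz : ‖z‖ < 1) :
    HasSum (fun k => PowerSeries.coeff k (gaussSmall q) * z ^ k) (gaussFun q z) := by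
  have h1 : ‖-z ^ 2‖ < 1 := by
    rw [norm_neg, norm_pow]; exact pow_lt_one₀ (norm_nonneg _) hz two_ne_zero
  have h2 := hasSum_eSeries (pow_pos hq0 4) (pow_four_lt_one hq0 hq1) h1
  rw [neg_neg] at h2
  have hinj : Function.Injective fun k : ℕ => 2 * k := fun a b h => by simpa using h
  rw [← hinj.hasSum_iff]
  · unfold gaussFun
    convert h2 using 1
    funext k
    simp only [Function.comp, gaussSmall, sqSubst, PowerSeries.coeff_mk]
    rw [if_pos (even_two_mul k), Nat.mul_div_cancel_left _ two_pos, pow_mul, neg_pow (z ^ 2)]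
    ring
  · intro m hm
    simp only [gaussSmall, sqSubst, PowerSeries.coeff_mk]
    rw [if_neg, zero_mul]
    intro he
    obtain ⟨r, rfl⟩ := he
    exact hm ⟨r, by simp [two_mul]⟩

theorem norm_gaussFun_mul_le (t : ℝ) (N : ℕ) :
    bigCoeff (q ^ 4) N * t ^ (2 * N) * ‖gaussFun q t‖ ≤ 1 := by
  have h0 := pow_pos hq0 4
  have h1 := pow_four_lt_one hq0 hq1
  have h2 := bigCoeff_mul_pow_le h0 h1 (sq_nonneg t) N
  have h3 := norm_pos_iff.2 (bigE_sq_ne_zero hq0 hq1 (ofReal_mem_strip t))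
  unfold gaussFun
  push_cast at h2
  rw [norm_inv, pow_mul, mul_inv_le_iff₀ h3, one_mul]
  exact h2

theorem absInt_pow_mul_gaussFun (k : ℕ) : AbsInt q fun z => z ^ k * gaussFun q z := by
  intro ζ hζ ε
  have hz : 0 < |ζ| := abs_pos.2 hζ
  have hterm : ∀ h : ℤ, q ^ (2 * h) * ‖(pt q ζ ε h : ℂ) ^ k * gaussFun q (pt q ζ ε h)‖ =
      q ^ (2 * h) * (q ^ (2 * h) * |ζ|) ^ k * ‖gaussFun q (pt q ζ ε h)‖ := by
    intro h
    rw [norm_mul, norm_pow, Complex.norm_real, Real.norm_eq_abs, abs_pt hq0, mul_assoc]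
  have hc := bigCoeff_pos (pow_pos hq0 4) (pow_four_lt_one hq0 hq1) (k + 1)
  have hgeo : Summable fun m : ℕ => (q ^ 2) ^ m :=
    summable_geometric_of_lt_one (by positivity) (pow_lt_one₀ hq0.le hq1 two_ne_zero)
  simp only [hterm]
  refine Summable.of_nat_of_neg ?_ ?_
  -- Towards `0` the Gaussian is bounded, and the weight `q^{2h}` alone gives convergence.
  · refine Summable.of_nonneg_of_le (fun m => by positivity) (fun m => ?_) (hgeo.mul_left (|ζ| ^ k))
    have h1 := norm_gaussFun_mul_le hq0 hq1 (pt q ζ ε m) 0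
    have h2 : bigCoeff (q ^ 4) 0 = 1 := by simp [bigCoeff, qPoch_zero]
    rw [h2, mul_zero, pow_zero, one_mul, one_mul] at h1
    have h3 : q ^ (2 * (m : ℤ)) = (q ^ 2) ^ m := by rw [zpow_mul]; norm_cast
    have h4 : (q ^ 2) ^ m ≤ 1 := pow_le_one₀ (by positivity) (pow_le_one₀ hq0.le hq1.le)
    have h5 : ((q ^ 2) ^ m * |ζ|) ^ k ≤ |ζ| ^ k :=
      pow_le_pow_left₀ (by positivity) (mul_le_of_le_one_left hz.le h4) k
    rw [h3]
    calc (q ^ 2) ^ m * ((q ^ 2) ^ m * |ζ|) ^ k * ‖gaussFun q (pt q ζ ε m)‖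
        ≤ (q ^ 2) ^ m * |ζ| ^ k * 1 := by gcongr
      _ = |ζ| ^ k * (q ^ 2) ^ m := by ring
  -- Towards infinity, with `x = q^{2m}`, weight and monomial grow like `x^{-(k+1)}`. Decay of order
  -- `2(k+1)` leaves `x^{k+1}`, which is at most `x`.
  · refine Summable.of_nonneg_of_le (fun m => by positivity) (fun m => ?_)
      (hgeo.mul_left ((bigCoeff (q ^ 4) (k + 1) * |ζ| ^ (k + 2))⁻¹))
    have h1 := norm_gaussFun_mul_le hq0 hq1 (pt q ζ ε (-m)) (k + 1)
    rw [pow_mul, ← sq_abs, ← pow_mul, abs_pt hq0] at h1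
    have h3 : q ^ (2 * (-(m : ℤ))) = ((q ^ 2) ^ m)⁻¹ := by
      rw [mul_neg, zpow_neg, zpow_mul]; norm_cast
    rw [h3] at h1 ⊢
    set x := (q ^ 2) ^ m
    have hx : 0 < x := by positivity
    have hx1 : x ≤ 1 := pow_le_one₀ (by positivity) (pow_le_one₀ hq0.le hq1.le)
    set G := ‖gaussFun q (pt q ζ ε (-m))‖
    have hG : 0 ≤ G := norm_nonneg _
    set c := bigCoeff (q ^ 4) (k + 1)
    rw [mul_comm _ x, ← div_eq_mul_inv, le_div_iff₀ (by positivity)]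
    have e1 : x⁻¹ * (x⁻¹ * |ζ|) ^ k * G * (c * |ζ| ^ (k + 2)) =
        x * (c * (x⁻¹ * |ζ|) ^ (2 * (k + 1)) * G) * x ^ k := by
      rw [mul_pow, mul_pow, inv_pow, inv_pow]
      field_simp
      ring
    rw [e1]
    calc x * (c * (x⁻¹ * |ζ|) ^ (2 * (k + 1)) * G) * x ^ k ≤ x * 1 * 1 := by
          gcongr
          exact pow_le_one₀ hx.le hx1
      _ = x := by ring

/-- The moments of the Gaussian on the `q²`-lattice. -/
theorem jack_pow_add_two (k : ℕ) {ζ : ℝ} (hζ : ζ ≠ 0) :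
    jack q (fun z => z ^ (k + 2) * gaussFun q z) ζ =
      (((q : ℂ) ^ (2 * (k + 1)))⁻¹ - 1) * jack q (fun z => z ^ k * gaussFun q z) ζ := by
  have hqc : (q : ℂ) ≠ 0 := Complex.ofReal_ne_zero.2 hq0.ne'
  -- The integral of `t^k w(q²t)` is evaluated twice: by substitution on the invariant lattice, and
  -- below by `w(q²t) = (1+t²)w(t)`.
  have h1 : jack q (fun z => z ^ k * gaussFun q ((q : ℂ) ^ 2 * z)) ζ =
      ((q : ℂ) ^ (2 * (k + 1)))⁻¹ * jack q (fun z => z ^ k * gaussFun q z) ζ := by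
    have h2 := jack_comp_mul (q := q) (φ := fun z => z ^ k * gaussFun q z)
      (pow_pos hq0 2).ne' ζ
    rw [jack_mul_sq hq0] at h2
    have h3 : (fun z : ℂ => z ^ k * gaussFun q ((q : ℂ) ^ 2 * z)) =
        fun z => ((q : ℂ) ^ (2 * k))⁻¹ *
          ((((q ^ 2 : ℝ) : ℂ) * z) ^ k * gaussFun q (((q ^ 2 : ℝ) : ℂ) * z)) := by
      funext z
      push_cast
      rw [mul_pow, ← pow_mul]
      field_simp
    rw [h3, jack_const_mul, h2]
    push_cast
    field_simp
    ring
  have h4 := jack_add (absInt_pow_mul_gaussFun hq0 hq1 k)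
    (absInt_pow_mul_gaussFun hq0 hq1 (k + 2)) hq0 hζ
  have h5 : jack q (fun z => z ^ k * gaussFun q z + z ^ (k + 2) * gaussFun q z) ζ =
      jack q (fun z => z ^ k * gaussFun q ((q : ℂ) ^ 2 * z)) ζ := by
    unfold jack
    refine tsum_congr fun h => ?_
    unfold jackTerm
    refine Finset.sum_congr rfl fun ε _ => ?_
    simp only [gaussFun_sq_mul hq0 hq1 (ofReal_mem_strip _)]
    ring
  rw [h5, h1] at h4
  linear_combination -h4

omit hq0 hq1 in
theorem jack_odd {φ : ℂ → ℂ} (h : ∀ z, φ (-z) = -φ z) (ζ : ℝ) : jack q φ ζ = 0 := by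
  unfold jack
  convert tsum_zero with k
  rw [jackTerm, sum_signs, pt_neg, Complex.ofReal_neg, h]
  ring

end

end BraidedFourier

end

noncomputable section

namespace BraidedFourier

open Filter Topology

theorem hasSum_of_eq {ι : Type} {f g : ι → ℂ} {a b : ℂ} (h : HasSum f a) (hf : ∀ x, g x = f x)
    (hb : b = a) : HasSum g b := by
  rwa [hb, funext hf]

theorem zpow_sum {ι K : Type} [Field K] {q : K} (hq : q ≠ 0) (s : Finset ι) (f : ι → ℤ) :
    q ^ (∑ i ∈ s, f i) = ∏ i ∈ s, q ^ f i := by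
  classical
  induction s using Finset.induction_on with
  | empty => simp
  | insert i s hi ih => rw [Finset.sum_insert hi, Finset.prod_insert hi, zpow_add₀ hq, ih]

/-! ### Uniqueness of the continuation -/

/-- The two domains may differ, but both contain a tube over a small ball of imaginary parts. This
tube is convex, so the identity theorem applies, and it contains all real points. -/
theorem IsContinuation.eq_ofReal {n : ℕ} {f : Series n} {φ ψ : (Fin n → ℂ) → ℂ}
    (hφ : IsContinuation f φ) (hψ : IsContinuation f ψ) (t : Fin n → ℝ) :
    φ (fun j => (t j : ℂ)) = ψ fun j => (t j : ℂ) := by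
  obtain ⟨⟨r, hr, hsr⟩, U, hU, hU0, hφa⟩ := hφ
  obtain ⟨⟨s, hs, hss⟩, U', hU', hU0', hψa⟩ := hψ
  obtain ⟨ε, hε, hball⟩ := Metric.isOpen_iff.1 (hU.inter hU') 0 ⟨hU0, hU0'⟩
  let L : (Fin n → ℂ) →ₗ[ℝ] (Fin n → ℝ) :=
    LinearMap.pi fun j => Complex.imLm ∘ₗ (LinearMap.proj j : (Fin n → ℂ) →ₗ[ℝ] ℂ)
  have hconv : Convex ℝ (L ⁻¹' Metric.ball (0 : Fin n → ℝ) ε) :=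
    (convex_ball 0 ε).linear_preimage L
  have h1 : AnalyticOnNhd ℂ φ (L ⁻¹' Metric.ball (0 : Fin n → ℝ) ε) :=
    hφa.mono fun z hz => (hball hz).1
  have h2 : AnalyticOnNhd ℂ ψ (L ⁻¹' Metric.ball (0 : Fin n → ℝ) ε) :=
    hψa.mono fun z hz => (hball hz).2
  have h0 : (0 : Fin n → ℂ) ∈ L ⁻¹' Metric.ball (0 : Fin n → ℝ) ε := by
    simp [hε]
  have hev : φ =ᶠ[𝓝 0] ψ := by
    filter_upwards [Metric.ball_mem_nhds (0 : Fin n → ℂ) (lt_min hr hs)] with z hz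
    have hz' := mem_ball_zero_iff.1 hz
    have h3 : ∀ j, ‖z j‖ < min r s := fun j => (norm_le_pi_norm z j).trans_lt hz'
    exact (hsr z fun j => (h3 j).trans_le (min_le_left _ _)).unique
      (hss z fun j => (h3 j).trans_le (min_le_right _ _))
  refine h1.eqOn_of_preconnected_of_eventuallyEq h2 hconv.isPreconnected h0 hev ?_
  have : L (fun j => (t j : ℂ)) = 0 := by
    funext j
    simp [L]
  simp [Set.mem_preimage, this, hε]

/-- The definition picks a continuation by choice; since lattice points are real, any other one
gives the same value. -/
theorem xIntegral_eq {n : ℕ} {q : ℝ} {f : Series n} {φ : (Fin n → ℂ) → ℂ}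
    (h : IsIntegrableContinuation q f φ) (s : Fin n → ℕ) (z : Fin n → ℝ) :
    xIntegral q s f z = jackson q φ fun j => q ^ (n - 1 - (j : ℕ) + s j) * z j := by
  have hX : XIntegrable q f := ⟨φ, h⟩
  unfold xIntegral
  rw [dif_pos hX]
  unfold jackson
  refine tsum_congr fun k => ?_
  unfold jacksonTerm
  refine Finset.sum_congr rfl fun ε _ => ?_
  congr 1
  exact (Classical.choose_spec hX).1.eq_ofReal h.1 _

/-! ### Products of functions of one variable -/

/-- `φ` continues the series `a`, convergent in the unit disc, to the strip, and is absolutely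
integrable. -/
def OneVarCont (q : ℝ) (a : PowerSeries ℂ) (φ : ℂ → ℂ) : Prop :=
  (∀ z : ℂ, ‖z‖ < 1 → HasSum (fun k => PowerSeries.coeff k a * z ^ k) (φ z)) ∧
    AnalyticOnNhd ℂ φ strip ∧ AbsInt q φ

section
variable {q : ℝ} {a b : PowerSeries ℂ} {φ ψ : ℂ → ℂ}

theorem OneVarCont.const_mul (h : OneVarCont q a φ) (c : ℂ) :
    OneVarCont q (c • a) fun z => c * φ z := by
  refine ⟨fun z hz => ?_, fun z hz => analyticAt_const.mul (h.2.1 z hz), h.2.2.const_mul c⟩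
  refine hasSum_of_eq ((h.1 z hz).mul_left c) (fun k => ?_) rfl
  rw [PowerSeries.coeff_smul, smul_eq_mul, mul_assoc]

theorem OneVarCont.sum {ι : Type} (s : Finset ι) {a : ι → PowerSeries ℂ} {φ : ι → ℂ → ℂ}
    (hq0 : 0 < q) (h : ∀ i ∈ s, OneVarCont q (a i) (φ i)) :
    OneVarCont q (∑ i ∈ s, a i) fun z => ∑ i ∈ s, φ i z := by
  refine ⟨fun z hz => ?_, fun z hz => ?_, AbsInt.sum s hq0 fun i hi => (h i hi).2.2⟩
  · refine hasSum_of_eq (hasSum_sum fun i hi => (h i hi).1 z hz) (fun k => ?_) rfl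
    rw [map_sum, Finset.sum_mul]
  · exact s.analyticAt_fun_sum fun i hi => (h i hi).2.1 z hz

theorem OneVarCont.comp_mul (h : OneVarCont q a φ) {c : ℝ} (hc : 0 < c) (hc1 : c ≤ 1) :
    OneVarCont q (PowerSeries.rescale (c : ℂ) a) fun z => φ (c * z) := by
  refine ⟨fun z hz => ?_, fun z hz => ?_, h.2.2.comp_mul hc.ne'⟩
  · have h1 : ‖(c : ℂ) * z‖ < 1 := by
      rw [norm_mul, Complex.norm_real, Real.norm_of_nonneg hc.le]
      have := norm_nonneg z
      nlinarith
    refine hasSum_of_eq (h.1 _ h1) (fun k => ?_) rfl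
    rw [PowerSeries.coeff_rescale, mul_pow]
    ring
  · refine AnalyticAt.fun_comp (g := φ) (h.2.1 _ ?_) (analyticAt_const.mul analyticAt_id)
    simp only [strip, Set.mem_ofPred_eq, Complex.im_ofReal_mul, abs_mul, abs_of_pos hc] at hz ⊢
    have := abs_nonneg z.im
    nlinarith

/-- The even part of a power series. -/
def evenSeries (a : PowerSeries ℂ) : PowerSeries ℂ :=
  PowerSeries.mk fun m => if Even m then PowerSeries.coeff m a else 0

theorem OneVarCont.even (h : OneVarCont q a φ) (hq0 : 0 < q) :
    OneVarCont q (evenSeries a) fun z => (1 / 2 : ℂ) * (φ z + φ (-z)) := by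
  refine ⟨fun z hz => ?_, fun z hz => ?_,
    (h.2.2.add h.2.2.comp_neg hq0).const_mul (1 / 2 : ℂ)⟩
  · refine hasSum_of_eq (((h.1 z hz).add (h.1 (-z) (by rwa [norm_neg]))).mul_left (1 / 2 : ℂ))
      (fun m => ?_) rfl
    simp only [evenSeries, PowerSeries.coeff_mk]
    split_ifs with he
    · rw [he.neg_pow]; ring
    · rw [(Nat.not_even_iff_odd.1 he).neg_pow]; ring
  · refine analyticAt_const.mul ((h.2.1 z hz).add ?_)
    refine AnalyticAt.fun_comp (g := φ) (h.2.1 _ ?_) analyticAt_id.neg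
    simpa [strip] using hz

/-- The lattice is symmetric, so projecting on the even part, required for integrability in the
definition of `I'`, does not change the value here. -/
theorem jack_even (h : OneVarCont q a φ) (hq0 : 0 < q) {ζ : ℝ} (hζ : ζ ≠ 0) :
    jack q (fun z => (1 / 2 : ℂ) * (φ z + φ (-z))) ζ = jack q φ ζ := by
  rw [jack_const_mul (φ := fun z => φ z + φ (-z)), jack_add h.2.2 h.2.2.comp_neg hq0 hζ,
    jack_comp_neg]
  ring

theorem oneVarCont_poly (hq0 : 0 < q) (hq1 : q < 1) (P : Polynomial ℂ) :
    OneVarCont q ((P : PowerSeries ℂ) * gaussSmall q) fun z => P.eval z * gaussFun q z := by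
  have hmon : ∀ k : ℕ, OneVarCont q (PowerSeries.X ^ k * gaussSmall q)
      fun z => z ^ k * gaussFun q z := by
    intro k
    refine ⟨fun z hz => ?_, fun z hz => ?_, absInt_pow_mul_gaussFun hq0 hq1 k⟩
    · have h1 := (hasSum_gaussSmall hq0 hq1 hz).mul_left (z ^ k)
      rw [← (add_left_injective k).hasSum_iff]
      · refine hasSum_of_eq h1 (fun m => ?_) rfl
        simp only [Function.comp]
        rw [PowerSeries.coeff_X_pow_mul, pow_add]
        ring
      · intro m hm
        rw [PowerSeries.coeff_X_pow_mul', if_neg, zero_mul]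
        intro hkm
        exact hm ⟨m - k, Nat.sub_add_cancel hkm⟩
    · exact (analyticAt_id.pow k).mul (analyticOnNhd_gaussFun hq0 hq1 z hz)
  have h := OneVarCont.sum P.support (a := fun k => P.coeff k • (PowerSeries.X ^ k * gaussSmall q))
    (φ := fun k z => P.coeff k * (z ^ k * gaussFun q z)) hq0
    fun k _ => (hmon k).const_mul (P.coeff k)
  convert h using 1
  · conv_lhs => rw [P.as_sum_support_C_mul_X_pow]
    rw [← Polynomial.coeToPowerSeries.ringHom_apply, map_sum, Finset.sum_mul]
    refine Finset.sum_congr rfl fun k _ => ?_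
    rw [Polynomial.coeToPowerSeries.ringHom_apply, Polynomial.coe_mul, Polynomial.coe_C,
      Polynomial.coe_pow, Polynomial.coe_X, mul_assoc, PowerSeries.smul_eq_C_mul]
  · funext z
    rw [Polynomial.eval_eq_sum, Polynomial.sum, Finset.sum_mul]
    exact Finset.sum_congr rfl fun k _ => by ring

end

section
variable {n : ℕ} {q : ℝ} {a : Fin n → PowerSeries ℂ} {φ : Fin n → ℂ → ℂ}

theorem isIntegrableContinuation_prod (hq0 : 0 < q) (hq1 : q < 1)
    (h : ∀ j, OneVarCont q (a j) (φ j)) :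
    IsIntegrableContinuation q (fun M : Exps n => ∏ j, PowerSeries.coeff (M j) (a j))
      fun z => ∏ j, φ j (z j) := by
  refine ⟨⟨⟨1, one_pos, fun z hz => ?_⟩, {y | ∀ j, |y j| < 1}, ?_, ?_, fun z hz => ?_⟩,
    fun z hz ε => ?_⟩
  · have h1 := hasSum_pi_prod (f := fun j k => PowerSeries.coeff k (a j) * z j ^ k)
      fun j => ((h j).1 (z j) (hz j)).summable.norm
    convert h1 using 2
    · exact Finset.prod_mul_distrib.symm
    · exact ((h _).1 _ (hz _)).tsum_eq.symm
  · rw [Set.ofPred_forall]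
    exact isOpen_iInter_of_finite fun j => isOpen_lt (by fun_prop) continuous_const
  · intro j; simp
  · refine Finset.analyticAt_fun_prod Finset.univ fun j _ => ?_
    exact AnalyticAt.fun_comp (g := φ j) ((h j).2.1 (z j) (hz j))
      ((ContinuousLinearMap.proj (R := ℂ) (φ := fun _ : Fin n => ℂ) j).analyticAt z)
  · have hq2 : 0 < 1 - q ^ 2 := sub_pos.2 (pow_lt_one₀ hq0.le hq1 two_ne_zero)
    have hs : ∀ j, Summable fun k : ℤ =>
        ‖(((1 - q ^ 2) * q ^ (2 * k) * |z j| : ℝ) : ℂ) * φ j (pt q (z j) (ε j) k)‖ := by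
      intro j
      refine (((h j).2.2 (z j) (hz j) (ε j)).mul_left ((1 - q ^ 2) * |z j|)).congr fun k => ?_
      rw [norm_mul, Complex.norm_real, Real.norm_of_nonneg]
      · ring
      · have := zpow_pos hq0 (2 * k)
        positivity
    refine (summable_norm_pi_prod hs).congr fun k => ?_
    rw [Finset.prod_mul_distrib, norm_mul, ← Complex.ofReal_prod, Complex.norm_real,
      Real.norm_of_nonneg]
    · rw [Finset.prod_mul_distrib, Finset.prod_mul_distrib, Finset.prod_const, Finset.card_univ,
        Fintype.card_fin, Finset.mul_sum]
      congr 3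
      exact (zpow_sum hq0.ne' _ _).symm
    · refine Finset.prod_nonneg fun j _ => ?_
      have := zpow_pos hq0 (2 * k j)
      positivity

theorem jackson_prod (hq0 : 0 < q) (h : ∀ j, AbsInt q (φ j)) {z : Fin n → ℝ} (hz : ∀ j, z j ≠ 0) :
    jackson q (fun z => ∏ j, φ j (z j)) z = ∏ j, jack q (φ j) (z j) := by
  have h1 := hasSum_pi_prod (f := fun j k => jackTerm q (φ j) (z j) k)
    fun j => (h j).summable_jackTerm (hz j) hq0
  unfold jackson jack
  rw [← h1.tsum_eq]
  refine tsum_congr fun k => ?_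
  simp only [jackTerm, jacksonTerm]
  rw [Finset.prod_univ_sum, Fintype.piFinset_univ]
  refine Finset.sum_congr rfl fun ε _ => ?_
  rw [Finset.prod_mul_distrib, ← Complex.ofReal_prod]
  congr 2
  rw [Finset.prod_mul_distrib, Finset.prod_mul_distrib, Finset.prod_const, Finset.card_univ,
    Fintype.card_fin, Finset.mul_sum]
  congr 2
  exact zpow_sum hq0.ne' _ _

theorem xIntegral_prod (hq0 : 0 < q) (hq1 : q < 1) (h : ∀ j, OneVarCont q (a j) (φ j))
    (s : Fin n → ℕ) {z : Fin n → ℝ} (hz : ∀ j, z j ≠ 0) :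
    xIntegral q s (fun M : Exps n => ∏ j, PowerSeries.coeff (M j) (a j)) z =
      ∏ j, jack q (φ j) (q ^ (n - 1 - (j : ℕ) + s j) * z j) := by
  rw [xIntegral_eq (isIntegrableContinuation_prod hq0 hq1 h),
    jackson_prod hq0 (fun j => (h j).2.2) fun j => mul_ne_zero (pow_pos hq0 _).ne' (hz j)]

end

end BraidedFourier

end

noncomputable section

namespace BraidedFourier

open Polynomial

/-! ### Linear operators on polynomials -/

/-- The linear map with prescribed values on the powers of `X`. -/
def linExt {V : Type} [AddCommGroup V] [Module ℂ V] (f : ℕ → V) : ℂ[X] →ₗ[ℂ] V :=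
  Polynomial.lsum fun k => LinearMap.toSpanSingleton ℂ V (f k)

section
variable {V : Type} [AddCommGroup V] [Module ℂ V]

theorem linExt_apply (f : ℕ → V) (p : ℂ[X]) : linExt f p = p.sum fun k a => a • f k := by
  simp [linExt, Polynomial.lsum_apply]

theorem linExt_X_pow (f : ℕ → V) (k : ℕ) : linExt f (X ^ k) = f k := by
  rw [linExt_apply, ← Polynomial.monomial_one_right_eq_X_pow, Polynomial.sum_monomial_index]
  · simp
  · simp

theorem linearMap_eq_of_X_pow {f g : ℂ[X] →ₗ[ℂ] V} (h : ∀ k, f (X ^ k) = g (X ^ k)) (p : ℂ[X]) :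
    f p = g p := by
  have : f = g := by
    refine Polynomial.lhom_ext' fun k => LinearMap.ext_ring ?_
    simpa [Polynomial.monomial_one_right_eq_X_pow] using h k
  rw [this]

end

/-- The moments of `e_{q⁴}(-t²)`. -/
def mom (q : ℝ) : ℕ → ℂ
  | 0 => 1
  | 1 => 0
  | k + 2 => (((q : ℂ) ^ (2 * (k + 1)))⁻¹ - 1) * mom q k

/-- The moments of `E_{q⁴}(-q⁴t²)`. -/
def momD (q : ℝ) : ℕ → ℂ
  | 0 => 1
  | 1 => 0
  | k + 2 => (1 - (q : ℂ) ^ (2 * (k + 1))) * momD q k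

/-- The operator on polynomials that multiplication by `∂` corresponds to. -/
def raise (q : ℝ) : ℂ[X] →ₗ[ℂ] ℂ[X] :=
  linExt fun k => (-Complex.I) • ((1 - (q : ℂ) ^ (2 * k)) • X ^ (k - 1) - (q : ℂ) ^ (2 * k) • X ^ (k + 1))

/-- The polynomials that the powers of `∂` correspond to. -/
def hermite (q : ℝ) : ℕ → ℂ[X]
  | 0 => 1
  | m + 1 => raise q (hermite q m)

/-- The transform on the polynomial factors. -/
def polyMap (q : ℝ) : ℂ[X] →ₗ[ℂ] ℂ[X] := linExt (hermite q)

theorem mom_odd (q : ℝ) {k : ℕ} (hk : ¬ Even k) : mom q k = 0 := by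
  induction k using Nat.strong_induction_on with
  | _ k ih =>
    match k, hk, ih with
    | 0, hk, _ => simp at hk
    | 1, _, _ => rfl
    | k + 2, hk, ih => rw [mom, ih k (by omega) (by simpa [parity_simps] using hk), mul_zero]

theorem momD_odd (q : ℝ) {k : ℕ} (hk : ¬ Even k) : momD q k = 0 := by
  induction k using Nat.strong_induction_on with
  | _ k ih =>
    match k, hk, ih with
    | 0, hk, _ => simp at hk
    | 1, _, _ => rfl
    | k + 2, hk, ih => rw [momD, ih k (by omega) (by simpa [parity_simps] using hk), mul_zero]

/-! ### The two transforms in one variable -/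

section
variable {q : ℝ} (hq0 : 0 < q) (hq1 : q < 1)
include hq0 hq1

theorem one_sub_pow_ne_zero {k : ℕ} (hk : k ≠ 0) : (1 : ℂ) - (q : ℂ) ^ k ≠ 0 := by
  have : 1 - q ^ k ≠ 0 := (sub_pos.2 (pow_lt_one₀ hq0.le hq1 hk)).ne'
  exact_mod_cast this

/-- The equation `w(q²t) = (1+t²)w(t)` on coefficients. -/
theorem coeff_gaussSmall_add_two (m : ℕ) :
    PowerSeries.coeff m (gaussSmall q) =
      -(1 - (q : ℂ) ^ (2 * (m + 2))) * PowerSeries.coeff (m + 2) (gaussSmall q) := by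
  simp only [gaussSmall, sqSubst, PowerSeries.coeff_mk, eSeries]
  by_cases he : Even m
  · rw [if_pos he, if_pos (he.add even_two)]
    obtain ⟨r, rfl⟩ := he
    have h1 : (r + r) / 2 = r := by omega
    have h2 : (r + r + 2) / 2 = r + 1 := by omega
    have h3 := one_sub_pow_ne_zero hq0 hq1 (k := 2 * (r + r + 2)) (by omega)
    have h4 := qPoch_ne_zero (pow_pos hq0 4) (pow_four_lt_one hq0 hq1) r
    have h5 : (1 : ℂ) - ((q : ℂ) ^ 4) ^ (r + 1) = 1 - (q : ℂ) ^ (2 * (r + r + 2)) := by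
      rw [← pow_mul]; congr 2; ring
    rw [h1, h2, qPoch_succ]
    push_cast at h4 ⊢
    rw [h5]
    field_simp
    ring
  · rw [if_neg he, if_neg (by simpa [parity_simps] using he), mul_zero]

omit hq0 hq1 in
theorem coeff_one_gaussSmall : PowerSeries.coeff 1 (gaussSmall q) = 0 := by
  simp [gaussSmall, sqSubst]

/-- The right side is the coefficient of `-i(f(t)-f(q²t))/t` for `f = p w`; the factor `1+t²` in
`w(q²t)` explains the two terms of `raise`. -/
theorem coeff_raise_mul (p : ℂ[X]) (E : ℕ) :
    PowerSeries.coeff E ((raise q p : PowerSeries ℂ) * gaussSmall q) =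
      -Complex.I * (1 - (q : ℂ) ^ (2 * (E + 1))) *
        PowerSeries.coeff (E + 1) ((p : PowerSeries ℂ) * gaussSmall q) := by
  let f : ℂ[X] →ₗ[ℂ] ℂ :=
    { toFun := fun p => PowerSeries.coeff E ((raise q p : PowerSeries ℂ) * gaussSmall q)
      map_add' := fun a b => by simp [add_mul]
      map_smul' := fun c a => by simp }
  let g : ℂ[X] →ₗ[ℂ] ℂ :=
    { toFun := fun p => -Complex.I * (1 - (q : ℂ) ^ (2 * (E + 1))) *
        PowerSeries.coeff (E + 1) ((p : PowerSeries ℂ) * gaussSmall q)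
      map_add' := fun a b => by simp [add_mul, mul_add]
      map_smul' := fun c a => by simp; ring }
  refine linearMap_eq_of_X_pow (f := f) (g := g) (fun k => ?_) p
  simp only [f, g, LinearMap.coe_mk, AddHom.coe_mk, raise, linExt_X_pow, Polynomial.coe_smul,
    Polynomial.coe_sub, Polynomial.coe_pow, Polynomial.coe_X, sub_mul, smul_mul_assoc, map_sub,
    PowerSeries.coeff_smul, smul_eq_mul, PowerSeries.coeff_X_pow_mul']
  rcases k with _ | k
  · simp only [mul_zero, pow_zero, sub_self, zero_add, zero_le, if_true, Nat.sub_zero]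
    rcases E with _ | E
    · simp [coeff_one_gaussSmall]
    · rw [if_pos (by omega), Nat.add_sub_cancel, coeff_gaussSmall_add_two hq0 hq1 E]
      ring_nf
  · simp only [Nat.add_sub_cancel, add_le_add_iff_right, Nat.add_sub_add_right]
    by_cases hk : k ≤ E
    · rw [if_pos hk]
      obtain ⟨r, rfl⟩ := Nat.exists_eq_add_of_le hk
      rw [Nat.add_sub_cancel_left]
      split_ifs with h2
      · obtain ⟨s, rfl⟩ : ∃ s, r = s + 2 := ⟨r - 2, by omega⟩
        rw [show k + (s + 2) - (k + 1 + 1) = s by omega, coeff_gaussSmall_add_two hq0 hq1 s]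
        ring
      · obtain rfl | rfl : r = 0 ∨ r = 1 := by omega
        · ring
        · rw [coeff_one_gaussSmall]; ring
    · rw [if_neg hk, if_neg (by omega)]
      ring

omit hq0 hq1 in
theorem polyMap_X_mul (p : ℂ[X]) : polyMap q (X * p) = raise q (polyMap q p) := by
  refine linearMap_eq_of_X_pow (f := (polyMap q).comp (LinearMap.mulLeft ℂ X))
    (g := (raise q).comp (polyMap q)) (fun k => ?_) p
  simp only [LinearMap.comp_apply, LinearMap.mulLeft_apply, ← pow_succ', polyMap, linExt_X_pow,
    hermite]

/-- `G''` in one variable. -/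
theorem momD_transform (p : ℂ[X]) (E : ℕ) :
    Complex.I ^ E / (qPoch (q ^ 2) E : ℂ) * linExt (momD q) (X ^ E * p) =
      PowerSeries.coeff E ((polyMap q p : PowerSeries ℂ) * gaussSmall q) := by
  have hP : ∀ k, (qPoch (q ^ 2) k : ℂ) ≠ 0 :=
    qPoch_ne_zero (pow_pos hq0 2) (pow_lt_one₀ hq0.le hq1 two_ne_zero)
  have hP' : ∀ k, (qPoch (q ^ 2) (k + 1) : ℂ) = qPoch (q ^ 2) k * (1 - (q : ℂ) ^ (2 * (k + 1))) := by
    intro k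
    rw [qPoch_succ, pow_mul]
    push_cast
    rfl
  let f : ℂ[X] →ₗ[ℂ] ℂ := (Complex.I ^ E / (qPoch (q ^ 2) E : ℂ)) •
    (linExt (momD q)).comp (LinearMap.mulLeft ℂ (X ^ E))
  let g : ℂ[X] →ₗ[ℂ] ℂ :=
    { toFun := fun p => PowerSeries.coeff E ((polyMap q p : PowerSeries ℂ) * gaussSmall q)
      map_add' := fun a b => by simp [add_mul]
      map_smul' := fun c a => by simp }
  refine linearMap_eq_of_X_pow (f := f) (g := g) (fun m => ?_) p
  simp only [f, g, LinearMap.smul_apply, LinearMap.comp_apply, LinearMap.mulLeft_apply, smul_eq_mul,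
    LinearMap.coe_mk, AddHom.coe_mk, ← pow_add, linExt_X_pow]
  clear f g
  -- A factor `X` raises `E` by one on the left and applies the difference operator on the right, so
  -- the induction must hold for all `E`. The base case compares the moments of `W` with the
  -- coefficients of `w` by their recurrences.
  induction m generalizing E with
  | zero =>
    have h0 : polyMap q (X ^ 0) = 1 := by rw [polyMap, linExt_X_pow]; rfl
    rw [h0, Polynomial.coe_one, one_mul, add_zero]
    induction E using Nat.strong_induction_on with
    | _ E ih =>
      match E, ih with
      | 0, _ => simp [momD, gaussSmall, sqSubst, eSeries, qPoch_zero]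
      | 1, _ => rw [coeff_one_gaussSmall]; simp [momD]
      | E + 2, ih =>
        have h1 := ih E (by omega)
        rw [coeff_gaussSmall_add_two hq0 hq1 E] at h1
        have h2 := one_sub_pow_ne_zero hq0 hq1 (k := 2 * (E + 1)) (by omega)
        have h3 := one_sub_pow_ne_zero hq0 hq1 (k := 2 * (E + 2)) (by omega)
        have h4 := hP E
        have h5 : Complex.I ^ (E + 2) = -Complex.I ^ E := by rw [pow_add, Complex.I_sq]; ring
        rw [hP', hP', momD, h5]
        rw [show E + 1 + 1 = E + 2 from rfl]
        field_simp at h1 ⊢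
        linear_combination -h1
  | succ m ih =>
    have h1 := ih (E + 1)
    rw [pow_succ' X m, polyMap_X_mul, coeff_raise_mul hq0 hq1, ← h1, hP']
    have h2 := one_sub_pow_ne_zero hq0 hq1 (k := 2 * (E + 1)) (by omega)
    have h4 := hP E
    rw [show E + (m + 1) = E + 1 + m by ring, pow_succ]
    field_simp
    linear_combination (momD q (E + 1 + m) * Complex.I ^ E) * Complex.I_sq

omit hq1 in
-- The integral of a `q²`-difference quotient vanishes; on moments this is their recurrence.
theorem mom_raise_zero (p : ℂ[X]) : linExt (mom q) (raise q p) = 0 := by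
  refine linearMap_eq_of_X_pow (f := (linExt (mom q)).comp (raise q)) (g := 0) (fun k => ?_) p
  have hq : (q : ℂ) ≠ 0 := Complex.ofReal_ne_zero.2 hq0.ne'
  rw [LinearMap.comp_apply, raise, linExt_X_pow, map_smul, map_sub, map_smul, map_smul, linExt_X_pow,
    linExt_X_pow, LinearMap.zero_apply]
  rcases k with _ | k
  · simp [mom]
  · rw [Nat.add_sub_cancel, mom]
    simp only [smul_eq_mul]
    field_simp
    ring

omit hq1 in
-- `q`-integration by parts: the difference operator is moved from `p w` onto the power of `t`.
theorem mom_X_pow_mul_raise (p : ℂ[X]) (E : ℕ) : linExt (mom q) (X ^ (E + 1) * raise q p) =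
    -Complex.I * (1 - ((q : ℂ) ^ (2 * (E + 1)))⁻¹) * linExt (mom q) (X ^ E * p) := by
  refine linearMap_eq_of_X_pow
    (f := (linExt (mom q)).comp ((LinearMap.mulLeft ℂ (X ^ (E + 1))).comp (raise q)))
    (g := (-Complex.I * (1 - ((q : ℂ) ^ (2 * (E + 1)))⁻¹)) •
      (linExt (mom q)).comp (LinearMap.mulLeft ℂ (X ^ E))) (fun k => ?_) p
  have hq : (q : ℂ) ≠ 0 := Complex.ofReal_ne_zero.2 hq0.ne'
  rw [LinearMap.comp_apply, LinearMap.comp_apply, raise, linExt_X_pow]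
  simp only [LinearMap.smul_apply, LinearMap.comp_apply, LinearMap.mulLeft_apply,
    mul_sub, ← pow_add, map_smul, map_sub, linExt_X_pow, smul_eq_mul]
  rcases k with _ | k
  · simp only [mul_zero, pow_zero, sub_self, zero_mul, zero_add, add_zero, zero_sub, one_mul]
    rw [mom]
    ring
  · rw [Nat.add_sub_cancel, show E + 1 + k = E + (k + 1) by ring,
      show E + 1 + (k + 1 + 1) = E + (k + 1) + 2 by ring, mom]
    rw [show 2 * (E + (k + 1) + 1) = 2 * (E + 1) + 2 * (k + 1) by ring, pow_add]
    field_simp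
    ring

/-- The equation `W(t) = (1 - q⁴t²)W(q²t)` on coefficients. -/
theorem coeff_gaussBig_add_two (m : ℕ) :
    PowerSeries.coeff (m + 2) (gaussBig q) * (1 - (q : ℂ) ^ (2 * (m + 2))) =
      -(q : ℂ) ^ (2 * m + 4) * PowerSeries.coeff m (gaussBig q) := by
  simp only [gaussBig, sqSubst, PowerSeries.coeff_mk]
  by_cases he : Even m
  · rw [if_pos he, if_pos (he.add even_two)]
    obtain ⟨r, rfl⟩ := he
    have h1 : (r + r) / 2 = r := by omega
    have h2 : (r + r + 2) / 2 = r + 1 := by omega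
    have h6 := bigCoeff_succ (pow_pos hq0 4) (pow_four_lt_one hq0 hq1) r
    have h7 : ∀ k, PowerSeries.coeff k (ESeries (q ^ 4)) = (bigCoeff (q ^ 4) k : ℂ) := by
      intro k; simp [ESeries, bigCoeff]
    have h8 : (bigCoeff (q ^ 4) (r + 1) : ℂ) * (1 - ((q : ℂ) ^ 4) ^ (r + 1)) =
        ((q : ℂ) ^ 4) ^ r * bigCoeff (q ^ 4) r := by
      exact_mod_cast congrArg Complex.ofReal h6
    rw [h1, h2, h7, h7]
    have h5 : (1 : ℂ) - ((q : ℂ) ^ 4) ^ (r + 1) = 1 - (q : ℂ) ^ (2 * (r + r + 2)) := by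
      rw [← pow_mul]; congr 2; ring
    have h9 : (q : ℂ) ^ (2 * (r + r) + 4) = ((q : ℂ) ^ 4) ^ r * (q : ℂ) ^ 4 := by
      rw [← pow_mul, ← pow_add]; congr 1; ring
    rw [h5] at h8
    rw [pow_succ (-(q : ℂ) ^ 4) r, h9]
    linear_combination (-(q : ℂ) ^ 4) ^ r * (-(q : ℂ) ^ 4) * h8
  · rw [if_neg he, if_neg (by simpa [parity_simps] using he), mul_zero, zero_mul]

/-- `F_S` in one variable. -/
theorem mom_transform (p : ℂ[X]) (E : ℕ) :
    (-Complex.I) ^ E * (q : ℂ) ^ (E ^ 2 + E) / (qPoch (q ^ 2) E : ℂ) *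
        linExt (mom q) (X ^ E * polyMap q p) =
      PowerSeries.coeff E (gaussBig q * (p : PowerSeries ℂ)) := by
  have hq : (q : ℂ) ≠ 0 := Complex.ofReal_ne_zero.2 hq0.ne'
  have hP : ∀ k, (qPoch (q ^ 2) k : ℂ) ≠ 0 :=
    qPoch_ne_zero (pow_pos hq0 2) (pow_lt_one₀ hq0.le hq1 two_ne_zero)
  have hP' : ∀ k, (qPoch (q ^ 2) (k + 1) : ℂ) = qPoch (q ^ 2) k * (1 - (q : ℂ) ^ (2 * (k + 1))) := by
    intro k
    rw [qPoch_succ, pow_mul]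
    push_cast
    rfl
  let f : ℂ[X] →ₗ[ℂ] ℂ := ((-Complex.I) ^ E * (q : ℂ) ^ (E ^ 2 + E) / (qPoch (q ^ 2) E : ℂ)) •
    (linExt (mom q)).comp ((LinearMap.mulLeft ℂ (X ^ E)).comp (polyMap q))
  let g : ℂ[X] →ₗ[ℂ] ℂ :=
    { toFun := fun p => PowerSeries.coeff E (gaussBig q * (p : PowerSeries ℂ))
      map_add' := fun a b => by simp [mul_add]
      map_smul' := fun c a => by simp }
  refine linearMap_eq_of_X_pow (f := f) (g := g) (fun m => ?_) p
  simp only [f, g, LinearMap.smul_apply, LinearMap.comp_apply, LinearMap.mulLeft_apply, smul_eq_mul,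
    LinearMap.coe_mk, AddHom.coe_mk, Polynomial.coe_pow, Polynomial.coe_X]
  clear f g
  induction m generalizing E with
  | zero =>
    have h0 : polyMap q (X ^ 0) = 1 := by rw [polyMap, linExt_X_pow]; rfl
    rw [h0, pow_zero, mul_one, mul_one, linExt_X_pow]
    induction E using Nat.strong_induction_on with
    | _ E ih =>
      match E, ih with
      | 0, _ => simp [mom, gaussBig, sqSubst, ESeries, qPoch_zero]
      | 1, _ => simp [mom, gaussBig, sqSubst]
      | E + 2, ih =>
        have h1 := ih E (by omega)
        have h6 := coeff_gaussBig_add_two hq0 hq1 E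
        have h2 := one_sub_pow_ne_zero hq0 hq1 (k := 2 * (E + 1)) (by omega)
        have h3 := one_sub_pow_ne_zero hq0 hq1 (k := 2 * (E + 2)) (by omega)
        have h4 := hP E
        have h5 : (-Complex.I) ^ (E + 2) = -(-Complex.I) ^ E := by
          rw [pow_add, neg_sq, Complex.I_sq]; ring
        rw [← h1] at h6
        rw [← mul_left_inj' h3, h6, hP', hP', mom, h5]
        rw [show E + 1 + 1 = E + 2 from rfl,
          show (E + 2) ^ 2 + (E + 2) = (E ^ 2 + E) + (2 * E + 4) + 2 * (E + 1) by ring, pow_add, pow_add]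
        field_simp
  | succ m ih =>
    rw [pow_succ' X m, polyMap_X_mul]
    -- At `E = 0` both sides vanish: a difference integrates to zero, and `W X^{m+1}` has no
    -- constant term. Otherwise integration by parts lowers `E`, as multiplication by `X` does on
    -- the right.
    rcases E with _ | E
    · rw [pow_zero X, one_mul, mom_raise_zero hq0, mul_zero, pow_succ, ← mul_assoc,
        PowerSeries.coeff_zero_mul_X]
    · rw [mom_X_pow_mul_raise hq0, pow_succ (PowerSeries.X),
        ← mul_assoc (gaussBig q), PowerSeries.coeff_succ_mul_X, ← ih E, hP']
      have h2 := one_sub_pow_ne_zero hq0 hq1 (k := 2 * (E + 1)) (by omega)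
      have h4 := hP E
      rw [show (E + 1) ^ 2 + (E + 1) = (E ^ 2 + E) + 2 * (E + 1) by ring, pow_add, pow_succ (-Complex.I)]
      field_simp
      linear_combination ((q : ℂ) ^ (E ^ 2 + E + 2 * (E + 1)) * ((q : ℂ) ^ (2 * (E + 1)) - 1) *
        linExt (mom q) (X ^ E * polyMap q (X ^ m))) * Complex.I_sq

end

end BraidedFourier

end

noncomputable section

namespace BraidedFourier

open Polynomial

/-! ### Parity and surjectivity of the transform of polynomials -/

theorem HasParity.smul {p : ℂ[X]} {b : ZMod 2} (h : HasParity p b) (c : ℂ) :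
    HasParity (c • p) b := by
  intro k hk
  refine h k fun h0 => hk ?_
  rw [coeff_smul, h0, smul_zero]

theorem HasParity.add {p r : ℂ[X]} {b : ZMod 2} (h : HasParity p b) (h' : HasParity r b) :
    HasParity (p + r) b := by
  intro k hk
  by_cases h0 : p.coeff k = 0
  · refine h' k fun h1 => hk ?_
    rw [coeff_add, h0, h1, add_zero]
  · exact h k h0

theorem HasParity.zero (b : ZMod 2) : HasParity 0 b := fun k hk => absurd (coeff_zero k) hk

theorem hasParity_X_pow (k : ℕ) : HasParity (X ^ k) (k : ZMod 2) := by
  intro m hm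
  rw [coeff_X_pow] at hm
  by_contra h
  apply hm
  rw [if_neg]
  rintro rfl
  exact h rfl

theorem HasParity.linExt {f : ℕ → ℂ[X]} {b c : ZMod 2}
    (hf : ∀ k : ℕ, (k : ZMod 2) = b → HasParity (f k) c) {p : ℂ[X]} (hp : HasParity p b) :
    HasParity (linExt f p) c := by
  rw [linExt_apply, Polynomial.sum]
  refine Finset.sum_induction _ (fun r => HasParity r c) (fun _ _ => HasParity.add)
    (HasParity.zero c) fun k hk => ?_
  exact (hf k (hp k (mem_support_iff.1 hk))).smul _

theorem HasParity.raise {q : ℝ} {p : ℂ[X]} {b : ZMod 2} (hp : HasParity p b) :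
    HasParity (raise q p) (b + 1) := by
  refine HasParity.linExt (fun k hk => HasParity.smul ?_ _) hp
  rw [sub_eq_add_neg, ← neg_smul]
  refine HasParity.add ?_ ?_
  · rcases k with _ | k
    · simp [HasParity.zero]
    · refine HasParity.smul ?_ _
      rw [← hk, Nat.add_sub_cancel]
      convert hasParity_X_pow k using 1
      push_cast
      rw [add_assoc, one_add_one_eq_two, show (2 : ZMod 2) = 0 from rfl, add_zero]
  · refine HasParity.smul ?_ _
    rw [← hk]
    exact_mod_cast hasParity_X_pow (k + 1)

theorem hasParity_hermite (q : ℝ) (m : ℕ) : HasParity (hermite q m) (m : ZMod 2) := by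
  induction m with
  | zero => simpa [hermite] using hasParity_X_pow 0
  | succ m ih =>
    rw [hermite, Nat.cast_succ]
    exact ih.raise

theorem HasParity.polyMap {q : ℝ} {p : ℂ[X]} {b : ZMod 2} (hp : HasParity p b) :
    HasParity (polyMap q p) b :=
  HasParity.linExt (fun k hk => hk ▸ hasParity_hermite q k) hp

/-- Preimages of the powers of `X` under `polyMap`. -/
def preim (q : ℝ) : ℕ → ℂ[X]
  | 0 => 1
  | 1 => (-Complex.I) • X
  | m + 2 => (Complex.I * (q : ℂ) ^ (2 * (m + 1)))⁻¹ •
      (X * preim q (m + 1) + (Complex.I * (1 - (q : ℂ) ^ (2 * (m + 1)))) • preim q m)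

theorem HasParity.X_mul {p : ℂ[X]} {b : ZMod 2} (hp : HasParity p b) : HasParity (X * p) (b + 1) := by
  intro k hk
  rcases k with _ | k
  · simp at hk
  · rw [coeff_X_mul] at hk
    rw [Nat.cast_succ, hp k hk]

theorem hasParity_preim (q : ℝ) (m : ℕ) :
    HasParity (preim q m) (m : ZMod 2) ∧ HasParity (preim q (m + 1)) ((m + 1 : ℕ) : ZMod 2) := by
  induction m with
  | zero =>
    constructor
    · simpa [preim] using hasParity_X_pow 0
    · simpa [preim] using (hasParity_X_pow 1).smul (-Complex.I)
  | succ m ih =>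
    refine ⟨ih.2, ?_⟩
    rw [preim]
    refine HasParity.smul (HasParity.add ?_ (HasParity.smul ?_ _)) _
    · rw [Nat.cast_succ]
      exact ih.2.X_mul
    · convert ih.1 using 1
      push_cast
      rw [add_assoc, one_add_one_eq_two, show (2 : ZMod 2) = 0 from rfl, add_zero]

theorem polyMap_one (q : ℝ) : polyMap q 1 = 1 := by
  rw [← pow_zero (X : ℂ[X]), polyMap, linExt_X_pow, hermite, pow_zero]

theorem polyMap_preim {q : ℝ} (hq0 : 0 < q) (m : ℕ) :
    polyMap q (preim q m) = X ^ m ∧ polyMap q (preim q (m + 1)) = X ^ (m + 1) := by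
  have hq : (q : ℂ) ≠ 0 := Complex.ofReal_ne_zero.2 hq0.ne'
  induction m with
  | zero =>
    constructor
    · rw [preim, polyMap_one, pow_zero]
    · rw [zero_add, preim, map_smul, ← mul_one X, polyMap_X_mul, polyMap_one, ← pow_zero (X : ℂ[X]),
        raise, linExt_X_pow]
      simp [smul_smul]
  | succ m ih =>
    refine ⟨ih.2, ?_⟩
    rw [preim, map_smul, map_add, map_smul, polyMap_X_mul, ih.1, ih.2, raise, linExt_X_pow]
    rw [Nat.add_sub_cancel, smul_sub, smul_smul, smul_smul, neg_mul, neg_mul, neg_smul, neg_smul,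
      sub_neg_eq_add]
    have h : -((Complex.I * (1 - (q : ℂ) ^ (2 * (m + 1)))) • (X : ℂ[X]) ^ m) +
        (Complex.I * (q : ℂ) ^ (2 * (m + 1))) • (X : ℂ[X]) ^ (m + 1 + 1) +
        (Complex.I * (1 - (q : ℂ) ^ (2 * (m + 1)))) • X ^ m =
        (Complex.I * (q : ℂ) ^ (2 * (m + 1))) • (X : ℂ[X]) ^ (m + 1 + 1) := by abel
    rw [h, inv_smul_smul₀ (mul_ne_zero Complex.I_ne_zero (pow_ne_zero _ hq))]

/-- The formula for `raise X^{m+1}` can be solved for `X^{m+2}`, because the coefficient `i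
q^{2(m+1)}` is invertible; `preim` records the solution. Thus every element of the second class is,
up to a scalar, an image of the first. -/
theorem exists_polyMap_eq {q : ℝ} (hq0 : 0 < q) {P : ℂ[X]} {b : ZMod 2} (hP : HasParity P b) :
    ∃ p, HasParity p b ∧ polyMap q p = P := by
  refine ⟨linExt (preim q) P, hP.linExt fun k hk => hk ▸ (hasParity_preim q k).1, ?_⟩
  refine linearMap_eq_of_X_pow (f := (polyMap q).comp (linExt (preim q))) (g := LinearMap.id)
    (fun k => ?_) P
  rw [LinearMap.comp_apply, linExt_X_pow, (polyMap_preim hq0 k).1, LinearMap.id_apply]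

/-- Here `X^E p` is odd. This confines the transforms to exponents of parity `β`, on which the
shifted lattices agree. -/
theorem linExt_eq_zero_of_parity {f : ℕ → ℂ} (hf : ∀ k, ¬ Even k → f k = 0) {p : ℂ[X]}
    {b : ZMod 2} (hp : HasParity p b) {E : ℕ} (hE : (E : ZMod 2) ≠ b) :
    linExt f (X ^ E * p) = 0 := by
  rw [linExt_apply, Polynomial.sum]
  refine Finset.sum_eq_zero fun k hk => ?_
  rw [hf k, smul_zero]
  intro he
  have hk' := mem_support_iff.1 hk
  rw [coeff_X_pow_mul'] at hk'
  split_ifs at hk' with hle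
  · apply hE
    rw [← hp _ hk', Nat.cast_sub hle, (ZMod.natCast_eq_zero_iff_even).2 he, zero_sub]
    exact (ZMod.neg_eq_self_mod_two _).symm
  · exact hk' rfl

/-! ### The transform `F_S` -/

/-- The Gaussian integral `∫_{-ζ·∞}^{ζ·∞} e_{q⁴}(-t²)`. -/
def gaussInt (q : ℝ) (ζ : ℝ) : ℂ := jack q (gaussFun q) ζ

theorem qFactorial_eq {p : ℝ} (h1 : p < 1) (m : ℕ) :
    qFactorial p m = qPoch p m / (1 - p) ^ m := by
  have h2 : 1 - p ≠ 0 := (sub_pos.2 h1).ne'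
  have h3 : p - 1 ≠ 0 := (sub_neg.2 h1).ne
  rw [qFactorial, qPoch, ← Finset.card_range m, ← Finset.prod_const, Finset.card_range,
    ← Finset.prod_div_distrib]
  refine Finset.prod_congr rfl fun l _ => ?_
  rw [qNumber, div_eq_div_iff h3 h2]
  ring

section
variable {q : ℝ} (hq0 : 0 < q) (hq1 : q < 1)
include hq0 hq1

theorem jack_pow_mul_gaussFun (k : ℕ) {ζ : ℝ} (hζ : ζ ≠ 0) :
    jack q (fun z => z ^ k * gaussFun q z) ζ = gaussInt q ζ * mom q k := by
  induction k using Nat.strong_induction_on with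
  | _ k ih =>
    match k, ih with
    | 0, _ => simp [mom, gaussInt]
    | 1, _ =>
      rw [mom, mul_zero]
      refine jack_odd (fun z => ?_) ζ
      simp [gaussFun]
    | k + 2, ih =>
      rw [jack_pow_add_two hq0 hq1 k hζ, ih k (by omega), mom]
      ring

theorem jack_poly (P : ℂ[X]) {ζ : ℝ} (hζ : ζ ≠ 0) :
    jack q (fun z => P.eval z * gaussFun q z) ζ = gaussInt q ζ * linExt (mom q) P := by
  have h : (fun z => P.eval z * gaussFun q z) =
      fun z => ∑ k ∈ P.support, P.coeff k * (z ^ k * gaussFun q z) := by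
    funext z
    rw [eval_eq_sum, Polynomial.sum, Finset.sum_mul]
    exact Finset.sum_congr rfl fun k _ => by ring
  rw [h, jack_sum (φ := fun k z => P.coeff k * (z ^ k * gaussFun q z)) P.support hq0
    (fun k _ => (absInt_pow_mul_gaussFun hq0 hq1 k).const_mul _) hζ, linExt_apply, Polynomial.sum,
    Finset.mul_sum]
  refine Finset.sum_congr rfl fun k _ => ?_
  rw [jack_const_mul (φ := fun z => z ^ k * gaussFun q z), jack_pow_mul_gaussFun hq0 hq1 k hζ,
    smul_eq_mul]
  ring

omit hq1 in
theorem gaussInt_pow_mul (m : ℕ) (ζ : ℝ) : gaussInt q (q ^ (2 * m) * ζ) = gaussInt q ζ := by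
  induction m with
  | zero => simp
  | succ m ih =>
    rw [show q ^ (2 * (m + 1)) * ζ = q ^ 2 * (q ^ (2 * m) * ζ) by ring, gaussInt, jack_mul_sq hq0]
    exact ih

omit hq1 in
theorem gaussInt_congr {a b : ℕ} (h : (a : ZMod 2) = b) (ζ : ℝ) :
    gaussInt q (q ^ a * ζ) = gaussInt q (q ^ b * ζ) := by
  have h1 := (ZMod.natCast_eq_natCast_iff' _ _ _).1 h
  rw [← Nat.div_add_mod a 2, ← Nat.div_add_mod b 2, h1, pow_add, pow_add, mul_assoc, mul_assoc,
    gaussInt_pow_mul hq0, gaussInt_pow_mul hq0]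

end

section
variable {n : ℕ} {q : ℝ}

/-- The factors of `f x^E` in normal order for `f` in the class of `P`. -/
def shiftSeries (q : ℝ) (P : Fin n → ℂ[X]) (E : Exps n) (j : Fin n) : PowerSeries ℂ :=
  (((q : ℂ) ^ (∑ i ∈ Finset.Iio j, E i)) ^ E j)⁻¹ •
    PowerSeries.rescale ((q ^ (∑ i ∈ Finset.Iio j, E i) : ℝ) : ℂ)
      (((X ^ E j * P j : ℂ[X]) : PowerSeries ℂ) * gaussSmall q)

/-- An `x_j` of `f` gains a factor `q` for every `x_i` of `x^E` with `i < j`. So the product still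
separates, with `x_j` rescaled in the factors of `f` but not in the new `x_j^{E_j}`; the inverse
power in `shiftSeries` corrects the latter. -/
theorem mulW_xClass_mono (hq0 : 0 < q) (P : Fin n → ℂ[X]) (E : Exps n) :
    mulW (xWeight q) (xClass q P) (mono E) =
      fun M => ∏ j, PowerSeries.coeff (M j) (shiftSeries q P E j) := by
  have hq : (q : ℂ) ≠ 0 := Complex.ofReal_ne_zero.2 hq0.ne'
  funext M
  rw [mulW_mono_right]
  have hc : ∀ j, PowerSeries.coeff (M j) (shiftSeries q P E j) = if E j ≤ M j then
      (q : ℂ) ^ ((M j - E j) * ∑ i ∈ Finset.Iio j, E i) *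
        PowerSeries.coeff (M j - E j) ((P j : PowerSeries ℂ) * gaussSmall q) else 0 := by
    intro j
    rw [shiftSeries, PowerSeries.coeff_smul, PowerSeries.coeff_rescale, Polynomial.coe_mul,
      Polynomial.coe_pow, Polynomial.coe_X, mul_assoc, PowerSeries.coeff_X_pow_mul']
    split_ifs with h
    · obtain ⟨r, hr⟩ := Nat.exists_eq_add_of_le h
      rw [hr, Nat.add_sub_cancel_left, smul_eq_mul, mul_comm r, pow_mul]
      push_cast
      rw [pow_add]
      field_simp
    · simp
  simp only [hc]
  split_ifs with h
  · rw [Finset.prod_congr rfl fun j _ => if_pos (h j), Finset.prod_mul_distrib, xClass_apply,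
      Finset.prod_pow_eq_pow_sum, xWeight]
    congr 2
    refine Finset.sum_congr rfl fun i _ => ?_
    rw [Finset.mul_sum]
    rfl
  · push Not at h
    obtain ⟨j, hj⟩ := h
    exact (Finset.prod_eq_zero (Finset.mem_univ j) (if_neg (not_le.2 hj))).symm

theorem evenPart_prod (a : Fin n → PowerSeries ℂ) :
    evenPart (fun M : Exps n => ∏ j, PowerSeries.coeff (M j) (a j)) =
      fun M => ∏ j, PowerSeries.coeff (M j) (evenSeries (a j)) := by
  funext M
  simp only [evenPart, evenSeries, PowerSeries.coeff_mk]
  split_ifs with h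
  · exact (Finset.prod_congr rfl fun j _ => if_pos (h j)).symm
  · push Not at h
    obtain ⟨j, hj⟩ := h
    exact (Finset.prod_eq_zero (Finset.mem_univ j) (if_neg (by simpa using hj))).symm

variable (hq0 : 0 < q) (hq1 : q < 1)
include hq0 hq1

/-- The continuation of the factors of `f x^E`. -/
theorem oneVarCont_shiftSeries (P : Fin n → ℂ[X]) (E : Exps n) (j : Fin n) :
    OneVarCont q (shiftSeries q P E j) fun z =>
      (((q : ℂ) ^ (∑ i ∈ Finset.Iio j, E i)) ^ E j)⁻¹ *
        ((X ^ E j * P j : ℂ[X]).eval (((q ^ (∑ i ∈ Finset.Iio j, E i) : ℝ) : ℂ) * z) *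
          gaussFun q (((q ^ (∑ i ∈ Finset.Iio j, E i) : ℝ) : ℂ) * z)) :=
  ((oneVarCont_poly hq0 hq1 (X ^ E j * P j)).comp_mul (pow_pos hq0 _)
    (pow_le_one₀ hq0.le hq1.le)).const_mul _

theorem classR_xClass (P : Fin n → ℂ[X]) : ClassR q (xClass q P) := by
  intro E
  rw [mulW_xClass_mono hq0, evenPart_prod]
  exact ⟨_, isIntegrableContinuation_prod hq0 hq1
    fun j => (oneVarCont_shiftSeries hq0 hq1 P E j).even hq0⟩

/-- Substituting the rescaled variable moves the scale into the lattice. Of the exponent `E j + 1`,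
the extra `1` is the Jacobian of this substitution. -/
theorem xIntegral'_xClass (P : Fin n → ℂ[X]) (E : Exps n) {z : Fin n → ℝ} (hz : ∀ j, z j ≠ 0) :
    xIntegral' q (mulW (xWeight q) (xClass q P) (mono E)) z =
      ∏ j, (((q : ℂ) ^ (∑ i ∈ Finset.Iio j, E i)) ^ (E j + 1))⁻¹ *
        (gaussInt q (q ^ (∑ i ∈ Finset.Iio j, E i) * (q ^ (n - 1 - (j : ℕ)) * z j)) *
          linExt (mom q) (X ^ E j * P j)) := by
  rw [xIntegral', mulW_xClass_mono hq0, evenPart_prod, xIntegral_prod hq0 hq1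
    (fun j => (oneVarCont_shiftSeries hq0 hq1 P E j).even hq0) _ hz]
  refine Finset.prod_congr rfl fun j _ => ?_
  have hζ : q ^ (n - 1 - (j : ℕ)) * z j ≠ 0 := mul_ne_zero (pow_pos hq0 _).ne' (hz j)
  have hc : q ^ (∑ i ∈ Finset.Iio j, E i) ≠ 0 := (pow_pos hq0 _).ne'
  rw [add_zero, jack_even (oneVarCont_shiftSeries hq0 hq1 P E j) hq0 hζ, jack_const_mul
    (φ := fun z => (X ^ E j * P j : ℂ[X]).eval (((q ^ (∑ i ∈ Finset.Iio j, E i) : ℝ) : ℂ) * z) *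
          gaussFun q (((q ^ (∑ i ∈ Finset.Iio j, E i) : ℝ) : ℂ) * z)),
    jack_comp_mul (φ := fun z => (X ^ E j * P j : ℂ[X]).eval z * gaussFun q z) hc,
    jack_poly hq0 hq1 _ (mul_ne_zero hc hζ), pow_succ, mul_inv]
  push_cast
  ring

end

theorem sum_sum_Iio {n : ℕ} (E : Exps n) :
    ∑ j, ∑ i ∈ Finset.Iio j, E i = ∑ i : Fin n, (n - 1 - (i : ℕ)) * E i := by
  rw [Finset.sum_comm' (t' := Finset.univ) (s' := fun i => Finset.Ioi i) (by simp)]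
  simp [Fin.card_Ioi]

theorem sum_sq_eq {n : ℕ} (E : Exps n) : (∑ j, E j) ^ 2 = ∑ j, E j ^ 2 + 2 * pairSum E := by
  have h1 : (∑ j, E j) ^ 2 = ∑ i, ∑ j, E j * E i := by
    rw [sq, Finset.sum_mul_sum, Finset.sum_comm]
  have h2 : ∀ i, ∑ j, E j * E i = ∑ j ∈ Finset.Iio i, E j * E i + E i ^ 2 +
      ∑ j ∈ Finset.Ioi i, E j * E i := by
    intro i
    rw [← Finset.sum_erase_add _ _ (Finset.mem_univ i), sq]
    have : (Finset.univ.erase i) = Finset.Iio i ∪ Finset.Ioi i := by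
      ext j; simp [lt_or_lt_iff_ne]
    rw [this, Finset.sum_union]
    · ring
    · rw [Finset.disjoint_left]
      intro j hj hj'
      exact lt_asymm (Finset.mem_Iio.1 hj) (Finset.mem_Ioi.1 hj')
  have h3 : ∑ i, ∑ j ∈ Finset.Ioi i, E j * E i = pairSum E := by
    rw [pairSum, Finset.sum_comm' (t' := Finset.univ) (s' := fun i => Finset.Iio i) (by simp)]
    exact Finset.sum_congr rfl fun i _ => Finset.sum_congr rfl fun j _ => mul_comm _ _
  rw [h1, Finset.sum_congr rfl fun i _ => h2 i, Finset.sum_add_distrib, Finset.sum_add_distrib, h3]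
  unfold pairSum
  ring

theorem transformFS_xClass {n : ℕ} {q : ℝ} (hq0 : 0 < q) (hq1 : q < 1) {β : Fin n → ZMod 2}
    {p : Fin n → ℂ[X]} (hp : ∀ j, HasParity (p j) (β j)) {z : Fin n → ℝ} (hz : ∀ j, z j ≠ 0) :
    transformFS q (xClass q fun j => polyMap q (p j)) z =
      (∏ j : Fin n, gaussInt q (q ^ (n - 1 - (j : ℕ) + lowerSum β j) * z j)) • dClass q p := by
  have hq : (q : ℂ) ≠ 0 := Complex.ofReal_ne_zero.2 hq0.ne'
  funext E
  have hq2 : q ^ 2 < 1 := pow_lt_one₀ hq0.le hq1 two_ne_zero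
  have hq2' : (1 : ℂ) - (q : ℂ) ^ 2 ≠ 0 := one_sub_pow_ne_zero hq0 hq1 two_ne_zero
  rw [transformFS, antipode, xIntegral'_xClass hq0 hq1 _ _ hz, Pi.smul_apply, smul_eq_mul,
    dClass_apply, expCoeff]
  simp only [← mom_transform hq0 hq1]
  by_cases hpar : ∀ j, (E j : ZMod 2) = β j
  -- For `E` of parity `β` the shift has the parity of `B(β)_j`, hence gives the same lattice.
  · have hK : ∀ j, gaussInt q (q ^ (∑ i ∈ Finset.Iio j, E i) * (q ^ (n - 1 - (j : ℕ)) * z j)) =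
        gaussInt q (q ^ (n - 1 - (j : ℕ) + lowerSum β j) * z j) := by
      intro j
      rw [add_comm, pow_add, mul_assoc]
      refine gaussInt_congr hq0 ?_ _
      rw [lowerSum]
      push_cast
      exact Finset.sum_congr rfl fun i _ => by rw [hpar i, ZMod.natCast_zmod_val]
    have hf : ∀ j : Fin n, (Complex.I * (q : ℂ) ^ 2 / (1 - (q : ℂ) ^ 2) * (q : ℂ) ^ (n - 1 - (j : ℕ))) ^ E j /
        (qFactorial (q ^ 2) (E j) : ℂ) = Complex.I ^ E j / (qPoch (q ^ 2) (E j) : ℂ) *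
          (q : ℂ) ^ (2 * E j + (n - 1 - (j : ℕ)) * E j) := by
      intro j
      have h4 := qPoch_ne_zero (pow_pos hq0 2) hq2 (E j)
      rw [qFactorial_eq hq2, mul_pow, div_pow, mul_pow, pow_add, ← pow_mul, ← pow_mul]
      push_cast at hq2' h4 ⊢
      field_simp
    -- The factors `q^{n-j}` in the exponential compensate the Jacobians, by `sum_sum_Iio`. The
    -- antipode supplies `2 ∑_{i<j} EᵢEⱼ`, of which one half cancels reordering and the other half
    -- is the normal order factor of `dClass`.
    have h1 : (q : ℂ) ^ ((∑ j, E j) ^ 2 - ∑ j, E j) *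
        (∏ j, (q : ℂ) ^ (2 * E j + (n - 1 - (j : ℕ)) * E j)) *
        (∏ j, (((q : ℂ) ^ (∑ i ∈ Finset.Iio j, E i)) ^ (E j + 1))⁻¹) =
        (q : ℂ) ^ pairSum E * ∏ j, (q : ℂ) ^ (E j ^ 2 + E j) := by
      rw [Finset.prod_inv_distrib, mul_inv_eq_iff_eq_mul₀
        (Finset.prod_ne_zero_iff.2 fun j _ => pow_ne_zero _ (pow_ne_zero _ hq))]
      simp only [← pow_mul, Finset.prod_pow_eq_pow_sum, ← pow_add]
      congr 1
      simp only [Finset.sum_add_distrib, mul_add, mul_one, sum_sum_Iio, ← Finset.mul_sum]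
      have h5 := sum_sq_eq E
      have h6 : ∑ j, (∑ i ∈ Finset.Iio j, E i) * E j = pairSum E := by
        simp only [pairSum, Finset.sum_mul]
      have h7 : ∑ j, E j ≤ (∑ j, E j) ^ 2 := Nat.le_self_pow two_ne_zero _
      omega
    have h2 : (-1 : ℂ) ^ (∑ j, E j) = ∏ j, (-1) ^ E j := (Finset.prod_pow_eq_pow_sum _ _ _).symm
    have h3 : ∀ j, (-Complex.I) ^ E j = (-1) ^ E j * Complex.I ^ E j := fun j => by
      rw [← mul_pow, neg_one_mul]
    simp only [hK, hf, h3, Finset.prod_mul_distrib, Finset.prod_div_distrib] at h1 ⊢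
    rw [h2]
    linear_combination (∏ j, (-1) ^ E j) * ((∏ j, Complex.I ^ E j) /
      ∏ j, (qPoch (q ^ 2) (E j) : ℂ)) *
      (∏ j : Fin n, gaussInt q (q ^ (n - 1 - (j : ℕ) + lowerSum β j) * z j)) *
      (∏ j, linExt (mom q) (X ^ E j * polyMap q (p j))) * h1
  -- If some parity is wrong, the corresponding moment vanishes on both sides.
  · push Not at hpar
    obtain ⟨j, hj⟩ := hpar
    have h0 := linExt_eq_zero_of_parity (f := mom q) (fun k => mom_odd q)
      (HasParity.polyMap (q := q) (hp j)) hj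
    rw [Finset.prod_eq_zero (f := fun j => (((q : ℂ) ^ (∑ i ∈ Finset.Iio j, E i)) ^ (E j + 1))⁻¹ *
        (gaussInt q (q ^ (∑ i ∈ Finset.Iio j, E i) * (q ^ (n - 1 - (j : ℕ)) * z j)) *
          linExt (mom q) (X ^ E j * polyMap q (p j)))) (Finset.mem_univ j) (by rw [h0]; ring),
      Finset.prod_eq_zero (f := fun j => (-Complex.I) ^ E j * (q : ℂ) ^ (E j ^ 2 + E j) /
        (qPoch (q ^ 2) (E j) : ℂ) * linExt (mom q) (X ^ E j * polyMap q (p j)))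
        (Finset.mem_univ j) (by rw [h0]; ring)]
    ring

theorem oneVarCont_gauss {q : ℝ} (hq0 : 0 < q) (hq1 : q < 1) :
    OneVarCont q (gaussSmall q) (gaussFun q) := by
  have := oneVarCont_poly hq0 hq1 1
  simpa using this

theorem xIntegrable_gaussX (n : ℕ) {q : ℝ} (hq0 : 0 < q) (hq1 : q < 1) :
    XIntegrable q (gaussX n q) := by
  rw [funext (gaussX_apply hq0 hq1)]
  exact ⟨_, isIntegrableContinuation_prod hq0 hq1 fun _ => oneVarCont_gauss hq0 hq1⟩

theorem xIntegral_gaussX {n : ℕ} {q : ℝ} (hq0 : 0 < q) (hq1 : q < 1) (s : Fin n → ℕ)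
    {z : Fin n → ℝ} (hz : ∀ j, z j ≠ 0) :
    xIntegral q s (gaussX n q) z = ∏ j : Fin n, gaussInt q (q ^ (n - 1 - (j : ℕ) + s j) * z j) := by
  rw [funext (gaussX_apply hq0 hq1)]
  exact xIntegral_prod hq0 hq1 (fun _ => oneVarCont_gauss hq0 hq1) s hz

end BraidedFourier

end

noncomputable section

namespace BraidedFourier

open Filter Topology

/-! ### Series with Gaussian coefficients -/

/-- The series `∑_K A q^{2|K|²} ∏ⱼ aⱼ(Kⱼ) ∂^{2K+e}`. -/
def famD {n : ℕ} (q : ℝ) (A : ℂ) (e : Exps n) (a : Fin n → ℕ → ℂ) : Series n := fun N =>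
  if ∀ j, e j ≤ N j ∧ Even (N j - e j) then
    A * (q : ℂ) ^ (2 * (∑ j, (N j - e j) / 2) ^ 2) * ∏ j, a j ((N j - e j) / 2) else 0

theorem famD_apply {n : ℕ} (q : ℝ) (A : ℂ) (e : Exps n) (a : Fin n → ℕ → ℂ) (K : Exps n) :
    famD q A e a (fun j => 2 * K j + e j) =
      A * (q : ℂ) ^ (2 * (∑ j, K j) ^ 2) * ∏ j, a j (K j) := by
  unfold famD
  have h : ∀ j, (2 * K j + e j - e j) / 2 = K j := fun j => by omega
  rw [if_pos]
  · simp only [h]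
  · intro j
    exact ⟨Nat.le_add_left _ _, by rw [Nat.add_sub_cancel]; exact even_two_mul _⟩

theorem famD_eq_zero {n : ℕ} {q : ℝ} {A : ℂ} {e : Exps n} {a : Fin n → ℕ → ℂ} {N : Exps n}
    (hN : N ∉ Set.range fun K : Exps n => fun j => 2 * K j + e j) : famD q A e a N = 0 := by
  unfold famD
  rw [if_neg]
  intro h
  refine hN ⟨fun j => (N j - e j) / 2, ?_⟩
  funext j
  obtain ⟨h1, h2⟩ := h j
  have := Nat.two_mul_div_two_of_even h2
  simp only
  omega

theorem injective_two_mul_add {n : ℕ} (e : Exps n) :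
    Function.Injective fun K : Exps n => (fun j => 2 * K j + e j : Exps n) := by
  intro K L h
  funext j
  have := congrFun h j
  simp only at this
  omega

theorem term_famD {n : ℕ} (q : ℝ) (A : ℂ) (e : Exps n) (a : Fin n → ℕ → ℂ) (z : Fin n → ℂ)
    (K : Exps n) : term (famD q A e a) z (fun j => 2 * K j + e j) =
      A * ((q : ℂ) ^ (2 * (∑ j, K j) ^ 2) * ∏ j, (a j (K j) * z j ^ (2 * K j + e j))) := by
  rw [term, famD_apply, Finset.prod_mul_distrib]
  ring

theorem hasSum_term_famD_iff {n : ℕ} {q : ℝ} {A : ℂ} {e : Exps n} {a : Fin n → ℕ → ℂ}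
    {z : Fin n → ℂ} {s : ℂ} : HasSum (term (famD q A e a) z) s ↔
      HasSum (fun K : Exps n => A * ((q : ℂ) ^ (2 * (∑ j, K j) ^ 2) *
        ∏ j, (a j (K j) * z j ^ (2 * K j + e j)))) s := by
  rw [← (injective_two_mul_add e).hasSum_iff]
  · simp only [Function.comp_def, term_famD]
  · intro N hN
    rw [term, famD_eq_zero hN, zero_mul]

/-- At most geometric growth. -/
def GeomBdd (c : ℕ → ℂ) : Prop := ∃ C ρ : ℝ, 0 ≤ ρ ∧ ∀ k, ‖c k‖ ≤ C * ρ ^ k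

theorem GeomBdd.mul_geom {c : ℕ → ℂ} (h : GeomBdd c) (b r : ℂ) :
    GeomBdd fun k => c k * (b * r ^ k) := by
  obtain ⟨C, ρ, hρ, hc⟩ := h
  refine ⟨C * ‖b‖, ρ * ‖r‖, by positivity, fun k => ?_⟩
  rw [norm_mul, norm_mul, norm_pow, mul_pow]
  calc ‖c k‖ * (‖b‖ * ‖r‖ ^ k) ≤ C * ρ ^ k * (‖b‖ * ‖r‖ ^ k) := by
        gcongr
        exact hc k
    _ = C * ‖b‖ * (ρ ^ k * ‖r‖ ^ k) := by ring

theorem GeomBdd.mul_pow_add {c : ℕ → ℂ} (h : GeomBdd c) (z : ℂ) (e : ℕ) :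
    GeomBdd fun k => c k * z ^ (2 * k + e) := by
  have := h.mul_geom (z ^ e) (z ^ 2)
  convert this using 3
  rw [pow_add, pow_mul]
  ring

section
variable {q : ℝ} (hq0 : 0 < q) (hq1 : q < 1)
include hq0 hq1

omit hq0 hq1 in
theorem qPoch_le_one {p : ℝ} (h0 : 0 < p) (h1 : p < 1) (k : ℕ) : qPoch p k ≤ 1 :=
  Finset.prod_le_one (fun l _ => (sub_pos.2 (pow_lt_one₀ h0.le h1 l.succ_ne_zero)).le)
    fun _ _ => sub_le_self _ (pow_pos h0 _).le

omit hq1 in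
theorem bigCoeff_mul_pow (k : ℕ) :
    bigCoeff (q ^ 4) k * (q ^ 2) ^ k = q ^ (2 * k ^ 2) / qPoch (q ^ 4) k := by
  have h1 : q ^ (2 * k ^ 2) * q ^ (2 * k) = (q ^ 4) ^ (k * (k - 1) / 2) * (q ^ 4) ^ k := by
    rw [← pow_add, two_mul_sq_add_two_mul, pow_add, pow_mul, pow_mul]
  have h2 : (q ^ 4) ^ k = q ^ (2 * k) * (q ^ 2) ^ k := by
    rw [← pow_mul, ← pow_mul, ← pow_add]; ring_nf
  have h3 : q ^ (2 * k) ≠ 0 := (pow_pos hq0 _).ne'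
  rw [h2, ← mul_assoc, mul_comm _ (q ^ (2 * k)), mul_comm ((q ^ 4) ^ _), mul_assoc] at h1
  have h4 := mul_left_cancel₀ h3 h1
  rw [bigCoeff, h4]
  ring

theorem summable_gauss_one {c : ℕ → ℂ} (hc : GeomBdd c) :
    Summable fun k => ‖(q : ℂ) ^ (2 * k ^ 2) * c k‖ := by
  obtain ⟨C, ρ, hρ, hc⟩ := hc
  have h0 := pow_pos hq0 4
  have h1 := pow_four_lt_one hq0 hq1
  refine Summable.of_nonneg_of_le (fun k => norm_nonneg _) (fun k => ?_)
    ((summable_bigCoeff h0 h1 (q ^ 2 * ρ)).mul_left C)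
  have h2 := bigCoeff_mul_pow hq0 k
  have h3 : q ^ (2 * k ^ 2) ≤ q ^ (2 * k ^ 2) / qPoch (q ^ 4) k :=
    le_div_self (by positivity) (qPoch_pos h0 h1 k) (qPoch_le_one h0 h1 k)
  rw [norm_mul, norm_pow, Complex.norm_real, Real.norm_of_nonneg hq0.le, mul_pow]
  calc q ^ (2 * k ^ 2) * ‖c k‖ ≤ q ^ (2 * k ^ 2) / qPoch (q ^ 4) k * (C * ρ ^ k) :=
        mul_le_mul h3 (hc k) (norm_nonneg _)
          (div_nonneg (by positivity) (qPoch_pos h0 h1 k).le)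
    _ = C * (bigCoeff (q ^ 4) k * ((q ^ 2) ^ k * ρ ^ k)) := by rw [← mul_assoc (bigCoeff _ _), h2]; ring

/-- `(∑ Kᵢ)² ≥ ∑ Kᵢ²`, so the coupled sum is dominated by a product of one-variable sums, where the
quadratic exponent beats geometric growth. -/
theorem summable_gauss {ι : Type} [Fintype ι] {c : ι → ℕ → ℂ} (hc : ∀ i, GeomBdd (c i)) :
    Summable fun K : ι → ℕ => ‖(q : ℂ) ^ (2 * (∑ i, K i) ^ 2) * ∏ i, c i (K i)‖ := by
  refine Summable.of_nonneg_of_le (fun k => norm_nonneg _) (fun K => ?_)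
    (summable_norm_pi_prod fun i => summable_gauss_one hq0 hq1 (hc i))
  rw [Finset.prod_mul_distrib, norm_mul, norm_mul, Finset.prod_pow_eq_pow_sum, norm_pow, norm_pow,
    Complex.norm_real, Real.norm_of_nonneg hq0.le, ← Finset.mul_sum]
  refine mul_le_mul_of_nonneg_right (pow_le_pow_of_le_one hq0.le hq1.le ?_) (norm_nonneg _)
  exact Nat.mul_le_mul_left 2 (Finset.sum_sq_le_sq_sum_of_nonneg (fun i _ => Nat.zero_le _))

theorem entire_famD {n : ℕ} (A : ℂ) (e : Exps n) {a : Fin n → ℕ → ℂ} (ha : ∀ j, GeomBdd (a j)) :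
    Entire (famD q A e a) := by
  intro z
  have h := (summable_gauss hq0 hq1 fun j => (ha j).mul_pow_add (z j) (e j)).of_norm.mul_left A
  exact (hasSum_term_famD_iff.2 h.hasSum).summable

/-- The Gaussian sum over the lattice `q^{2ℤ}`. -/
def latticeSum (q : ℝ) (e : ℕ) : ℂ :=
  ∑' h : ℕ, (q : ℂ) ^ (2 * h * (e + 1)) * bigE (q ^ 4) (-((q : ℂ) ^ 4) ^ (h + 1))

theorem summable_latticeSum (e : ℕ) : Summable fun h : ℕ =>
    ‖(q : ℂ) ^ (2 * h * (e + 1)) * bigE (q ^ 4) (-((q : ℂ) ^ 4) ^ (h + 1))‖ := by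
  have h0 := pow_pos hq0 4
  have h1 := pow_four_lt_one hq0 hq1
  have hgeo : Summable fun m : ℕ => (q ^ (2 * (e + 1))) ^ m :=
    summable_geometric_of_lt_one (by positivity) (pow_lt_one₀ hq0.le hq1 (by omega))
  refine Summable.of_nonneg_of_le (fun k => norm_nonneg _) (fun h => ?_)
    (hgeo.mul_right (∑' k, bigCoeff (q ^ 4) k))
  rw [norm_mul, norm_pow, Complex.norm_real, Real.norm_of_nonneg hq0.le, ← pow_mul q,
    show 2 * (e + 1) * h = 2 * h * (e + 1) by ring]
  refine mul_le_mul_of_nonneg_left (norm_bigE_le h0 h1 ?_) (by positivity)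
  rw [norm_neg, norm_pow, norm_pow, Complex.norm_real, Real.norm_of_nonneg hq0.le]
  exact pow_le_one₀ h0.le h1.le

/-- For `h < 0` the points `-q^{4(h+1)}` are zeros of `E_{q⁴}`, so the two-sided sum is one-sided.
Otherwise the large arguments would have to be controlled. -/
theorem hasSum_latticeSum (e : ℕ) :
    (Summable fun h : ℤ => ‖(q : ℂ) ^ (2 * h * (e + 1)) * bigE (q ^ 4) (-((q : ℂ) ^ 4) ^ (h + 1))‖) ∧
      HasSum (fun h : ℤ => (q : ℂ) ^ (2 * h * (e + 1)) * bigE (q ^ 4) (-((q : ℂ) ^ 4) ^ (h + 1)))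
        (latticeSum q e) := by
  have h0 := pow_pos hq0 4
  have h1 := pow_four_lt_one hq0 hq1
  have hs := summable_latticeSum hq0 hq1 e
  have hz : ∀ h : ℤ, h ∉ Set.range (Nat.cast : ℕ → ℤ) →
      (q : ℂ) ^ (2 * h * (e + 1)) * bigE (q ^ 4) (-((q : ℂ) ^ 4) ^ (h + 1)) = 0 := by
    intro h hh
    have hneg : h < 0 := by
      by_contra hc
      exact hh ⟨h.toNat, Int.toNat_of_nonneg (not_lt.1 hc)⟩
    have := bigE_neg_zpow_eq_zero h0 h1 (j := h + 1) (by omega)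
    push_cast at this
    rw [this, mul_zero]
  have hc : ∀ h : ℕ, (q : ℂ) ^ (2 * (h : ℤ) * (e + 1)) * bigE (q ^ 4) (-((q : ℂ) ^ 4) ^ ((h : ℤ) + 1)) =
      (q : ℂ) ^ (2 * h * (e + 1)) * bigE (q ^ 4) (-((q : ℂ) ^ 4) ^ (h + 1)) := by
    intro h
    norm_cast
  constructor
  · rw [← Nat.cast_injective.summable_iff (f := fun h : ℤ =>
      ‖(q : ℂ) ^ (2 * h * (e + 1)) * bigE (q ^ 4) (-((q : ℂ) ^ 4) ^ (h + 1))‖)]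
    · simpa only [Function.comp_def, hc] using hs
    · intro h hh
      rw [hz h hh, norm_zero]
  · rw [← Nat.cast_injective.hasSum_iff hz]
    simp only [Function.comp_def, hc]
    exact hs.of_norm.hasSum

/-- Solving `E(-q^{4h}) = (1 - q^{4h})E(-q^{4(h+1)})` for the term with `q^{4h}` gives a difference
of two sums. The second is an index shift of the first, without boundary term because `E_{q⁴}(-1) =
0`. -/
theorem latticeSum_add_two (e : ℕ) :
    latticeSum q (e + 2) = (1 - (q : ℂ) ^ (2 * (e + 1))) * latticeSum q e := by
  have h0 := pow_pos hq0 4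
  have h1 := pow_four_lt_one hq0 hq1
  have hs := (summable_latticeSum hq0 hq1 e).of_norm
  let f : ℕ → ℂ := fun h => (q : ℂ) ^ (2 * h * (e + 1)) * bigE (q ^ 4) (-((q : ℂ) ^ 4) ^ h)
  have hf : ∀ h, f (h + 1) = (q : ℂ) ^ (2 * (e + 1)) *
      ((q : ℂ) ^ (2 * h * (e + 1)) * bigE (q ^ 4) (-((q : ℂ) ^ 4) ^ (h + 1))) := by
    intro h
    simp only [f]
    rw [← mul_assoc, ← pow_add]
    ring_nf
  have hf0 : f 0 = 0 := by
    have := bigE_neg_zpow_eq_zero h0 h1 (j := 0) le_rfl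
    simp only [f]
    simp only [zpow_zero] at this
    rw [pow_zero ((q : ℂ) ^ 4), this, mul_zero]
  have hsf : Summable f := by
    rw [← summable_nat_add_iff 1]
    simpa only [hf] using hs.mul_left _
  have ht : ∑' h, f h = (q : ℂ) ^ (2 * (e + 1)) * latticeSum q e := by
    rw [hsf.tsum_eq_zero_add, hf0, zero_add, latticeSum, ← tsum_mul_left]
    exact tsum_congr hf
  rw [sub_mul, one_mul, ← ht, latticeSum, latticeSum, ← hs.tsum_sub hsf]
  refine tsum_congr fun h => ?_
  have h2 := bigE_eq h0 h1 (-((q : ℂ) ^ 4) ^ h)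
  have h3 : ((q ^ 4 : ℝ) : ℂ) * (-((q : ℂ) ^ 4) ^ h) = -((q : ℂ) ^ 4) ^ (h + 1) := by
    push_cast; ring
  simp only [f]
  rw [h2, h3, show 2 * h * (e + 2 + 1) = 2 * h * (e + 1) + 4 * h by ring, pow_add, pow_mul _ 4 h]
  ring

theorem latticeSum_eq (r : ℕ) : latticeSum q (2 * r) = latticeSum q 0 * momD q (2 * r) := by
  induction r with
  | zero => simp [momD]
  | succ r ih =>
    rw [show 2 * (r + 1) = 2 * r + 2 by ring, latticeSum_add_two hq0 hq1, ih, momD]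
    ring

theorem latticeSum_zero_ne_zero : latticeSum q 0 ≠ 0 := by
  have h0 := pow_pos hq0 4
  have h1 := pow_four_lt_one hq0 hq1
  have hs := (summable_latticeSum hq0 hq1 0).of_norm
  have hpos : ∀ h : ℕ, 0 < ((q : ℂ) ^ (2 * h * (0 + 1)) * bigE (q ^ 4) (-((q : ℂ) ^ 4) ^ (h + 1))).re := by
    intro h
    have h2 : (q : ℂ) ^ (2 * h * (0 + 1)) = ((q ^ (2 * h * (0 + 1)) : ℝ) : ℂ) := by push_cast; rfl
    have h3 : -((q : ℂ) ^ 4) ^ (h + 1) = ((-(q ^ 4) ^ (h + 1) : ℝ) : ℂ) := by push_cast; rfl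
    rw [h2, Complex.re_ofReal_mul, h3]
    refine mul_pos (pow_pos hq0 _) (bigE_re_pos h0 h1 ?_)
    exact neg_lt_neg (pow_lt_one₀ h0.le h1 h.succ_ne_zero)
  intro h
  have h2 := congrArg Complex.re h
  rw [latticeSum, Complex.re_tsum hs, Complex.zero_re] at h2
  have h3 := (Complex.reCLM.summable hs).tsum_pos (fun i => (hpos i).le) 0 (hpos 0)
  exact h3.ne' h2

end

end BraidedFourier

end

noncomputable section

namespace BraidedFourier

open Filter Topology

/-! ### One step of the lattice order integral -/

theorem evenPart_famD {n : ℕ} {q : ℝ} {A : ℂ} {e : Exps n} {a : Fin n → ℕ → ℂ}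
    (he : ∀ j, Even (e j)) : evenPart (famD q A e a) = famD q A e a := by
  funext N
  unfold evenPart
  split_ifs with h
  · rfl
  · refine (famD_eq_zero fun ⟨K, hK⟩ => h fun j => ?_).symm
    rw [← hK]
    exact (even_two_mul _).add (he j)

/-- For `j < l` the scaling `q^{-2}` meets a factor `q` from moving `∂_l` past `∂_j`, which leaves
`q^{-1}`. As all exponents are even, both signs contribute equally, whence the `2`. -/
theorem stepTerm_famD {n : ℕ} {q : ℝ} (hq0 : 0 < q) (l : Fin n) (γ : ℝ) (A : ℂ) {e : Exps n}
    (a : Fin n → ℕ → ℂ) (he : ∀ j, Even (e j)) (z : Fin n → ℂ) (h : ℤ) :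
    stepTerm q l γ (famD q A e a) z h =
      2 * (1 - (q : ℂ) ^ 2) * (q : ℂ) ^ (2 * h) * γ * (A * ∑' K : Exps n,
        (q : ℂ) ^ (2 * (∑ j, K j) ^ 2) * ∏ j, (a j (K j) *
          (if j = l then (q : ℂ) ^ (2 * h) * γ else if j < l then (q : ℂ)⁻¹ * z j else z j) ^
            (2 * K j + e j))) := by
  have hq : (q : ℂ) ≠ 0 := Complex.ofReal_ne_zero.2 hq0.ne'
  have heval : ∀ ε : ℤˣ, eval (mulW (dWeight q) (rescale (stepScale q l h ε)
      (evenPart (famD q A e a))) (gen l)) (Function.update z l (γ : ℂ)) =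
      γ * (A * ∑' K : Exps n, (q : ℂ) ^ (2 * (∑ j, K j) ^ 2) * ∏ j, (a j (K j) *
          (if j = l then (q : ℂ) ^ (2 * h) * γ else if j < l then (q : ℂ)⁻¹ * z j else z j) ^
            (2 * K j + e j))) := by
    intro ε
    rw [evenPart_famD he, eval, ← tsum_mul_left, ← tsum_mul_left]
    have hinj : Function.Injective fun K : Exps n =>
        ((fun j => 2 * K j + e j) + Pi.single l 1 : Exps n) :=
      (add_left_injective _).comp (injective_two_mul_add e)
    rw [← hinj.tsum_eq]
    · refine tsum_congr fun K => ?_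
      have hle : ∀ i, (Pi.single l 1 : Exps n) i ≤
          ((fun j => 2 * K j + e j) + Pi.single l 1 : Exps n) i := fun i => Nat.le_add_left _ _
      rw [term, gen, mulW_mono_right, if_pos hle, add_tsub_cancel_right, rescale, famD_apply,
        dWeight_single_right, one_mul, ← Finset.prod_pow_eq_pow_sum]
      have h1 : ∏ j, Function.update z l (γ : ℂ) j ^
          ((fun j => 2 * K j + e j) + Pi.single l 1 : Exps n) j =
          (∏ j, Function.update z l (γ : ℂ) j ^ (2 * K j + e j)) * γ := by
        simp only [Pi.add_apply, pow_add _ (2 * K _ + e _) _, Finset.prod_mul_distrib]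
        congr 1
        rw [Finset.prod_eq_single l]
        · simp
        · intro j _ hj; simp [hj]
        · simp
      have h2 : ∏ j ∈ Finset.Iio l, (q : ℂ) ^ (2 * K j + e j) =
          ∏ j, (if j < l then (q : ℂ) else 1) ^ (2 * K j + e j) := by
        simp only [ite_pow, one_pow]
        rw [← Finset.prod_filter]
        congr 1
        ext j; simp
      have h3 : (∏ j, (if j < l then (q : ℂ) else 1) ^ (2 * K j + e j)) *
          (∏ j, stepScale q l h ε j ^ (2 * K j + e j)) *
          (∏ j, Function.update z l (γ : ℂ) j ^ (2 * K j + e j)) =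
          ∏ j, (if j = l then (q : ℂ) ^ (2 * h) * γ else if j < l then (q : ℂ)⁻¹ * z j else z j) ^
            (2 * K j + e j) := by
        rw [← Finset.prod_mul_distrib, ← Finset.prod_mul_distrib]
        refine Finset.prod_congr rfl fun j _ => ?_
        have hev : Even (2 * K j + e j) := (even_two_mul _).add (he j)
        rw [← mul_pow, ← mul_pow]
        unfold stepScale
        by_cases hj : j = l
        · subst hj
          rw [if_neg (lt_irrefl j), if_pos rfl, if_pos rfl, Function.update_self, one_mul]
          rcases Int.units_eq_one_or ε with rfl | rfl
          · simp
          · rw [Units.val_neg, Units.val_one, Int.cast_neg, Int.cast_one, neg_one_mul, neg_mul,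
              hev.neg_pow]
        · rw [if_neg hj, if_neg hj, Function.update_of_ne hj]
          split_ifs with hlt
          · congr 2
            rw [zpow_neg]
            norm_cast
            field_simp
          · rw [one_mul, one_mul]
      rw [h1, h2, Finset.prod_mul_distrib, ← h3]
      ring
    · intro M hM
      by_contra hr
      apply hM
      rw [term, gen, mulW_mono_right]
      split_ifs with hle
      · rw [rescale, famD_eq_zero, zero_mul, mul_zero, zero_mul]
        rintro ⟨K, hK⟩
        refine hr ⟨K, ?_⟩
        simp only at hK ⊢
        rw [hK]
        exact tsub_add_cancel_of_le (show Pi.single l 1 ≤ M from hle)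
      · exact zero_mul _
  rw [stepTerm, Finset.sum_congr rfl fun ε _ => by rw [heval ε], Finset.sum_const, Finset.card_univ,
    show Fintype.card ℤˣ = 2 from rfl, nsmul_eq_mul]
  push_cast
  ring

/-- The coefficients of the `j`-th factor: Gaussian as long as `∂ⱼ` has not been integrated out. -/
def coefA {n : ℕ} (q : ℝ) (R : Finset (Fin n)) (lam : Fin n → ℤ) (j : Fin n) (k : ℕ) : ℂ :=
  if j ∈ R then (-1) ^ k * (q : ℂ) ^ (2 * lam j * k) / (qPoch (q ^ 4) k : ℂ)
  else if k = 0 then 1 else 0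

theorem geomBdd_coefA {n : ℕ} {q : ℝ} (hq0 : 0 < q) (hq1 : q < 1) (R : Finset (Fin n))
    (lam : Fin n → ℤ) (j : Fin n) : GeomBdd (coefA q R lam j) := by
  by_cases hj : j ∈ R
  · have h0 := pow_pos hq0 4
    have h1 := pow_four_lt_one hq0 hq1
    have hC : ∀ k, (qPoch (q ^ 4) k)⁻¹ ≤ ((1 - q ^ 4)⁻¹) ^ k := by
      intro k
      rw [inv_pow]
      refine inv_anti₀ (pow_pos (sub_pos.2 h1) k) ?_
      have h2 := Finset.prod_le_prod (s := Finset.range k) (f := fun _ => 1 - q ^ 4)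
        (g := fun l => 1 - (q ^ 4) ^ (l + 1)) (fun _ _ => (sub_pos.2 h1).le) fun l _ =>
          sub_le_sub_left (pow_le_of_le_one h0.le h1.le l.succ_ne_zero) 1
      simpa [qPoch] using h2
    refine ⟨1, q ^ (2 * lam j) * (1 - q ^ 4)⁻¹,
      mul_nonneg (zpow_pos hq0 _).le (inv_pos.2 (sub_pos.2 h1)).le, fun k => ?_⟩
    rw [coefA, if_pos hj, norm_div, norm_mul, norm_pow, norm_neg, norm_one, one_pow, one_mul,
      norm_zpow, Complex.norm_real, Complex.norm_real, Real.norm_of_nonneg hq0.le,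
      Real.norm_of_nonneg (qPoch_pos h0 h1 k).le, div_eq_mul_inv, zpow_mul, zpow_natCast, one_mul,
      mul_pow]
    exact mul_le_mul_of_nonneg_left (hC k) (pow_pos (zpow_pos hq0 _) k).le
  · refine ⟨1, 1, zero_le_one, fun k => ?_⟩
    rw [coefA, if_neg hj]
    split_ifs <;> simp

/-- Multi-indices, split into the `l`-th index and the others. -/
def splitAt {n : ℕ} (l : Fin n) : ({j // j ≠ l} → ℕ) × ℕ ≃ Exps n :=
  (Equiv.prodComm ({j // j ≠ l} → ℕ) ℕ).trans (Equiv.funSplitAt l ℕ).symm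

section
variable {n : ℕ} {l : Fin n} (x : ({j // j ≠ l} → ℕ) × ℕ)

theorem splitAt_self : splitAt l x l = x.2 := by
  simp [splitAt, Equiv.funSplitAt]

theorem splitAt_ne (j : {j // j ≠ l}) : splitAt l x j = x.1 j := by
  simp [splitAt, Equiv.funSplitAt, j.2]

theorem sum_splitAt : ∑ j, splitAt l x j = x.2 + ∑ j, x.1 j := by
  rw [Fintype.sum_eq_add_sum_subtype_ne _ l, splitAt_self]
  simp only [splitAt_ne]

theorem prod_splitAt (f : Fin n → ℕ → ℂ) :
    ∏ j, f j (splitAt l x j) = f l x.2 * ∏ j : {j // j ≠ l}, f j (x.1 j) := by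
  rw [Fintype.prod_eq_mul_prod_subtype_ne _ l, splitAt_self]
  simp only [splitAt_ne]

end

section
variable {n : ℕ} {q : ℝ} (hq0 : 0 < q) (hq1 : q < 1)
include hq0 hq1

/-- Expanding `2(k+S)² = 2k² + 4kS + 2S²`: the square in `k` builds the coefficients of `E_{q⁴}`,
the mixed term enters its argument, and the last term is the coupling of the other variables. -/
theorem hasSum_coefA {R : Finset (Fin n)} {l : Fin n} (hl : l ∈ R) (lam : Fin n → ℤ) (S e : ℕ)
    (t : ℂ) : HasSum (fun k : ℕ => (q : ℂ) ^ (2 * (k + S) ^ 2) * (coefA q R lam l k * t ^ (2 * k + e)))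
      ((q : ℂ) ^ (2 * S ^ 2) * t ^ e *
        bigE (q ^ 4) (-((q : ℂ) ^ (4 * (S : ℤ) + 2 + 2 * lam l) * t ^ 2))) := by
  have hq : (q : ℂ) ≠ 0 := Complex.ofReal_ne_zero.2 hq0.ne'
  have h := (hasSum_bigE (pow_pos hq0 4) (pow_four_lt_one hq0 hq1)
    (-((q : ℂ) ^ (4 * (S : ℤ) + 2 + 2 * lam l) * t ^ 2))).mul_left ((q : ℂ) ^ (2 * S ^ 2) * t ^ e)
  refine hasSum_of_eq h (fun k => ?_) rfl
  have h1 : (bigCoeff (q ^ 4) k : ℂ) * (q : ℂ) ^ (2 * k) =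
      (q : ℂ) ^ (2 * k ^ 2) / (qPoch (q ^ 4) k : ℂ) := by
    rw [pow_mul]
    exact_mod_cast congrArg Complex.ofReal (bigCoeff_mul_pow hq0 k)
  have h2 : ((q : ℂ) ^ (4 * (S : ℤ) + 2 + 2 * lam l)) ^ k =
      (q : ℂ) ^ (4 * k * S) * (q : ℂ) ^ (2 * k) * (q : ℂ) ^ (2 * lam l * k) := by
    rw [zpow_add₀ hq, zpow_add₀ hq, mul_pow, mul_pow, ← zpow_natCast _ k, ← zpow_natCast _ k,
      ← zpow_natCast _ k, ← zpow_mul, ← zpow_mul, ← zpow_mul]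
    congr 2
    rw [← zpow_natCast]; congr 1; push_cast; ring
  rw [coefA, if_pos hl, neg_pow (_ * _), mul_pow, h2, ← pow_mul,
    show 2 * (k + S) ^ 2 = 2 * k ^ 2 + 4 * k * S + 2 * S ^ 2 by ring, pow_add, pow_add, pow_add,
    mul_div_assoc]
  linear_combination (-(q : ℂ) ^ (4 * k * S) * (q : ℂ) ^ (2 * S ^ 2) * (-1) ^ k *
    (q : ℂ) ^ (2 * lam l * k) * t ^ (2 * k) * t ^ e) * h1

/-- One integration, split into the summation over the lattice and over the other variables. -/
theorem hasSum_lattice_step {R : Finset (Fin n)} {l : Fin n} (hl : l ∈ R) (lam : Fin n → ℤ) (e : ℕ)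
    {g d : ℤ} (hg : g + lam l - 1 = 2 * d) {b : {j // j ≠ l} → ℕ → ℂ} (hb : ∀ j, GeomBdd (b j))
    {v : ℂ} (hv : HasSum (fun K : {j // j ≠ l} → ℕ => (q : ℂ) ^ (2 * (∑ j, K j) ^ 2) *
      ∏ j, (b j (K j) * ((q : ℂ) ^ (-(2 * (e + 1) : ℤ))) ^ K j)) v) :
    HasSum (fun h : ℤ => (q : ℂ) ^ (2 * h) * (q : ℂ) ^ g *
      ∑' K : {j // j ≠ l} → ℕ, ∑' k : ℕ, (q : ℂ) ^ (2 * (k + ∑ j, K j) ^ 2) *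
        ((coefA q R lam l k * ((q : ℂ) ^ (2 * h) * (q : ℂ) ^ g) ^ (2 * k + e)) * ∏ j, b j (K j)))
      (latticeSum q e * (q : ℂ) ^ (-((lam l - 1) * (e + 1))) * v) := by
  have hq : (q : ℂ) ≠ 0 := Complex.ofReal_ne_zero.2 hq0.ne'
  let F : ({j // j ≠ l} → ℕ) → ℂ := fun K => (q : ℂ) ^ (2 * (∑ j, K j) ^ 2) *
      ∏ j, (b j (K j) * ((q : ℂ) ^ (-(2 * (e + 1) : ℤ))) ^ K j)
  let f : ℤ → ℂ := fun h => (q : ℂ) ^ (2 * h * (e + 1)) * bigE (q ^ 4) (-((q : ℂ) ^ 4) ^ (h + 1))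
  have hF : Summable fun K => ‖F K‖ := by
    refine summable_gauss hq0 hq1 (c := fun j k => b j k * ((q : ℂ) ^ (-(2 * (e + 1) : ℤ))) ^ k)
      fun j => ?_
    have := (hb j).mul_geom 1 ((q : ℂ) ^ (-(2 * (e + 1) : ℤ)))
    simpa only [one_mul] using this
  obtain ⟨hf1, hf2⟩ := hasSum_latticeSum hq0 hq1 e
  have hprod : HasSum (fun x : ({j // j ≠ l} → ℕ) × ℤ => F x.1 * f x.2) (v * latticeSum q e) :=
    HasSum.mul hv hf2 (summable_mul_of_summable_norm hF hf1)
  -- The shear `h ↦ h + |K| + d` makes the argument of `E_{q⁴}` independent of `K`, so the double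
  -- sum becomes a product. By `hg` the shift is an integer.
  let σ : ℤ × ({j // j ≠ l} → ℕ) ≃ ({j // j ≠ l} → ℕ) × ℤ :=
    (Equiv.prodComm _ _).trans
      (Equiv.prodShear (Equiv.refl _) fun K => Equiv.addRight (((∑ j, K j : ℕ) : ℤ) + d))
  rw [← σ.hasSum_iff] at hprod
  have h1 := hprod.prod_fiberwise fun h => (hprod.summable.prod_factor h).hasSum
  refine hasSum_of_eq (h1.mul_left ((q : ℂ) ^ (-((lam l - 1) * (e + 1))))) (fun h => ?_) (by ring)
  rw [← tsum_mul_left, ← tsum_mul_left]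
  refine tsum_congr fun K => ?_
  have h2 := ((hasSum_coefA hq0 hq1 hl lam (∑ j, K j) e ((q : ℂ) ^ (2 * h) * (q : ℂ) ^ g)).mul_right
    (∏ j, b j (K j))).tsum_eq
  simp only [mul_assoc] at h2 ⊢
  rw [h2]
  simp only [Function.comp, σ, Equiv.trans_apply, Equiv.prodComm_apply, Prod.swap,
    Equiv.prodShear_apply, Equiv.refl_apply, Equiv.coe_addRight, F, f]
  set S : ℕ := ∑ j, K j
  have h3 : (q : ℂ) ^ (4 * (S : ℤ) + 2 + 2 * lam l) * ((q : ℂ) ^ (2 * h) * (q : ℂ) ^ g) ^ 2 =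
      ((q : ℂ) ^ 4) ^ (h + (S + d) + 1) := by
    rw [← zpow_add₀ hq, ← zpow_natCast _ 2, ← zpow_mul, ← zpow_add₀ hq, ← zpow_natCast _ 4,
      ← zpow_mul]
    congr 1
    push_cast
    linarith
  have h4 : (q : ℂ) ^ (2 * h) * (q : ℂ) ^ g * ((q : ℂ) ^ (2 * h) * (q : ℂ) ^ g) ^ e =
      (q : ℂ) ^ (-((lam l - 1) * (e + 1))) * ((q : ℂ) ^ (-(2 * (e + 1) : ℤ))) ^ S *
        (q : ℂ) ^ (2 * (h + (S + d)) * (e + 1)) := by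
    rw [← zpow_add₀ hq, ← zpow_natCast _ e, ← zpow_natCast _ S, ← zpow_mul, ← zpow_mul,
      ← zpow_add₀ hq, ← zpow_add₀ hq, ← zpow_add₀ hq]
    congr 1
    linear_combination ((e : ℤ) + 1) * hg
  rw [h3, Finset.prod_mul_distrib, Finset.prod_pow_eq_pow_sum]
  linear_combination ((q : ℂ) ^ (2 * S ^ 2) * bigE (q ^ 4) (-((q : ℂ) ^ 4) ^ (h + (S + d) + 1)) *
    ∏ j, b j (K j)) * h4

/-- The factor of the integral over `∂_l`. -/
def stepConst {n : ℕ} (q : ℝ) (l : Fin n) (e : Exps n) (lam : Fin n → ℤ) : ℂ :=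
  2 * (1 - (q : ℂ) ^ 2) * latticeSum q (e l) *
    (q : ℂ) ^ (-((lam l - 1) * (e l + 1)) - ∑ j ∈ Finset.Iio l, (e j : ℤ))

/-- The new linear exponents after integrating out `∂_l`. -/
def stepLam {n : ℕ} (l : Fin n) (e : Exps n) (lam : Fin n → ℤ) (j : Fin n) : ℤ :=
  lam j - (e l + 1) - if j < l then 1 else 0

omit hq1 in
theorem coefA_stepLam {R : Finset (Fin n)} {l j : Fin n} (hj : j ≠ l) (e : Exps n)
    (lam : Fin n → ℤ) (k : ℕ) : coefA q (R.erase l) (stepLam l e lam) j k =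
      coefA q R lam j k * (if j < l then (q : ℂ)⁻¹ else 1) ^ (2 * k) *
        ((q : ℂ) ^ (-(2 * (e l + 1) : ℤ))) ^ k := by
  have hq : (q : ℂ) ≠ 0 := Complex.ofReal_ne_zero.2 hq0.ne'
  simp only [coefA, Finset.mem_erase, ne_eq, hj, not_false_eq_true, true_and]
  split_ifs with h1 h2 h3 h4
  · have : (q : ℂ) ^ (2 * stepLam l e lam j * k) = (q : ℂ) ^ (2 * lam j * k) *
        (q : ℂ)⁻¹ ^ (2 * k) * ((q : ℂ) ^ (-(2 * (e l + 1) : ℤ))) ^ k := by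
      rw [inv_pow, ← zpow_natCast _ k, ← zpow_mul, ← zpow_natCast _ (2 * k), ← zpow_neg,
        ← zpow_add₀ hq, ← zpow_add₀ hq, stepLam, if_pos h2]
      congr 1; push_cast; ring
    rw [this]; ring
  · have : (q : ℂ) ^ (2 * stepLam l e lam j * k) = (q : ℂ) ^ (2 * lam j * k) *
        ((q : ℂ) ^ (-(2 * (e l + 1) : ℤ))) ^ k := by
      rw [← zpow_natCast _ k, ← zpow_mul, ← zpow_add₀ hq, stepLam, if_neg h2]
      congr 1; ring
    rw [this, one_pow]; ring
  · simp [h3]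
  · simp [h3]
  · simp
  · simp

/-- The geometric factor left by `hasSum_lattice_step` and the `q^{-1}` for `j < l` only change the
linear exponents `lam`. The quadratic coupling persists among the remaining variables, so the next
step has the same form. -/
theorem isStep_famD {R : Finset (Fin n)} {l : Fin n} (hl : l ∈ R) (A : ℂ) {e : Exps n}
    (he : ∀ j, Even (e j)) (lam : Fin n → ℤ) {g : ℕ} {d : ℤ} (hg : g + lam l - 1 = 2 * d) :
    IsStep q l (q ^ g) (famD q A e (coefA q R lam))
      (famD q (A * stepConst q l e lam) (Function.update e l 0)
        (coefA q (R.erase l) (stepLam l e lam))) := by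
  have hq : (q : ℂ) ≠ 0 := Complex.ofReal_ne_zero.2 hq0.ne'
  have hbd := geomBdd_coefA hq0 hq1 R lam
  have hbd' := geomBdd_coefA hq0 hq1 (R.erase l) (stepLam l e lam)
  refine ⟨entire_famD hq0 hq1 A e hbd, fun z => ?_⟩
  let u : {j // j ≠ l} → ℂ := fun j => if j.1 < l then (q : ℂ)⁻¹ * z j else z j
  let b : {j // j ≠ l} → ℕ → ℂ := fun j k => coefA q R lam j k * u j ^ (2 * k + e j)
  have hb : ∀ j, GeomBdd (b j) := fun j => (hbd j).mul_pow_add _ _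
  have hv : Summable fun K : {j // j ≠ l} → ℕ => (q : ℂ) ^ (2 * (∑ j, K j) ^ 2) *
      ∏ j, (b j (K j) * ((q : ℂ) ^ (-(2 * (e l + 1) : ℤ))) ^ K j) := by
    refine (summable_gauss hq0 hq1
      (c := fun j k => b j k * ((q : ℂ) ^ (-(2 * (e l + 1) : ℤ))) ^ k) fun j => ?_).of_norm
    have := (hb j).mul_geom 1 ((q : ℂ) ^ (-(2 * (e l + 1) : ℤ)))
    simpa only [one_mul] using this
  set v := ∑' K : {j // j ≠ l} → ℕ, (q : ℂ) ^ (2 * (∑ j, K j) ^ 2) *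
      ∏ j, (b j (K j) * ((q : ℂ) ^ (-(2 * (e l + 1) : ℤ))) ^ K j) with hvdef
  have hsum := hasSum_lattice_step hq0 hq1 hl lam (e l) hg hb hv.hasSum
  have hsplit : ∀ x : Fin n → ℂ, (∀ j : {j // j ≠ l}, x j = u j) →
      ∑' K : Exps n, (q : ℂ) ^ (2 * (∑ j, K j) ^ 2) * ∏ j, (coefA q R lam j (K j) *
        x j ^ (2 * K j + e j)) =
      ∑' K : {j // j ≠ l} → ℕ, ∑' k : ℕ, (q : ℂ) ^ (2 * (k + ∑ j, K j) ^ 2) *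
        ((coefA q R lam l k * x l ^ (2 * k + e l)) * ∏ j, b j (K j)) := by
    intro x hx
    have hs : Summable fun K : Exps n => (q : ℂ) ^ (2 * (∑ j, K j) ^ 2) *
        ∏ j, (coefA q R lam j (K j) * x j ^ (2 * K j + e j)) :=
      (summable_gauss hq0 hq1 fun j => (hbd j).mul_pow_add (x j) (e j)).of_norm
    rw [← (splitAt l).tsum_eq]
    refine (((splitAt l).summable_iff.2 hs).tsum_prod).trans ?_
    refine tsum_congr fun K => tsum_congr fun k => ?_
    simp only [Function.comp]
    rw [sum_splitAt, prod_splitAt (K, k) fun j m => coefA q R lam j m * x j ^ (2 * m + e j)]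
    simp only [hx, b]
  have hstep : HasSum (stepTerm q l (q ^ g) (famD q A e (coefA q R lam)) z)
      (2 * (1 - (q : ℂ) ^ 2) * A *
        (latticeSum q (e l) * (q : ℂ) ^ (-((lam l - 1) * (e l + 1))) * v)) := by
    refine hasSum_of_eq (hsum.mul_left (2 * (1 - (q : ℂ) ^ 2) * A)) (fun h => ?_) rfl
    rw [stepTerm_famD hq0 l _ A _ he, hsplit]
    · rw [if_pos rfl]
      push_cast
      rw [zpow_natCast]
      ring
    · intro j
      rw [if_neg j.2]
  refine ⟨hstep.summable, ?_⟩
  rw [hstep.tsum_eq, hasSum_term_famD_iff]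
  -- After erasing `l` from `R`, `coefA` is supported at `K l = 0`, so the new series is a sum over
  -- the other indices.
  have hinj : Function.Injective fun K : {j // j ≠ l} → ℕ => splitAt l (K, 0) := by
    intro K L h
    exact congrArg Prod.fst ((splitAt l).injective h)
  rw [← hinj.hasSum_iff]
  · refine hasSum_of_eq (hv.hasSum.mul_left (A * stepConst q l e lam *
      (q : ℂ) ^ (∑ j ∈ Finset.Iio l, (e j : ℤ)))) (fun K => ?_) ?_
    · have h1 : (q : ℂ) ^ (∑ j ∈ Finset.Iio l, (e j : ℤ)) *
          ∏ j : {j // j ≠ l}, (if j.1 < l then (q : ℂ)⁻¹ else 1) ^ e j = 1 := by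
        have h2 : ∏ j : {j // j ≠ l}, (if j.1 < l then (q : ℂ)⁻¹ else 1) ^ e j =
            ∏ j : Fin n, (if j < l then (q : ℂ)⁻¹ else 1) ^ e j := by
          rw [Fintype.prod_eq_mul_prod_subtype_ne _ l, if_neg (lt_irrefl l), one_pow, one_mul]
        rw [h2]
        simp only [ite_pow, one_pow]
        rw [← Finset.prod_filter, show Finset.univ.filter (fun j => j < l) = Finset.Iio l by
          ext j; simp, zpow_sum hq, ← Finset.prod_mul_distrib]
        refine Finset.prod_eq_one fun j _ => ?_
        rw [zpow_natCast, ← mul_pow, mul_inv_cancel₀ hq, one_pow]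
      simp only [Function.comp]
      rw [sum_splitAt, prod_splitAt (K, 0) fun j m => coefA q (R.erase l) (stepLam l e lam) j m *
        z j ^ (2 * m + Function.update e l 0 j)]
      have h3 : ∀ j : {j // j ≠ l}, coefA q (R.erase l) (stepLam l e lam) j (K j) *
          z j ^ (2 * K j + Function.update e l 0 j) * (if j.1 < l then (q : ℂ)⁻¹ else 1) ^ e j =
          b j (K j) * ((q : ℂ) ^ (-(2 * (e l + 1) : ℤ))) ^ K j := by
        intro j
        rw [coefA_stepLam hq0 j.2, Function.update_of_ne j.2]
        simp only [b, u]
        split_ifs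
        · rw [mul_pow, pow_add, pow_add]; ring
        · rw [one_pow, one_pow]; ring
      have h4 : coefA q (R.erase l) (stepLam l e lam) l 0 = 1 := by
        rw [coefA, if_neg (Finset.notMem_erase l R), if_pos rfl]
      simp only [← h3, Finset.prod_mul_distrib, zero_add, h4, Function.update_self, mul_zero, pow_zero, mul_one, one_mul]
      linear_combination (-(A * stepConst q l e lam * (q : ℂ) ^ (2 * (∑ j, K j) ^ 2) *
        (∏ j : {j // j ≠ l}, coefA q (R.erase l) (stepLam l e lam) j (K j)) *
        ∏ j : {j // j ≠ l}, z j ^ (2 * K j + Function.update e l 0 j))) * h1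
    · have h5 : (q : ℂ) ^ (-((lam l - 1) * (e l + 1)) - ∑ j ∈ Finset.Iio l, (e j : ℤ)) *
          (q : ℂ) ^ (∑ j ∈ Finset.Iio l, (e j : ℤ)) = (q : ℂ) ^ (-((lam l - 1) * (e l + 1))) := by
        rw [← zpow_add₀ hq, sub_add_cancel]
      rw [← hvdef, stepConst]
      linear_combination (-(2 * (1 - (q : ℂ) ^ 2) * A * latticeSum q (e l) * v)) * h5
  · intro N hN
    have hNl : N l ≠ 0 := by
      intro h0
      apply hN
      obtain ⟨⟨K, k⟩, rfl⟩ := (splitAt l).surjective N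
      rw [splitAt_self] at h0
      simp only at h0
      exact ⟨K, by rw [h0]⟩
    rw [Finset.prod_eq_zero (Finset.mem_univ l), mul_zero, mul_zero]
    rw [coefA, if_neg (Finset.notMem_erase l R), if_neg hNl, zero_mul]

end

end BraidedFourier

end

noncomputable section

namespace BraidedFourier

open Filter Topology

/-! ### Linearity and uniqueness of the lattice order integral -/

section
variable {n : ℕ}

theorem term_add (f g : Series n) (z : Fin n → ℂ) : term (f + g) z = term f z + term g z := by
  funext M
  exact add_mul _ _ _

theorem term_smul (c : ℂ) (f : Series n) (z : Fin n → ℂ) : term (c • f) z = c • term f z := by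
  funext M
  exact mul_assoc _ _ _

theorem Entire.evenPart {f : Series n} (hf : Entire f) : Entire (evenPart f) := by
  intro z
  have h := (hf z).indicator {M | ∀ j, Even (M j)}
  refine h.congr fun M => ?_
  by_cases hM : ∀ j, Even (M j)
  · rw [Set.indicator_of_mem (show M ∈ {M : Exps n | ∀ j, Even (M j)} from hM), term, term,
      BraidedFourier.evenPart, if_pos hM]
  · rw [Set.indicator_of_notMem (show M ∉ {M : Exps n | ∀ j, Even (M j)} from hM), term,
      BraidedFourier.evenPart, if_neg hM, zero_mul]

theorem evenPart_add (f g : Series n) : evenPart (f + g) = evenPart f + evenPart g := by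
  funext M
  simp only [evenPart, Pi.add_apply]
  split_ifs <;> simp

theorem evenPart_smul (c : ℂ) (f : Series n) : evenPart (c • f) = c • evenPart f := by
  funext M
  simp only [evenPart, Pi.smul_apply]
  split_ifs <;> simp

theorem Entire.add {f g : Series n} (hf : Entire f) (hg : Entire g) : Entire (f + g) := fun z => by
  rw [term_add]; exact (hf z).add (hg z)

theorem Entire.smul {f : Series n} (hf : Entire f) (c : ℂ) : Entire (c • f) := fun z => by
  rw [term_smul]; exact (hf z).const_smul c

/-- The integrand of a step is an evaluation of the given series at a rescaled point. Linearity of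
the integral then follows from that of evaluation on entire series. -/
theorem eval_mulW_gen (q : ℝ) (s : Fin n → ℂ) (f : Series n) (l : Fin n) (w : Fin n → ℂ) :
    eval (mulW (dWeight q) (rescale s f) (gen l)) w =
      w l * eval f fun j => (if j < l then (q : ℂ) else 1) * s j * w j := by
  rw [eval, eval, ← tsum_mul_left, ← (add_left_injective (Pi.single l 1 : Exps n)).tsum_eq]
  · refine tsum_congr fun M => ?_
    have hle : ∀ i, (Pi.single l 1 : Exps n) i ≤ (M + Pi.single l 1 : Exps n) i := fun i =>
      Nat.le_add_left _ _
    have h1 : ∏ j, w j ^ (M + Pi.single l 1 : Exps n) j = (∏ j, w j ^ M j) * w l := by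
      simp only [Pi.add_apply, pow_add, Finset.prod_mul_distrib]
      congr 1
      rw [Finset.prod_eq_single l]
      · simp
      · intro j _ hj; simp [hj]
      · simp
    have h2 : ∏ j ∈ Finset.Iio l, (q : ℂ) ^ M j = ∏ j, (if j < l then (q : ℂ) else 1) ^ M j := by
      simp only [ite_pow, one_pow]
      rw [← Finset.prod_filter]
      congr 1
      ext j; simp
    rw [term, gen, mulW_mono_right, if_pos hle, add_tsub_cancel_right, rescale,
      dWeight_single_right, one_mul, ← Finset.prod_pow_eq_pow_sum, h1, h2, term]
    simp only [mul_pow, Finset.prod_mul_distrib]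
    ring
  · intro M hM
    by_contra hr
    apply hM
    rw [term, gen, mulW_mono_right, if_neg, zero_mul]
    exact fun hle => hr ⟨M - Pi.single l 1, tsub_add_cancel_of_le (show Pi.single l 1 ≤ M from hle)⟩

theorem eval_add {f g : Series n} (hf : Entire f) (hg : Entire g) (z : Fin n → ℂ) :
    eval (f + g) z = eval f z + eval g z := by
  rw [eval, term_add]
  exact (hf z).tsum_add (hg z)

theorem eval_smul (c : ℂ) (f : Series n) (z : Fin n → ℂ) : eval (c • f) z = c * eval f z := by
  rw [eval, term_smul]
  exact tsum_mul_left

theorem stepTerm_add {q : ℝ} {l : Fin n} {γ : ℝ} {f g : Series n} (hf : Entire f) (hg : Entire g)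
    (z : Fin n → ℂ) : stepTerm q l γ (f + g) z = stepTerm q l γ f z + stepTerm q l γ g z := by
  funext h
  simp only [stepTerm, eval_mulW_gen, evenPart_add, eval_add hf.evenPart hg.evenPart, Pi.add_apply,
    mul_add, Finset.sum_add_distrib]

theorem stepTerm_smul {q : ℝ} {l : Fin n} {γ : ℝ} (c : ℂ) (f : Series n) (z : Fin n → ℂ) :
    stepTerm q l γ (c • f) z = c • stepTerm q l γ f z := by
  funext h
  simp only [stepTerm, eval_mulW_gen, evenPart_smul, eval_smul, Pi.smul_apply, smul_eq_mul,
    Finset.mul_sum]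
  refine Finset.sum_congr rfl fun ε _ => ?_
  ring

theorem IsStep.add {q : ℝ} {l : Fin n} {γ : ℝ} {f f' g g' : Series n} (h : IsStep q l γ f f')
    (h' : IsStep q l γ g g') : IsStep q l γ (f + g) (f' + g') := by
  refine ⟨h.1.add h'.1, fun z => ?_⟩
  rw [stepTerm_add h.1 h'.1, term_add]
  refine ⟨(h.2 z).1.add (h'.2 z).1, ?_⟩
  have := (h.2 z).1.tsum_add (h'.2 z).1
  simp only [Pi.add_apply]
  rw [this]
  exact (h.2 z).2.add (h'.2 z).2

theorem IsStep.smul {q : ℝ} {l : Fin n} {γ : ℝ} {f f' : Series n} (h : IsStep q l γ f f') (c : ℂ) :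
    IsStep q l γ (c • f) (c • f') := by
  refine ⟨h.1.smul c, fun z => ?_⟩
  rw [stepTerm_smul, term_smul]
  refine ⟨(h.2 z).1.const_smul c, ?_⟩
  simp only [Pi.smul_apply, smul_eq_mul, tsum_mul_left]
  exact (h.2 z).2.mul_left c

theorem isStep_of_evenPart_eq_zero {q : ℝ} {l : Fin n} {γ : ℝ} {f : Series n} (hf : Entire f)
    (h : evenPart f = 0) : IsStep q l γ f 0 := by
  have h0 : ∀ z : Fin n → ℂ, term (0 : Series n) z = 0 := fun z => by
    funext M; exact zero_mul _
  have h1 : ∀ z, stepTerm q l γ f z = 0 := by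
    intro z
    funext k
    have h2 : ∀ w : Fin n → ℂ, eval (0 : Series n) w = 0 := fun w => by simp [eval, h0]
    simp [stepTerm, eval_mulW_gen, h, h2]
  refine ⟨hf, fun z => ?_⟩
  rw [h1, h0]
  refine ⟨summable_zero, ?_⟩
  simp only [Pi.zero_apply, tsum_zero]
  exact hasSum_zero

theorem IsStep.unique {q : ℝ} {l : Fin n} {γ : ℝ} {f g h : Series n} (hg : IsStep q l γ f g)
    (hh : IsStep q l γ f h) : g = h :=
  eq_of_hasSum_term (fun z => (hg.2 z).2) fun z => (hh.2 z).2

end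

section
variable {n : ℕ} {q : ℝ} {σ : Equiv.Perm (Fin n)} {γ : Fin n → ℝ}

theorem HasLOIntegral.add {f g : Series n} {u v : ℂ} (hf : HasLOIntegral q σ γ f u)
    (hg : HasLOIntegral q σ γ g v) : HasLOIntegral q σ γ (f + g) (u + v) := by
  obtain ⟨c, h0, h1, h2⟩ := hf
  obtain ⟨d, k0, k1, k2⟩ := hg
  exact ⟨c + d, by simp [h0, k0], fun k => (h1 k).add (k1 k), by simp [h2, k2]⟩

theorem HasLOIntegral.smul {f : Series n} {u : ℂ} (hf : HasLOIntegral q σ γ f u) (c : ℂ) :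
    HasLOIntegral q σ γ (c • f) (c * u) := by
  obtain ⟨d, h0, h1, h2⟩ := hf
  exact ⟨c • d, by simp [h0], fun k => (h1 k).smul c, by simp [h2]⟩

theorem entire_zero : Entire (0 : Series n) := fun _ =>
  summable_zero.congr fun _ => (zero_mul _).symm

theorem hasLOIntegral_zero : HasLOIntegral q σ γ (0 : Series n) 0 :=
  ⟨0, rfl, fun _ => isStep_of_evenPart_eq_zero entire_zero (by funext M; simp [evenPart]), rfl⟩

theorem HasLOIntegral.sum {ι : Type} {s : Finset ι} {f : ι → Series n} {u : ι → ℂ}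
    (h : ∀ i ∈ s, HasLOIntegral q σ γ (f i) (u i)) :
    HasLOIntegral q σ γ (∑ i ∈ s, f i) (∑ i ∈ s, u i) := by
  classical
  induction s using Finset.induction_on with
  | empty => simpa using hasLOIntegral_zero
  | insert i s hi ih =>
    rw [Finset.sum_insert hi, Finset.sum_insert hi]
    exact (h i (Finset.mem_insert_self i s)).add
      (ih fun j hj => h j (Finset.mem_insert_of_mem hj))

theorem hasLOIntegral_of_evenPart_eq_zero {f : Series n} (hf : Entire f) (h : evenPart f = 0)
    (hn : 0 < n) : HasLOIntegral q σ γ f 0 := by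
  refine ⟨fun k => if k = 0 then f else 0, if_pos rfl, fun k => ?_, ?_⟩
  · simp only [Fin.succ_ne_zero, if_false]
    split_ifs
    · exact isStep_of_evenPart_eq_zero hf h
    · exact isStep_of_evenPart_eq_zero entire_zero (by funext M; simp [evenPart])
  · have h0 : Fin.last n ≠ 0 := fun h0 => by
      have := congrArg Fin.val h0
      simp at this
      omega
    simp [h0]

theorem HasLOIntegral.unique {f : Series n} {u v : ℂ} (hu : HasLOIntegral q σ γ f u)
    (hv : HasLOIntegral q σ γ f v) : u = v := by
  obtain ⟨c, h0, h1, h2⟩ := hu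
  obtain ⟨d, k0, k1, k2⟩ := hv
  have h : ∀ k, c k = d k := by
    intro k
    induction k using Fin.induction with
    | zero => rw [h0, k0]
    | succ k ih => exact (h1 k).unique (ih ▸ k1 k)
  rw [← h2, ← k2, h]

theorem HasLOIntegral.loIntegral_eq {f : Series n} {u : ℂ} (hu : HasLOIntegral q σ γ f u) :
    loIntegral q σ γ f = u := by
  have h : LOIntegrable q σ γ f := ⟨u, hu⟩
  rw [loIntegral, dif_pos h]
  exact (Classical.choose_spec h).unique hu

end

/-! ### The lattice order integral of a Gaussian family -/

section
variable {n : ℕ} {q : ℝ} (hq0 : 0 < q) (hq1 : q < 1) (σ : Equiv.Perm (Fin n))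
include hq0 hq1

/-- The variables among `∂_{σ(1)}, …, ∂_{σ(k)}`. -/
def before (σ : Equiv.Perm (Fin n)) (k : ℕ) : Finset (Fin n) :=
  Finset.univ.filter fun i => (σ.symm i : ℕ) < k

/-- The parameter `lam` before the `(k+1)`-st step. -/
def lamAt (σ : Equiv.Perm (Fin n)) (e : Exps n) (lam : Fin n → ℤ) (k : ℕ) (j : Fin n) : ℤ :=
  lam j - ∑ i ∈ before σ k, ((e i + 1 : ℤ) + if j < i then 1 else 0)

omit hq0 hq1 in
theorem before_succ (k : Fin n) :
    before σ (k + 1) = insert (σ k) (before σ k) := by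
  ext i
  simp only [before, Finset.mem_filter, Finset.mem_univ, true_and, Finset.mem_insert]
  rw [Nat.lt_succ_iff_lt_or_eq, or_comm, ← Fin.ext_iff, Equiv.symm_apply_eq]

omit hq0 hq1 in
theorem notMem_before (k : Fin n) : σ k ∉ before σ k := by
  simp [before]

/-- Iteration of `isStep_famD`: before each step the exponents `e` of the variables already removed
are `0`, and `lamAt` has collected their contributions. The hypothesis `hg` is the parity that each
step needs. -/
theorem hasLOIntegral_famD (A : ℂ) {e : Exps n} (he : ∀ j, Even (e j)) (lam : Fin n → ℤ)
    (g : Fin n → ℕ) (hg : ∀ i, Even (g i + lamAt σ e lam (σ.symm i) i - 1)) :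
    HasLOIntegral q σ (fun i => q ^ g i) (famD q A e (coefA q Finset.univ lam))
      (A * ∏ i, (2 * (1 - (q : ℂ) ^ 2) * latticeSum q (e i) *
        (q : ℂ) ^ (-((lamAt σ e lam (σ.symm i) i - 1) * (e i + 1)) -
          ∑ j ∈ Finset.Iio i, if j ∈ before σ (σ.symm i) then 0 else (e j : ℤ)))) := by
  set C : Fin n → ℂ := fun i => 2 * (1 - (q : ℂ) ^ 2) * latticeSum q (e i) *
        (q : ℂ) ^ (-((lamAt σ e lam (σ.symm i) i - 1) * (e i + 1)) -
          ∑ j ∈ Finset.Iio i, if j ∈ before σ (σ.symm i) then 0 else (e j : ℤ)) with hC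
  let eK : ℕ → Exps n := fun k i => if i ∈ before σ k then 0 else e i
  refine ⟨fun k => famD q (A * ∏ i ∈ before σ k, C i) (eK k)
    (coefA q (before σ k)ᶜ (lamAt σ e lam k)), ?_, fun k => ?_, ?_⟩
  · have hb : before σ 0 = ∅ := by simp [before]
    have h1 : lamAt σ e lam 0 = lam := by funext j; simp [lamAt, hb]
    have h2 : eK 0 = e := by funext j; simp [eK, hb]
    simp only [Fin.val_zero, hb, h1, h2, Finset.prod_empty, mul_one, Finset.compl_empty]
  · have hl : σ k ∈ (before σ k)ᶜ := Finset.mem_compl.2 (notMem_before σ k)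
    obtain ⟨d, hd⟩ := hg (σ k)
    rw [Equiv.symm_apply_apply, ← two_mul] at hd
    have h := isStep_famD hq0 hq1 hl (A * ∏ i ∈ before σ k, C i) (e := eK k)
      (fun j => by simp only [eK]; split_ifs; exacts [Even.zero, he j]) (lamAt σ e lam k) hd
    have hel : eK k (σ k) = e (σ k) := if_neg (notMem_before σ k)
    have h1 : A * (∏ i ∈ before σ k, C i) * stepConst q (σ k) (eK k) (lamAt σ e lam k) =
        A * ∏ i ∈ before σ (k + 1), C i := by
      rw [before_succ, Finset.prod_insert (notMem_before σ k), mul_assoc, mul_comm (∏ i ∈ _, _)]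
      congr 2
      simp only [stepConst, hC, Equiv.symm_apply_apply, hel, eK]
      congr 3
      refine Finset.sum_congr rfl fun j _ => ?_
      split_ifs <;> simp
    have h2 : Function.update (eK k) (σ k) 0 = eK (k + 1) := by
      funext j
      simp only [eK, before_succ, Finset.mem_insert]
      by_cases hj : j = σ k
      · subst hj; simp
      · simp [hj]
    have h3 : (before σ k)ᶜ.erase (σ k) = (before σ (k + 1))ᶜ := by
      rw [before_succ, Finset.compl_insert]
    have h4 : stepLam (σ k) (eK k) (lamAt σ e lam k) = lamAt σ e lam (k + 1) := by
      funext j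
      simp only [stepLam, lamAt, before_succ, Finset.sum_insert (notMem_before σ k), hel]
      ring
    rw [h1, h2, h3, h4] at h
    exact h
  · have hb : before σ n = Finset.univ := by simp [before]
    have h2 : eK n = 0 := by funext j; simp [eK, hb]
    simp only [Fin.val_last, hb, h2, Finset.compl_univ]
    have := famD_apply q (A * ∏ i, C i) (0 : Exps n) (coefA q ∅ (lamAt σ e lam n)) 0
    have h0 : (fun j => 2 * (0 : Exps n) j + (0 : Exps n) j : Exps n) = 0 := by funext j; simp
    rw [h0] at this
    rw [this]
    simp [coefA]

end

end BraidedFourier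

end

noncomputable section

namespace BraidedFourier

open Polynomial

/-! ### Sums over pairs of indices -/

section
variable {n : ℕ}

/-- `∑_{k<i} f k i`. -/
def sumLT (f : Fin n → Fin n → ℤ) : ℤ := ∑ i, ∑ k ∈ Finset.Iio i, f k i

theorem sumLT_add (f g : Fin n → Fin n → ℤ) :
    sumLT f + sumLT g = sumLT fun k i => f k i + g k i := by
  simp only [sumLT, Finset.sum_add_distrib]

theorem sumLT_sub (f g : Fin n → Fin n → ℤ) :
    sumLT f - sumLT g = sumLT fun k i => f k i - g k i := by
  simp only [sumLT, Finset.sum_sub_distrib]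

theorem sumLT_mul (c : ℤ) (f : Fin n → Fin n → ℤ) :
    c * sumLT f = sumLT fun k i => c * f k i := by
  simp only [sumLT, Finset.mul_sum]

theorem sumLT_congr {f g : Fin n → Fin n → ℤ} (h : ∀ k i, k < i → f k i = g k i) :
    sumLT f = sumLT g :=
  Finset.sum_congr rfl fun i _ => Finset.sum_congr rfl fun k hk => h k i (Finset.mem_Iio.1 hk)

theorem sum_eq_Iio_add_Ioi (f : Fin n → ℤ) (i : Fin n) :
    ∑ j, f j = ∑ j ∈ Finset.Iio i, f j + f i + ∑ j ∈ Finset.Ioi i, f j := by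
  rw [← Finset.sum_erase_add _ _ (Finset.mem_univ i)]
  have : (Finset.univ.erase i) = Finset.Iio i ∪ Finset.Ioi i := by
    ext j; simp [lt_or_lt_iff_ne]
  rw [this, Finset.sum_union]
  · ring
  · rw [Finset.disjoint_left]
    intro j hj hj'
    exact lt_asymm (Finset.mem_Iio.1 hj) (Finset.mem_Ioi.1 hj')

theorem sum_sum_eq_sumLT (f : Fin n → Fin n → ℤ) :
    ∑ i, ∑ j, f j i = ∑ i, f i i + sumLT fun k i => f k i + f i k := by
  rw [Finset.sum_congr rfl fun i _ => sum_eq_Iio_add_Ioi (fun j => f j i) i, Finset.sum_add_distrib,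
    Finset.sum_add_distrib, ← sumLT_add]
  have : ∑ i, ∑ j ∈ Finset.Ioi i, f j i = sumLT fun k i => f i k := by
    rw [sumLT, Finset.sum_comm' (t' := Finset.univ) (s' := fun i => Finset.Iio i) (by simp)]
  have h0 : ∑ i, ∑ j ∈ Finset.Iio i, f j i = sumLT fun k i => f k i := rfl
  rw [this, h0]
  ring

theorem sum_sub_mul_eq_sumLT (f g : Fin n → ℤ) :
    ∑ i, (∑ k, f k - f i) * g i = sumLT fun k i => f k * g i + f i * g k := by
  have h := sum_sum_eq_sumLT fun k i => f k * g i
  simp only [sub_mul, Finset.sum_sub_distrib, Finset.sum_mul]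
  rw [h]
  ring

theorem sum_sq_eq_sumLT (f : Fin n → ℤ) :
    (∑ i, f i) ^ 2 = ∑ i, f i ^ 2 + sumLT fun k i => 2 * (f k * f i) := by
  rw [sq, Finset.sum_mul_sum, Finset.sum_comm, sum_sum_eq_sumLT fun j i => f j * f i]
  congr 1
  · exact Finset.sum_congr rfl fun i _ => (sq _).symm
  · exact sumLT_congr fun k i _ => by ring

theorem sumLT_right (f : Fin n → ℤ) : (sumLT fun _ i => f i) = ∑ i : Fin n, (i : ℤ) * f i := by
  simp [sumLT, Fin.card_Iio]

/-- The exponent that the lattice order integral produces. -/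
theorem sum_lamAt (σ : Equiv.Perm (Fin n)) (e : Exps n) (lam : Fin n → ℤ) :
    ∑ i, (-((lamAt σ e lam (σ.symm i) i - 1) * (e i + 1)) -
      ∑ j ∈ Finset.Iio i, if j ∈ before σ (σ.symm i) then 0 else (e j : ℤ)) =
    -(∑ i, (lam i - 1) * (e i + 1)) +
      sumLT fun k i => (e k + 1) * (e i + 1) + if σ.symm i < σ.symm k then 1 else 0 := by
  have h1 : ∑ i, (∑ j ∈ before σ (σ.symm i), ((e j + 1 : ℤ) + if i < j then 1 else 0)) * (e i + 1) =
      sumLT fun k i => (if σ.symm k < σ.symm i then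
          ((e k + 1 : ℤ) + if i < k then 1 else 0) * (e i + 1) else 0) +
        if σ.symm i < σ.symm k then ((e i + 1 : ℤ) + if k < i then 1 else 0) * (e k + 1) else 0 := by
    have h := sum_sum_eq_sumLT fun j i => if σ.symm j < σ.symm i then
          ((e j + 1 : ℤ) + if i < j then 1 else 0) * (e i + 1) else 0
    simp only [lt_irrefl, if_false, Finset.sum_const_zero, zero_add] at h
    rw [← h]
    refine Finset.sum_congr rfl fun i _ => ?_
    rw [Finset.sum_mul, before, Finset.sum_filter]
    rfl
  have h2 : ∀ i, -((lamAt σ e lam (σ.symm i) i - 1) * (e i + 1)) = -((lam i - 1) * (e i + 1)) +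
      (∑ j ∈ before σ (σ.symm i), ((e j + 1 : ℤ) + if i < j then 1 else 0)) * (e i + 1) := by
    intro i
    rw [lamAt]
    ring
  rw [Finset.sum_sub_distrib, Finset.sum_congr rfl fun i _ => h2 i, Finset.sum_add_distrib, h1,
    Finset.sum_neg_distrib, add_sub_assoc]
  congr 1
  have h3 : (∑ i, ∑ j ∈ Finset.Iio i, if j ∈ before σ (σ.symm i) then 0 else (e j : ℤ)) =
      sumLT fun k i => if σ.symm k < σ.symm i then 0 else (e k : ℤ) := by
    simp [sumLT, before]
  rw [h3, sumLT_sub]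
  refine sumLT_congr fun k i hk => ?_
  -- A pair `k < i` contributes `(e k + 1)(e i + 1)` whichever variable is integrated first. If `i`
  -- comes first there is an additional `1`, so only inversions are seen.
  rcases lt_trichotomy (σ.symm k) (σ.symm i) with h | h | h
  · simp [h, hk.not_gt, h.not_gt]
  · exact absurd (σ.symm.injective h) hk.ne
  · simp [h, h.not_gt, hk]
    ring

/-- The exponent of the lattice `γ`, in terms of the order of integration. -/
theorem sum_before (σ : Equiv.Perm (Fin n)) (e : Exps n) (i : Fin n) :
    ∑ j ∈ before σ (σ.symm i), ((e j + 1 : ℤ) + if i < j then 1 else 0) =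
      ∑ j ∈ before σ (σ.symm i), (e j : ℤ) + ((σ.symm i : ℕ) +
        (Finset.univ.filter fun j => j < σ.symm i ∧ i < σ j).card) := by
  have h1 : (before σ (σ.symm i)).card = (σ.symm i : ℕ) := by
    rw [← Fin.card_Iio (σ.symm i)]
    refine Finset.card_equiv σ.symm fun j => ?_
    simp [before]
  have h2 : ((before σ (σ.symm i)).filter fun j => i < j).card =
      (Finset.univ.filter fun j => j < σ.symm i ∧ i < σ j).card := by
    refine Finset.card_equiv σ.symm fun j => ?_
    simp [before]
  rw [← h2]
  simp only [Finset.sum_add_distrib, Finset.sum_const, nsmul_eq_mul, mul_one, Finset.sum_boole, h1]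
  ring

end

/-! ### The inverse transform on the first class -/

section
variable {n : ℕ} {q : ℝ} (hq0 : 0 < q) (hq1 : q < 1) (σ : Equiv.Perm (Fin n))

/-- The lattice order integral of the Gaussian. -/
def loConst (q : ℝ) (σ : Equiv.Perm (Fin n)) : ℂ :=
  (2 * (1 - (q : ℂ) ^ 2) * latticeSum q 0) ^ n *
    (q : ℂ) ^ (sumLT fun k i => 1 + if σ.symm i < σ.symm k then 1 else 0)

include hq0 hq1

theorem loConst_ne_zero : loConst q σ ≠ 0 := by
  have hq : (q : ℂ) ≠ 0 := Complex.ofReal_ne_zero.2 hq0.ne'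
  refine mul_ne_zero (pow_ne_zero _ (mul_ne_zero (mul_ne_zero two_ne_zero
    (one_sub_pow_ne_zero hq0 hq1 two_ne_zero)) (latticeSum_zero_ne_zero hq0 hq1))) (zpow_ne_zero _ hq)

theorem latticeSum_even {e : ℕ} (he : Even e) : latticeSum q e = latticeSum q 0 * momD q e := by
  obtain ⟨r, rfl⟩ := he
  rw [← two_mul, latticeSum_eq hq0 hq1]

/-- The parity condition of each step, freed from the even `e j`, involves only the position and the
inversions of the variable, which is where these terms in `γ` come from. -/
theorem hasLOIntegral_famD_of_even (A : ℂ) {e : Exps n} (he : ∀ j, Even (e j)) (lam : Fin n → ℤ)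
    {γ : Fin n → ℝ} (g : Fin n → ℕ) (hγ : ∀ i, γ i = q ^ g i)
    (hg : ∀ i, Even (g i + (lam i - 1) - ((σ.symm i : ℕ) +
        (Finset.univ.filter fun j => j < σ.symm i ∧ i < σ j).card : ℤ))) :
    HasLOIntegral q σ γ (famD q A e (coefA q Finset.univ lam))
      (A * ((2 * (1 - (q : ℂ) ^ 2) * latticeSum q 0) ^ n * (∏ i, momD q (e i)) *
        (q : ℂ) ^ (-(∑ i, (lam i - 1) * (e i + 1)) +
          sumLT fun k i => (e k + 1) * (e i + 1) + if σ.symm i < σ.symm k then 1 else 0))) := by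
  have hq : (q : ℂ) ≠ 0 := Complex.ofReal_ne_zero.2 hq0.ne'
  have h := hasLOIntegral_famD hq0 hq1 σ A he lam g fun i => by
    rw [lamAt, sum_before]
    have h1 : Even (∑ j ∈ before σ (σ.symm i), (e j : ℤ)) :=
      Finset.even_sum _ fun j _ => by exact_mod_cast he j
    have h2 := (hg i).sub h1
    refine (congrArg Even ?_).mpr h2
    ring
  rw [Finset.prod_mul_distrib, ← zpow_sum hq, sum_lamAt,
    Finset.prod_congr rfl fun i _ => by rw [latticeSum_even hq0 hq1 (he i), ← mul_assoc],
    Finset.prod_mul_distrib, Finset.prod_const, Finset.card_univ, Fintype.card_fin, ← funext hγ] at h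
  exact h

theorem gaussD_eq_famD : gaussD n q = famD q 1 0 (coefA q Finset.univ fun _ => 1) := by
  funext M
  rw [gaussD_apply hq0 hq1, famD]
  simp only [Pi.zero_apply, zero_le, true_and, tsub_zero, coefA, Finset.mem_univ, if_true, one_mul]
  split_ifs
  · rw [Finset.prod_div_distrib, Finset.prod_mul_distrib, Finset.prod_pow_eq_pow_sum,
      Finset.prod_inv_distrib, pow_add]
    have : ∀ k : ℕ, (q : ℂ) ^ (2 * (1 : ℤ) * k) = (q : ℂ) ^ (2 * k) := fun k => by
      rw [mul_one, ← zpow_natCast]; push_cast; rfl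
    simp only [this, Finset.prod_pow_eq_pow_sum, ← Finset.mul_sum]
    ring
  · rfl

/-- The Gaussian has `lam = 1`, so its parity condition requires an even further exponent; in `γ̃`
the sum `B(β)^i` indeed occurs twice. -/
theorem hasLOIntegral_gaussD (β : Fin n → ZMod 2) :
    HasLOIntegral q σ (latticeGammaTilde q β σ) (gaussD n q) (loConst q σ) := by
  rw [gaussD_eq_famD hq0 hq1]
  have h := hasLOIntegral_famD_of_even hq0 hq1 σ 1 (e := 0) (fun _ => Even.zero) (fun _ => 1)
    (γ := latticeGammaTilde q β σ) (fun i => upperSum β i + (σ.symm i : ℕ) +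
      (Finset.univ.filter fun j => j < σ.symm i ∧ i < σ j).card + upperSum β i)
    (fun i => by rw [latticeGammaTilde, latticeGamma, ← pow_add]) fun i => ⟨upperSum β i, by
      push_cast; ring⟩
  convert h using 1
  simp [loConst, momD]

omit hq0 hq1 in
theorem coeff_gaussBig_mul_X_pow (m L : ℕ) :
    PowerSeries.coeff L (gaussBig q * ((X ^ m : ℂ[X]) : PowerSeries ℂ)) =
      if m ≤ L ∧ Even (L - m) then PowerSeries.coeff ((L - m) / 2) (ESeries (q ^ 4)) *
        (-(q : ℂ) ^ 4) ^ ((L - m) / 2) else 0 := by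
  rw [Polynomial.coe_pow, Polynomial.coe_X, PowerSeries.coeff_mul_X_pow']
  by_cases h : m ≤ L
  · simp [h, gaussBig, sqSubst]
  · simp [h]

omit hq1 in
-- With `M = 2K + E + m`, the reordering exponents are quadratic in `K`, `E`, `m`. The part
-- quadratic in `K` completes `∑ Kⱼ²` to `(∑ Kⱼ)²`, the linear part is `lam`, and the constant part
-- is `A`.
theorem mono_mul_dClass_X_pow (E m : Exps n) :
    mulW (dWeight q) (mono E) (dClass q fun j => X ^ m j) =
      famD q ((q : ℂ) ^ (sumLT fun k i => m k * m i + E k * m i)) (E + m)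
        (coefA q Finset.univ fun j => 1 + (∑ k, (m k : ℤ) - m j) + ∑ k ∈ Finset.Iio j, (E k : ℤ)) := by
  have hq : (q : ℂ) ≠ 0 := Complex.ofReal_ne_zero.2 hq0.ne'
  funext M
  rw [mulW_mono_left]
  by_cases hM : M ∈ Set.range fun K : Exps n => fun j => 2 * K j + (E + m) j
  · obtain ⟨K, rfl⟩ := hM
    rw [famD_apply]
    have hL : ((fun j => 2 * K j + (E + m) j) - E : Exps n) = fun j => 2 * K j + m j := by
      funext j
      simp only [Pi.sub_apply, Pi.add_apply]
      omega
    have h1 : ∀ j, (2 * K j + m j - m j) / 2 = K j := fun j => by omega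
    rw [if_pos fun i => by simp only [Pi.add_apply]; omega, hL, dClass_apply]
    simp only [coeff_gaussBig_mul_X_pow, Nat.le_add_left, Nat.add_sub_cancel, even_two_mul, true_and,
      if_true, coefA, Finset.mem_univ, Nat.mul_div_cancel_left _ (Nat.succ_pos 1)]
    have h2 : ∀ j, PowerSeries.coeff (K j) (ESeries (q ^ 4)) * (-(q : ℂ) ^ 4) ^ K j =
        (q : ℂ) ^ (2 * (K j : ℤ) ^ 2 + 2 * K j) * ((-1) ^ K j / (qPoch (q ^ 4) (K j) : ℂ)) := by
      intro j
      have h3 := two_mul_sq_add_two_mul (K j)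
      have h4 : (2 * (K j : ℤ) ^ 2 + 2 * K j) = ((2 * K j ^ 2 + 2 * K j : ℕ) : ℤ) := by push_cast; ring
      rw [ESeries, PowerSeries.coeff_mk, h4, zpow_natCast, h3, pow_add, pow_mul, pow_mul,
        neg_pow ((q : ℂ) ^ 4)]
      push_cast
      ring
    have h5 : ∀ (j : Fin n) (l : ℤ), (-1 : ℂ) ^ K j * (q : ℂ) ^ (2 * l * K j) / (qPoch (q ^ 4) (K j) : ℂ) =
        (q : ℂ) ^ (2 * l * K j) * ((-1) ^ K j / (qPoch (q ^ 4) (K j) : ℂ)) := by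
      intro j l
      ring
    simp only [h2, h5]
    rw [Finset.prod_mul_distrib, Finset.prod_mul_distrib, ← zpow_sum hq, ← zpow_sum hq, dWeight,
      ← zpow_natCast _ (∑ i, ∑ j ∈ Finset.Iio i, E j * (2 * K i + m i)), ← zpow_natCast _ (pairSum _),
      ← zpow_natCast _ (2 * (∑ j, K j) ^ 2), ← mul_assoc, ← mul_assoc, ← mul_assoc,
      ← zpow_add₀ hq, ← zpow_add₀ hq, ← zpow_add₀ hq, ← zpow_add₀ hq]
    congr 2
    have e1 : ((∑ i, ∑ j ∈ Finset.Iio i, E j * (2 * K i + m i) : ℕ) : ℤ) =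
        sumLT fun k i => E k * (2 * K i + m i) := by
      push_cast; rfl
    have e2 : ((pairSum fun j => 2 * K j + m j : ℕ) : ℤ) =
        sumLT fun k i => (2 * K k + m k) * (2 * K i + m i) := by
      rw [pairSum]; push_cast; rfl
    have e3 : ((2 * (∑ j, K j) ^ 2 : ℕ) : ℤ) = 2 * ∑ i, (K i : ℤ) ^ 2 +
        2 * sumLT fun k i => 2 * ((K k : ℤ) * K i) := by
      rw [← mul_add, ← sum_sq_eq_sumLT]; push_cast; rfl
    have e4 : ∑ j, 2 * (1 + (∑ k, (m k : ℤ) - m j) + ∑ k ∈ Finset.Iio j, (E k : ℤ)) * (K j : ℤ) =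
        2 * ∑ j, (K j : ℤ) + 2 * (sumLT fun k i => m k * K i + m i * K k) +
          2 * sumLT fun k i => E k * K i := by
      rw [← sum_sub_mul_eq_sumLT, sumLT, Finset.mul_sum, Finset.mul_sum, Finset.mul_sum,
        ← Finset.sum_add_distrib, ← Finset.sum_add_distrib]
      refine Finset.sum_congr rfl fun j _ => ?_
      rw [← Finset.sum_mul]
      ring
    have e5 : ∑ j, (2 * (K j : ℤ) ^ 2 + 2 * K j) = 2 * ∑ i, (K i : ℤ) ^ 2 + 2 * ∑ j, (K j : ℤ) := by
      rw [Finset.sum_add_distrib, Finset.mul_sum, Finset.mul_sum]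
    have e6 : (sumLT fun k i => (E k : ℤ) * (2 * K i + m i)) +
        (sumLT fun k i => (2 * K k + m k : ℤ) * (2 * K i + m i)) =
        (sumLT fun k i => (m k * m i + E k * m i : ℤ)) + 2 * (sumLT fun k i => 2 * ((K k : ℤ) * K i)) +
        2 * (sumLT fun k i => (m k * K i + m i * K k : ℤ)) + 2 * sumLT fun k i => (E k * K i : ℤ) := by
      simp only [sumLT_mul, sumLT_add]
      exact sumLT_congr fun k i _ => by ring
    rw [e1, e2, e3, e4, e5]
    linear_combination e6
  · rw [famD_eq_zero hM]
    split_ifs with hE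
    · rw [dClass_apply]
      have : ∃ j, ¬ (m j ≤ (M - E) j ∧ Even ((M - E) j - m j)) := by
        by_contra! h
        refine hM ⟨fun j => ((M - E) j - m j) / 2, ?_⟩
        funext j
        have h1 := Nat.two_mul_div_two_of_even (h j).2
        have h2 := (h j).1
        have h3 := hE j
        simp only [Pi.sub_apply, Pi.add_apply] at *
        omega
      obtain ⟨j, hj⟩ := this
      rw [Finset.prod_eq_zero (Finset.mem_univ j)]
      · ring
      · simp only [coeff_gaussBig_mul_X_pow, if_neg hj]
    · rfl

theorem hasLOIntegral_mono_mul_dClass_X_pow {β : Fin n → ZMod 2} {m : Exps n}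
    (hm : ∀ j, (m j : ZMod 2) = β j) (E : Exps n) :
    HasLOIntegral q σ (latticeGamma q β σ)
      (mulW (dWeight q) (mono E) (dClass q fun j => X ^ m j))
      (loConst q σ * ((q : ℂ) ^ (∑ i : Fin n, (i : ℕ) * E i) * ∏ j, momD q (E j + m j))) := by
  have hq : (q : ℂ) ≠ 0 := Complex.ofReal_ne_zero.2 hq0.ne'
  rw [mono_mul_dClass_X_pow hq0]
  by_cases he : ∀ j, Even ((E + m) j)
  · have h := hasLOIntegral_famD_of_even hq0 hq1 σ ((q : ℂ) ^ (sumLT fun k i => m k * m i + E k * m i))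
      he (fun j => 1 + (∑ k, (m k : ℤ) - m j) + ∑ k ∈ Finset.Iio j, (E k : ℤ))
      (γ := latticeGamma q β σ) (fun i => upperSum β i + (σ.symm i : ℕ) +
        (Finset.univ.filter fun j => j < σ.symm i ∧ i < σ j).card) (fun i => rfl) fun i => ?_
    · convert h using 1
      -- Pair by pair, everything cancels except the Gaussian's own exponent and one `E i` for each
      -- pair `k < i`.
      have hexp : (q : ℂ) ^ (sumLT fun k i => 1 + if σ.symm i < σ.symm k then 1 else 0) *
          (q : ℂ) ^ (∑ i : Fin n, (i : ℕ) * E i) =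
          (q : ℂ) ^ (sumLT fun k i => (m k * m i + E k * m i : ℤ)) * (q : ℂ) ^ (-(∑ i,
            (1 + (∑ k, (m k : ℤ) - m i) + ∑ k ∈ Finset.Iio i, (E k : ℤ) - 1) * (E i + m i + 1)) +
            sumLT fun k i => (E k + m k + 1 : ℤ) * (E i + m i + 1) +
              if σ.symm i < σ.symm k then 1 else 0) := by
        rw [← zpow_natCast _ (∑ i : Fin n, (i : ℕ) * E i), ← zpow_add₀ hq, ← zpow_add₀ hq]
        congr 1
        push_cast
        rw [← sumLT_right]
        have e1 : ∑ i, (1 + (∑ k, (m k : ℤ) - m i) + ∑ k ∈ Finset.Iio i, (E k : ℤ) - 1) *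
            (E i + m i + 1) = (sumLT fun k i => m k * (E i + m i + 1) + m i * (E k + m k + 1)) +
              sumLT fun k i => E k * (E i + m i + 1) := by
          rw [← sum_sub_mul_eq_sumLT (fun i => (m i : ℤ)) (fun i => (E i + m i + 1 : ℤ)), sumLT,
            ← Finset.sum_add_distrib]
          refine Finset.sum_congr rfl fun j _ => ?_
          rw [← Finset.sum_mul]
          ring
        rw [e1]
        have e2 : (sumLT fun _ i => (E i : ℤ)) +
            (sumLT fun k i => 1 + if σ.symm i < σ.symm k then 1 else 0) +
            (sumLT fun k i => m k * (E i + m i + 1) + m i * (E k + m k + 1)) +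
              (sumLT fun k i => E k * (E i + m i + 1)) =
            (sumLT fun k i => (m k * m i + E k * m i : ℤ)) + (sumLT fun k i =>
              (E k + m k + 1 : ℤ) * (E i + m i + 1) + if σ.symm i < σ.symm k then 1 else 0) := by
          simp only [sumLT_add]
          exact sumLT_congr fun k i _ => by ring
        linear_combination e2
      simp only [Pi.add_apply, Nat.cast_add, loConst]
      linear_combination ((2 * (1 - (q : ℂ) ^ 2) * latticeSum q 0) ^ n *
        ∏ j, momD q (E j + m j)) * hexp
    -- The linear exponent contributes `m k + E k` for `k < i`, which is even, and `m k` for `k >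
    -- i`; the term `B(β)^i` of `γ` compensates the latter modulo `2`.
    · have h1 : Even (∑ k ∈ Finset.Ioi i, (((β k).val : ℤ) + m k)) := by
        refine Finset.even_sum _ fun k _ => ?_
        have : Even ((β k).val + m k) := by
          rw [← ZMod.natCast_eq_zero_iff_even]
          push_cast
          rw [hm, ZMod.natCast_zmod_val]
          exact CharTwo.add_self_eq_zero _
        exact_mod_cast this
      have h2 : Even (∑ k ∈ Finset.Iio i, ((E k : ℤ) + m k)) :=
        Finset.even_sum _ fun k _ => by exact_mod_cast he k
      refine (congrArg Even ?_).mpr (h1.add h2)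
      rw [sum_eq_Iio_add_Ioi (fun k => (m k : ℤ)) i, Finset.sum_add_distrib, Finset.sum_add_distrib,
        upperSum]
      push_cast
      ring
  · push Not at he
    obtain ⟨j, hj⟩ := he
    rw [Finset.prod_eq_zero (Finset.mem_univ j) (show momD q (E j + m j) = 0 from momD_odd q hj),
      mul_zero, mul_zero]
    -- With an odd exponent the even part is zero, and the first integration already gives `0`.
    · refine hasLOIntegral_of_evenPart_eq_zero
        (entire_famD hq0 hq1 _ _ (geomBdd_coefA hq0 hq1 _ _)) ?_ (Fin.pos j)
      funext N
      rw [evenPart]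
      split_ifs with hN
      · refine famD_eq_zero ?_
        rintro ⟨K, rfl⟩
        have := hN j
        rw [Nat.even_add] at this
        exact hj (this.1 (even_two_mul _))
      · rfl

omit hq0 hq1 in
theorem dClass_eq_sum (p : Fin n → ℂ[X]) :
    dClass q p = ∑ m ∈ Fintype.piFinset fun j => (p j).support,
      (∏ j, (p j).coeff (m j)) • dClass q fun j => X ^ m j := by
  funext M
  have h : ∀ j, PowerSeries.coeff (M j) (gaussBig q * (p j : PowerSeries ℂ)) =
      ∑ k ∈ (p j).support, (p j).coeff k *
        PowerSeries.coeff (M j) (gaussBig q * ((X ^ k : ℂ[X]) : PowerSeries ℂ)) := by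
    intro j
    let f : ℂ[X] →ₗ[ℂ] ℂ :=
      { toFun := fun p => PowerSeries.coeff (M j) (gaussBig q * (p : PowerSeries ℂ))
        map_add' := fun a b => by simp [mul_add]
        map_smul' := fun c a => by
          rw [Polynomial.coe_smul, mul_smul_comm]; simp }
    change f (p j) = ∑ k ∈ (p j).support, (p j).coeff k * f (X ^ k)
    conv_lhs => rw [(p j).as_sum_support_C_mul_X_pow]
    rw [map_sum]
    refine Finset.sum_congr rfl fun k _ => ?_
    rw [← smul_eq_C_mul, map_smul, smul_eq_mul]
  rw [Finset.sum_apply, dClass_apply, Finset.prod_congr rfl fun j _ => h j, Finset.prod_univ_sum,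
    Finset.mul_sum]
  refine Finset.sum_congr rfl fun m _ => ?_
  rw [Pi.smul_apply, smul_eq_mul, dClass_apply, Finset.prod_mul_distrib]
  ring

theorem hasLOIntegral_mono_mul_dClass {β : Fin n → ZMod 2} {p : Fin n → ℂ[X]}
    (hp : ∀ j, HasParity (p j) (β j)) (E : Exps n) :
    HasLOIntegral q σ (latticeGamma q β σ) (mulW (dWeight q) (mono E) (dClass q p))
      (loConst q σ * ((q : ℂ) ^ (∑ i : Fin n, (i : ℕ) * E i) *
        ∏ j, linExt (momD q) (X ^ E j * p j))) := by
  have h : ∀ j, linExt (momD q) (X ^ E j * p j) =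
      ∑ k ∈ (p j).support, (p j).coeff k * momD q (E j + k) := by
    intro j
    conv_lhs => rw [(p j).as_sum_support_C_mul_X_pow, Finset.mul_sum, map_sum]
    refine Finset.sum_congr rfl fun k _ => ?_
    rw [← smul_eq_C_mul, mul_smul_comm, map_smul, ← pow_add, linExt_X_pow, smul_eq_mul]
  rw [dClass_eq_sum, mulW_sum_right, Finset.prod_congr rfl fun j _ => h j, Finset.prod_univ_sum,
    Finset.mul_sum, Finset.mul_sum]
  refine HasLOIntegral.sum fun m hm => ?_
  rw [mulW_smul_right, Finset.prod_mul_distrib]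
  have hm' : ∀ j, (m j : ZMod 2) = β j := fun j =>
    hp j (m j) (Polynomial.mem_support_iff.1 (Fintype.mem_piFinset.1 hm j))
  convert (hasLOIntegral_mono_mul_dClass_X_pow hq0 hq1 σ hm' E).smul (∏ j, (p j).coeff (m j)) using 1
  ring

/-- The factors `q^{1-j}` in the exponential cancel the power `q^{∑ (j-1)Eⱼ}` of the lattice order
integral. What remains is `momD_transform` in each variable. -/
theorem transformG_dClass {β : Fin n → ZMod 2} {p : Fin n → ℂ[X]}
    (hp : ∀ j, HasParity (p j) (β j)) :
    transformG q σ (latticeGamma q β σ) (dClass q p) =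
      loConst q σ • xClass q fun j => polyMap q (p j) := by
  have hq : (q : ℂ) ≠ 0 := Complex.ofReal_ne_zero.2 hq0.ne'
  have hq2 : q ^ 2 < 1 := pow_lt_one₀ hq0.le hq1 two_ne_zero
  have hq2' : (1 : ℂ) - (q : ℂ) ^ 2 ≠ 0 := one_sub_pow_ne_zero hq0 hq1 two_ne_zero
  funext E
  rw [transformG, (hasLOIntegral_mono_mul_dClass hq0 hq1 σ hp E).loIntegral_eq, Pi.smul_apply,
    smul_eq_mul, xClass_apply, expCoeff]
  simp only [← momD_transform hq0 hq1]
  rw [← Finset.prod_pow_eq_pow_sum, ← Finset.prod_mul_distrib, mul_left_comm,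
    ← Finset.prod_mul_distrib]
  congr 1
  refine Finset.prod_congr rfl fun j _ => ?_
  have h4 := qPoch_ne_zero (pow_pos hq0 2) hq2 (E j)
  rw [qFactorial_eq hq2, mul_pow, div_pow, zpow_neg, zpow_natCast, inv_pow, ← pow_mul]
  push_cast at hq2' h4 ⊢
  field_simp

theorem classS_dClass {β : Fin n → ZMod 2} {p : Fin n → ℂ[X]} (hp : ∀ j, HasParity (p j) (β j)) :
    ClassS q σ (latticeGamma q β σ) (dClass q p) := fun E =>
  ⟨_, hasLOIntegral_mono_mul_dClass hq0 hq1 σ hp E⟩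

end

end BraidedFourier

end

noncomputable section

namespace BraidedFourier

open Filter Topology

/-! ### The Gaussian integral depends on the lattice -/

/-- `w / (1 + w²)`. -/
def cauchyKer (w : ℂ) : ℂ := w / (1 + w ^ 2)

/-- The Jackson integral of `1 / (1 + t²)`, up to a constant. -/
def cauchySum (q : ℝ) (z : ℂ) : ℂ := ∑' h : ℤ, cauchyKer ((q : ℂ) ^ (2 * h) * z)

section
variable {q : ℝ} (hq0 : 0 < q) (hq1 : q < 1)
include hq0 hq1

theorem summable_pow_natAbs : Summable fun s : ℤ => q ^ s.natAbs := by
  have h := summable_geometric_of_lt_one hq0.le hq1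
  refine Summable.of_nat_of_neg (by simpa using h) (by simpa using h)

omit hq1 in
theorem norm_cauchyKer_le {t : ℝ} (ht : 0 < t) (s : ℤ) :
    ‖cauchyKer ((q : ℂ) ^ s * t)‖ ≤ (t + t⁻¹) * q ^ s.natAbs := by
  have h1 : cauchyKer ((q : ℂ) ^ s * t) = ((q ^ s * t / (1 + (q ^ s * t) ^ 2) : ℝ) : ℂ) := by
    simp [cauchyKer]
  have hw : 0 < q ^ s * t := mul_pos (zpow_pos hq0 s) ht
  rw [h1, Complex.norm_real, Real.norm_of_nonneg (by positivity)]
  rcases le_total 0 s with hs | hs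
  · obtain ⟨k, rfl⟩ := Int.eq_ofNat_of_zero_le hs
    calc q ^ (k : ℤ) * t / (1 + (q ^ (k : ℤ) * t) ^ 2) ≤ q ^ (k : ℤ) * t :=
          div_le_self hw.le (by nlinarith)
      _ = t * q ^ k := by rw [zpow_natCast, mul_comm]
      _ ≤ (t + t⁻¹) * q ^ k := by
          have : 0 < t⁻¹ := inv_pos.2 ht
          have := pow_pos hq0 k
          nlinarith
  · obtain ⟨k, hk⟩ := Int.eq_ofNat_of_zero_le (neg_nonneg.2 hs)
    obtain rfl : s = -k := by omega
    have hna : (-(k : ℤ)).natAbs = k := by simp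
    have hpos := pow_pos hq0 k
    calc q ^ (-(k : ℤ)) * t / (1 + (q ^ (-(k : ℤ)) * t) ^ 2) ≤
          q ^ (-(k : ℤ)) * t / (q ^ (-(k : ℤ)) * t) ^ 2 :=
          div_le_div_of_nonneg_left hw.le (by positivity) (by linarith)
      _ = t⁻¹ * q ^ k := by
          rw [zpow_neg, zpow_natCast]
          field_simp
      _ ≤ (t + t⁻¹) * q ^ (-(k : ℤ)).natAbs := by
          rw [hna]
          nlinarith

theorem summable_cauchyKer {t : ℝ} (ht : 0 < t) :
    Summable fun s : ℤ => ‖cauchyKer ((q : ℂ) ^ s * t)‖ :=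
  Summable.of_nonneg_of_le (fun _ => norm_nonneg _) (norm_cauchyKer_le hq0 ht)
    ((summable_pow_natAbs hq0 hq1).mul_left _)

theorem summable_cauchyKer_even {t : ℝ} (ht : 0 < t) :
    Summable fun h : ℤ => ‖cauchyKer ((q : ℂ) ^ (2 * h) * t)‖ :=
  (summable_cauchyKer hq0 hq1 ht).comp_injective (i := fun h : ℤ => 2 * h) fun a b h => by
    simp only at h; omega

/-- A convex neighbourhood of `1` and `i` that avoids all points `± i q^s` with `s ≠ 0`. -/
def poleStrip (q : ℝ) : Set ℂ := {z | |z.re + z.im - 1| < (1 - q) / 2} ∩ Metric.ball 0 3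

omit hq0 hq1 in
theorem isOpen_poleStrip : IsOpen (poleStrip q) := by
  refine IsOpen.inter (isOpen_lt ?_ continuous_const) Metric.isOpen_ball
  exact ((Complex.continuous_re.add Complex.continuous_im).sub continuous_const).abs

omit hq0 hq1 in
theorem convex_poleStrip : Convex ℝ (poleStrip q) := by
  refine Convex.inter ?_ (convex_ball 0 3)
  have h : {z : ℂ | |z.re + z.im - 1| < (1 - q) / 2} =
      (Complex.reLm + Complex.imLm) ⁻¹' Metric.ball 1 ((1 - q) / 2) := by
    ext z
    simp [Real.dist_eq]
  rw [h]
  exact (convex_ball (1 : ℝ) _).linear_preimage _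

omit hq0 hq1 in
-- Factor `1 + w² = (w-i)(w+i)`, and bound each factor below by the linear form `Re + Im`, which is
-- at most twice the norm.
theorem norm_one_add_sq_ge (w : ℂ) {d : ℝ} (h : d ≤ |w.re + w.im - 1|)
    (hw : 0 ≤ w.re + w.im) : d * (w.re + w.im + 1) / 4 ≤ ‖1 + w ^ 2‖ := by
  have hl : ∀ v : ℂ, |v.re + v.im| ≤ 2 * ‖v‖ := fun v =>
    (abs_add_le _ _).trans (by linarith [Complex.abs_re_le_norm v, Complex.abs_im_le_norm v])
  have h1 := hl (w - Complex.I)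
  have h2 := hl (w + Complex.I)
  simp only [Complex.sub_re, Complex.sub_im, Complex.add_re, Complex.add_im, Complex.I_re,
    Complex.I_im, sub_zero, add_zero, ← add_sub_assoc, ← add_assoc] at h1 h2
  have h3 : 1 + w ^ 2 = (w - Complex.I) * (w + Complex.I) := by
    linear_combination Complex.I_sq
  rw [h3, norm_mul]
  rw [abs_of_nonneg (by linarith)] at h2
  have h4 : d / 2 ≤ ‖w - Complex.I‖ := by linarith
  have h5 : (w.re + w.im + 1) / 2 ≤ ‖w + Complex.I‖ := by linarith
  calc d * (w.re + w.im + 1) / 4 = d / 2 * ((w.re + w.im + 1) / 2) := by ring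
    _ ≤ _ := mul_le_mul h4 h5 (by linarith) (norm_nonneg _)

theorem poleStrip_bound {z : ℂ} (hz : z ∈ poleStrip q) {s : ℤ} (hs : s ≠ 0) :
    1 + ((q : ℂ) ^ s * z) ^ 2 ≠ 0 ∧
      ‖cauchyKer ((q : ℂ) ^ s * z)‖ ≤ 48 / (1 - q) * q ^ s.natAbs := by
  obtain ⟨h1, h2⟩ := hz
  rw [Set.mem_ofPred_eq, abs_lt] at h1
  rw [mem_ball_zero_iff] at h2
  have hd : 0 < 1 - q := sub_pos.2 hq1
  have hre : ((q : ℂ) ^ s * z).re + ((q : ℂ) ^ s * z).im = q ^ s * (z.re + z.im) := by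
    rw [← Complex.ofReal_zpow, Complex.re_ofReal_mul, Complex.im_ofReal_mul]
    ring
  have hqs : 0 < q ^ s := zpow_pos hq0 s
  set l := z.re + z.im with hl
  have hl0 : 1 / 2 < l := by linarith
  have hw : ‖(q : ℂ) ^ s * z‖ ≤ 3 * q ^ s := by
    rw [norm_mul, norm_zpow, Complex.norm_real, Real.norm_of_nonneg hq0.le]
    nlinarith
  -- Since `l` differs from `1` by less than `(1-q)/2`, the value `q^s l` stays away from `1`: by a
  -- multiple of `q^s` if `s < 0`, by a constant if `s > 0`.
  obtain ⟨d, hd0, hd1, hd2⟩ : ∃ d : ℝ, 0 < d ∧ d ≤ |q ^ s * l - 1| ∧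
      3 * q ^ s ≤ d * (q ^ s * l + 1) / 4 * (48 / (1 - q) * q ^ s.natAbs) := by
    rcases lt_or_gt_of_ne hs with hs | hs
    · obtain ⟨k, hk⟩ := Int.eq_ofNat_of_zero_le (show 0 ≤ -s - 1 by omega)
      obtain rfl : s = -((k : ℤ) + 1) := by omega
      have hna : (-((k : ℤ) + 1)).natAbs = k + 1 := by omega
      have hinv : q ^ (-((k : ℤ) + 1)) * q ^ (k + 1) = 1 := by
        rw [zpow_neg, ← Nat.cast_succ, zpow_natCast]
        exact inv_mul_cancel₀ (pow_pos hq0 _).ne'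
      have hle : q ^ (k + 1) ≤ q := pow_le_of_le_one hq0.le hq1.le k.succ_ne_zero
      set Q := q ^ (-((k : ℤ) + 1))
      refine ⟨Q * ((1 - q) / 2), by positivity, ?_, ?_⟩
      · refine le_trans ?_ (le_abs_self _)
        nlinarith
      · rw [hna]
        have : Q * ((1 - q) / 2) * (Q * l + 1) / 4 * (48 / (1 - q) * q ^ (k + 1)) =
            6 * (Q * l + 1) * (Q * q ^ (k + 1)) := by
          field_simp
          ring
        rw [this, hinv]
        nlinarith
    · obtain ⟨k, hk⟩ := Int.eq_ofNat_of_zero_le (show 0 ≤ s - 1 by omega)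
      obtain rfl : s = (k : ℤ) + 1 := by omega
      have hna : ((k : ℤ) + 1).natAbs = k + 1 := by omega
      have hz' : q ^ ((k : ℤ) + 1) = q ^ (k + 1) := by rw [← Nat.cast_succ, zpow_natCast]
      have hle : q ^ (k + 1) ≤ q := pow_le_of_le_one hq0.le hq1.le k.succ_ne_zero
      rw [hz'] at hqs ⊢
      rw [hna]
      set Q := q ^ (k + 1)
      refine ⟨(1 - q) / 4, by positivity, ?_, ?_⟩
      · refine le_trans ?_ (neg_le_abs _)
        nlinarith
      · have : (1 - q) / 4 * (Q * l + 1) / 4 * (48 / (1 - q) * Q) = 3 * (Q * l + 1) * Q := by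
          field_simp
          ring
        rw [this]
        nlinarith [mul_pos (mul_pos hqs hqs) (lt_trans one_half_pos hl0)]
  have hb := norm_one_add_sq_ge ((q : ℂ) ^ s * z) (d := d) (by rw [hre]; exact hd1)
    (by rw [hre]; positivity)
  rw [hre] at hb
  have hpos : 0 < ‖1 + ((q : ℂ) ^ s * z) ^ 2‖ := lt_of_lt_of_le (by positivity) hb
  refine ⟨norm_pos_iff.1 hpos, ?_⟩
  rw [cauchyKer, norm_div, div_le_iff₀ hpos]
  refine hw.trans (hd2.trans ?_)
  rw [mul_comm]
  exact mul_le_mul_of_nonneg_left hb (by positivity)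

/-- The part of the alternating lattice sum that is regular at `i`. -/
def regularSum (q : ℝ) (z : ℂ) : ℂ :=
  ∑' h : ℤ, if h = 0 then 0 else cauchyKer ((q : ℂ) ^ (2 * h) * z)

theorem differentiableOn_cauchyKer {s : ℤ} (hs : s ≠ 0) :
    DifferentiableOn ℂ (fun z => cauchyKer ((q : ℂ) ^ s * z)) (poleStrip q) := by
  intro z hz
  have := (poleStrip_bound hq0 hq1 hz hs).1
  unfold cauchyKer
  exact ((by fun_prop : DifferentiableAt ℂ (fun z => (q : ℂ) ^ s * z) z).div
    (by fun_prop : DifferentiableAt ℂ (fun z => 1 + ((q : ℂ) ^ s * z) ^ 2) z)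
    this).differentiableWithinAt

theorem differentiableOn_regularSum : DifferentiableOn ℂ (regularSum q) (poleStrip q) := by
  have hs : Summable fun h : ℤ => 48 / (1 - q) * q ^ (2 * h).natAbs :=
    (((summable_pow_natAbs hq0 hq1).comp_injective (i := fun h : ℤ => 2 * h) fun a b h => by
      simp only at h; omega)).mul_left _
  refine Complex.differentiableOn_tsum_of_summable_norm hs (fun h => ?_) isOpen_poleStrip
    fun h z hz => ?_
  · by_cases hh : h = 0
    · simp [hh]
    · simp only [if_neg hh]
      exact differentiableOn_cauchyKer hq0 hq1 (by omega)
  · split_ifs with hh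
    · rw [norm_zero]
      have := sub_pos.2 hq1
      positivity
    · exact (poleStrip_bound hq0 hq1 hz (by omega)).2

theorem differentiableOn_cauchySum :
    DifferentiableOn ℂ (fun z => cauchySum q (q * z)) (poleStrip q) := by
  have hq : (q : ℂ) ≠ 0 := Complex.ofReal_ne_zero.2 hq0.ne'
  have hs : Summable fun h : ℤ => 48 / (1 - q) * q ^ (2 * h + 1).natAbs :=
    (((summable_pow_natAbs hq0 hq1).comp_injective (i := fun h : ℤ => 2 * h + 1) fun a b h => by
      simp only at h; omega)).mul_left _
  have he : ∀ (h : ℤ) (z : ℂ), (q : ℂ) ^ (2 * h) * (q * z) = (q : ℂ) ^ (2 * h + 1) * z := by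
    intro h z
    rw [zpow_add_one₀ hq, mul_assoc]
  simp only [cauchySum, he]
  exact Complex.differentiableOn_tsum_of_summable_norm hs
    (fun h => differentiableOn_cauchyKer hq0 hq1 (by omega)) isOpen_poleStrip
    fun h z hz => (poleStrip_bound hq0 hq1 hz (by omega)).2

/-- Equality for all positive `t` would extend along `poleStrip` from `1` to `i`. At `i` only the
term `h = 0` of one sum is singular. -/
theorem exists_cauchySum_ne : ∃ t : ℝ, 0 < t ∧ cauchySum q (q * t) ≠ cauchySum q t := by
  by_contra! hcon
  -- The difference of the two sums, cleared of its pole; its value at `i` is the numerator `i`, not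
  -- `0`.
  let f : ℂ → ℂ := fun z => (1 + z ^ 2) * (regularSum q z - cauchySum q (q * z)) + z
  have hf : AnalyticOnNhd ℂ f (poleStrip q) := by
    refine DifferentiableOn.analyticOnNhd ?_ isOpen_poleStrip
    exact ((by fun_prop : Differentiable ℂ fun z : ℂ => 1 + z ^ 2).differentiableOn.mul
      ((differentiableOn_regularSum hq0 hq1).sub (differentiableOn_cauchySum hq0 hq1))).add
      differentiableOn_id
  have hzero : ∀ t : ℝ, 0 < t → f t = 0 := by
    intro t ht
    have h1 : cauchySum q t = cauchyKer t + regularSum q t := by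
      rw [cauchySum, (summable_cauchyKer_even hq0 hq1 ht).of_norm.tsum_eq_add_tsum_ite 0, regularSum]
      simp
    have h2 : (1 : ℂ) + (t : ℂ) ^ 2 ≠ 0 := by
      have : (1 : ℝ) + t ^ 2 ≠ 0 := by positivity
      exact_mod_cast this
    have h3 : (1 + (t : ℂ) ^ 2) * cauchyKer t = t := mul_div_cancel₀ _ h2
    simp only [f]
    rw [hcon t ht, h1]
    linear_combination -h3
  have hone : (1 : ℂ) ∈ poleStrip q := by
    refine ⟨?_, by simp⟩
    simp only [Set.mem_ofPred_eq, Complex.one_re, Complex.one_im]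
    norm_num
    exact hq1
  have hI : Complex.I ∈ poleStrip q := by
    refine ⟨?_, by simp⟩
    simp only [Set.mem_ofPred_eq, Complex.I_re, Complex.I_im]
    norm_num
    exact hq1
  have hseq : Tendsto (fun n : ℕ => ((1 + 1 / ((n : ℝ) + 1) : ℝ) : ℂ)) atTop (𝓝[≠] 1) := by
    refine tendsto_nhdsWithin_iff.2 ⟨?_, Eventually.of_forall fun n => ?_⟩
    · have := (tendsto_one_div_add_atTop_nhds_zero_nat (𝕜 := ℝ)).const_add 1
      rw [add_zero] at this
      have := (Complex.continuous_ofReal.tendsto _).comp this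
      simpa only [Function.comp_def, Complex.ofReal_one] using this
    · have : (0 : ℝ) < 1 / ((n : ℝ) + 1) := by positivity
      intro h
      have h' := congrArg Complex.re h
      simp only [Complex.ofReal_re, Complex.one_re] at h'
      linarith
  have hfreq : ∃ᶠ z in 𝓝[≠] (1 : ℂ), f z = 0 :=
    hseq.frequently (Frequently.of_forall fun n => hzero _ (by positivity))
  have := hf.eqOn_zero_of_preconnected_of_frequently_eq_zero
    convex_poleStrip.isPreconnected hone hfreq hI
  simp [f] at this

/-! #### Partial fractions -/

/-- The partial fraction expansion of `1 / E_p`, up to a constant. -/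
def partialFrac (p : ℝ) (x : ℝ) : ℂ :=
  ∑' k : ℕ, (bigCoeff p k : ℂ) * (-(p : ℂ)) ^ k / (1 + (p : ℂ) ^ k * x)

end

section
variable {p : ℝ} (h0 : 0 < p) (h1 : p < 1)
include h0 h1

theorem norm_partialFrac_term_le {x : ℝ} (hx : 0 ≤ x) (k : ℕ) :
    ‖(bigCoeff p k : ℂ) * (-(p : ℂ)) ^ k / (1 + (p : ℂ) ^ k * x)‖ ≤ bigCoeff p k * p ^ k := by
  have hb := bigCoeff_pos h0 h1 k
  have h2 : 1 + (p : ℂ) ^ k * x = ((1 + p ^ k * x : ℝ) : ℂ) := by push_cast; rfl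
  have h3 : (1 : ℝ) ≤ 1 + p ^ k * x := le_add_of_nonneg_right (by positivity)
  rw [norm_div, norm_mul, norm_pow, norm_neg, h2, Complex.norm_real, Complex.norm_real,
    Complex.norm_real, Real.norm_of_nonneg h0.le, Real.norm_of_nonneg hb.le,
    Real.norm_of_nonneg (by linarith)]
  exact div_le_self (by positivity) h3

theorem summable_partialFrac {x : ℝ} (hx : 0 ≤ x) :
    Summable fun k : ℕ => ‖(bigCoeff p k : ℂ) * (-(p : ℂ)) ^ k / (1 + (p : ℂ) ^ k * x)‖ :=
  Summable.of_nonneg_of_le (fun _ => norm_nonneg _) (norm_partialFrac_term_le h0 h1 hx)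
    (summable_bigCoeff h0 h1 p)

theorem partialFrac_mul {x : ℝ} (hx : 0 ≤ x) :
    partialFrac p (p * x) = (1 + x) * partialFrac p x := by
  have hp : (p : ℂ) ≠ 0 := Complex.ofReal_ne_zero.2 h0.ne'
  have hne : ∀ k : ℕ, 1 + (p : ℂ) ^ k * x ≠ 0 := fun k => by
    have : 1 + p ^ k * x ≠ 0 := by positivity
    exact_mod_cast this
  have hs := (summable_partialFrac h0 h1 hx).of_norm
  have hs' := (summable_partialFrac h0 h1 (mul_nonneg h0.le hx)).of_norm
  -- Subtracting the series of `E_p(-1) = 0` from `(1+x)` times the expansion kills the term `k = 0`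
  -- and turns the term `k+1` into the `k`-th one at `px`.
  have hE : bigE p (-1) = 0 := by simpa using bigE_neg_zpow_eq_zero h0 h1 (le_refl (0 : ℤ))
  have hE' := hasSum_bigE h0 h1 (-1)
  rw [hE] at hE'
  have h2 := (hs.mul_left (1 + (x : ℂ))).hasSum.sub hE'
  rw [sub_zero, tsum_mul_left] at h2
  refine HasSum.unique ?_ h2
  have h3 : HasSum (fun k => (1 + (x : ℂ)) * ((bigCoeff p (k + 1) : ℂ) * (-(p : ℂ)) ^ (k + 1) /
      (1 + (p : ℂ) ^ (k + 1) * x)) - (bigCoeff p (k + 1) : ℂ) * (-1) ^ (k + 1))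
      (partialFrac p (p * x)) := by
    refine hasSum_of_eq hs'.hasSum (fun k => ?_) rfl
    have h4 : (bigCoeff p (k + 1) : ℂ) * (1 - (p : ℂ) ^ (k + 1)) = (p : ℂ) ^ k * bigCoeff p k := by
      exact_mod_cast congrArg Complex.ofReal (bigCoeff_succ h0 h1 k)
    have h5 := hne (k + 1)
    have h6 : 1 + (p : ℂ) ^ k * ((p * x : ℝ) : ℂ) = 1 + (p : ℂ) ^ (k + 1) * x := by
      push_cast; ring
    rw [h6, eq_div_iff h5, sub_mul, mul_assoc, div_mul_cancel₀ _ h5, neg_pow (p : ℂ) (k + 1),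
      neg_pow (p : ℂ) k, pow_succ (-1 : ℂ) k]
    linear_combination (-1 : ℂ) ^ k * h4
  have h7 := (hasSum_nat_add_iff (f := fun k => (1 + (x : ℂ)) * ((bigCoeff p k : ℂ) *
    (-(p : ℂ)) ^ k / (1 + (p : ℂ) ^ k * x)) - (bigCoeff p k : ℂ) * (-1) ^ k) 1).1 h3
  refine hasSum_of_eq h7 (fun k => rfl) ?_
  have hx0 := hne 0
  rw [pow_zero, one_mul] at hx0
  rw [Finset.sum_range_one]
  simp only [pow_zero, mul_one, one_mul]
  rw [mul_div_cancel₀ _ hx0]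
  ring

theorem tendsto_partialFrac {x : ℝ} (hx : 0 ≤ x) :
    Tendsto (fun m : ℕ => partialFrac p (p ^ m * x)) atTop (𝓝 (bigE p (-p))) := by
  have : bigE p (-p) = ∑' k : ℕ, (bigCoeff p k : ℂ) * (-(p : ℂ)) ^ k := rfl
  rw [this]
  refine tendsto_tsum_of_dominated_convergence (summable_bigCoeff h0 h1 p) (fun k => ?_)
    (Eventually.of_forall fun m k => norm_partialFrac_term_le h0 h1 (by positivity) k)
  have h2 : Tendsto (fun m : ℕ => ((p ^ m * x : ℝ) : ℂ)) atTop (𝓝 ((0 * x : ℝ) : ℂ)) :=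
    (Complex.continuous_ofReal.tendsto _).comp
      ((tendsto_pow_atTop_nhds_zero_of_lt_one h0.le h1).mul_const x)
  have h3 := (tendsto_const_nhds (x := (bigCoeff p k : ℂ) * (-(p : ℂ)) ^ k)).div
    ((h2.const_mul ((p : ℂ) ^ k)).const_add 1) (by simp)
  simp only [zero_mul, Complex.ofReal_zero, mul_zero, add_zero, div_one] at h3
  exact h3

/-- The functional equations are inverse to each other, so the product is invariant under `x ↦ px`
and equals its limit at `0`. -/
theorem partialFrac_mul_bigE {x : ℝ} (hx : 0 ≤ x) :
    partialFrac p x * bigE p x = bigE p (-p) := by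
  have hne : (1 : ℂ) + x ≠ 0 := by
    have : 1 + x ≠ 0 := by positivity
    exact_mod_cast this
  have hm : ∀ m : ℕ, partialFrac p (p ^ m * x) * bigE p ((p : ℂ) ^ m * x) =
      partialFrac p x * bigE p x := by
    intro m
    induction m with
    | zero => simp
    | succ m ih =>
      rw [← ih]
      have h2 := partialFrac_mul h0 h1 (x := p ^ m * x) (by positivity)
      have h3 := bigE_eq h0 h1 ((p : ℂ) ^ m * x)
      rw [pow_succ', mul_assoc, h2, h3, pow_succ', mul_assoc]
      push_cast
      ring_nf
  have hlim := (tendsto_partialFrac h0 h1 hx).mul (tendsto_bigE_pow_mul h0 h1 x)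
  simp only [hm, mul_one] at hlim
  exact tendsto_nhds_unique tendsto_const_nhds hlim

end

section
variable {q : ℝ} (hq0 : 0 < q) (hq1 : q < 1)
include hq0 hq1

omit hq1 in
theorem jackTerm_gaussFun (ζ : ℝ) (h : ℤ) : jackTerm q (gaussFun q) ζ h =
    2 * (1 - (q : ℂ) ^ 2) * ((q : ℂ) ^ (2 * h) * ζ) *
      (bigE (q ^ 4) ((((q ^ (2 * h) * ζ) ^ 2 : ℝ)) : ℂ))⁻¹ := by
  have hp : ∀ ε : ℤˣ, gaussFun q (pt q ζ ε h) =
      (bigE (q ^ 4) ((((q ^ (2 * h) * ζ) ^ 2 : ℝ)) : ℂ))⁻¹ := by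
    intro ε
    rw [gaussFun, ← Complex.ofReal_pow, ← sq_abs, abs_pt hq0, mul_pow, sq_abs, mul_pow]
  rw [jackTerm, sum_signs, hp, hp]
  push_cast
  ring

omit hq0 hq1 in
theorem mul_partialFrac (t : ℝ) : (t : ℂ) * partialFrac (q ^ 4) (t ^ 2) =
    ∑' k : ℕ, (bigCoeff (q ^ 4) k : ℂ) * (-(q : ℂ) ^ 2) ^ k *
      cauchyKer ((q : ℂ) ^ (2 * k) * t) := by
  rw [partialFrac, ← tsum_mul_left]
  refine tsum_congr fun k => ?_
  have h9 : (1 : ℂ) + ((q ^ 4 : ℝ) : ℂ) ^ k * ((t ^ 2 : ℝ) : ℂ) =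
      1 + ((q : ℂ) ^ (2 * k) * t) ^ 2 := by
    push_cast
    ring
  have h10 : (-((q ^ 4 : ℝ) : ℂ)) ^ k = (-(q : ℂ) ^ 2) ^ k * (q : ℂ) ^ (2 * k) := by
    rw [pow_mul, ← mul_pow]
    push_cast
    ring
  rw [h9, h10, cauchyKer, mul_div_assoc', mul_div_assoc']
  congr 1
  ring

theorem inv_bigE_sq (t : ℝ) : (bigE (q ^ 4) ((t ^ 2 : ℝ) : ℂ))⁻¹ =
    (bigE (q ^ 4) (-((q ^ 4 : ℝ) : ℂ)))⁻¹ * partialFrac (q ^ 4) (t ^ 2) := by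
  have h0 := pow_pos hq0 4
  have h1 := pow_four_lt_one hq0 hq1
  have hne : bigE (q ^ 4) (-((q ^ 4 : ℝ) : ℂ)) ≠ 0 := by
    intro h
    have := bigE_re_pos h0 h1 (x := -q ^ 4) (by linarith)
    rw [Complex.ofReal_neg, h] at this
    simp at this
  have h4 := partialFrac_mul_bigE h0 h1 (x := t ^ 2) (by positivity)
  have h5 : partialFrac (q ^ 4) (t ^ 2) ≠ 0 := fun h => hne (by rw [← h4, h, zero_mul])
  rw [← h4, mul_inv, mul_right_comm, inv_mul_cancel₀ h5, one_mul]

omit hq0 hq1 in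
theorem hasSum_mul_shear {f : ℕ → ℂ} {g : ℤ → ℂ} {u v : ℂ} (hf : HasSum f u) (hg : HasSum g v)
    (hf' : Summable fun k => ‖f k‖) (hg' : Summable fun h => ‖g h‖) :
    HasSum (fun h : ℤ => ∑' k : ℕ, f k * g (h + k)) (u * v) := by
  have hprod : HasSum (fun x : ℕ × ℤ => f x.1 * g x.2) (u * v) :=
    HasSum.mul hf hg (summable_mul_of_summable_norm hf' hg')
  let σ : ℤ × ℕ ≃ ℕ × ℤ := (Equiv.prodComm _ _).trans
    (Equiv.prodShear (Equiv.refl _) fun k => Equiv.addRight (k : ℤ))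
  rw [← σ.hasSum_iff] at hprod
  exact hprod.prod_fiberwise fun h => (hprod.summable.prod_factor h).hasSum

/-- In the partial fractions the `k`-th term at a lattice point is the Cauchy kernel at the point
shifted by `k` steps. Summing over the whole lattice removes the shift, and the coefficients add up
to `E_{q⁴}(-q²)`. -/
theorem gaussInt_eq {ζ : ℝ} (hζ : 0 < ζ) : gaussInt q ζ =
    2 * (1 - (q : ℂ) ^ 2) * (bigE (q ^ 4) (-((q ^ 4 : ℝ) : ℂ)))⁻¹ * bigE (q ^ 4) (-(q : ℂ) ^ 2) *
      cauchySum q ζ := by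
  have h0 := pow_pos hq0 4
  have h1 := pow_four_lt_one hq0 hq1
  have hq : (q : ℂ) ≠ 0 := Complex.ofReal_ne_zero.2 hq0.ne'
  have ha := summable_cauchyKer_even hq0 hq1 hζ
  have h2 := hasSum_mul_shear (g := fun h : ℤ => cauchyKer ((q : ℂ) ^ (2 * h) * ζ))
    (hasSum_bigE h0 h1 (-(q : ℂ) ^ 2)) ha.of_norm.hasSum (summable_norm_bigE h0 h1 _) ha
  rw [gaussInt, jack, mul_assoc, cauchySum, ← h2.tsum_eq, ← tsum_mul_left]
  refine tsum_congr fun h => ?_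
  have htc : ((q ^ (2 * h) * ζ : ℝ) : ℂ) = (q : ℂ) ^ (2 * h) * ζ := by push_cast; rfl
  rw [jackTerm_gaussFun hq0, inv_bigE_sq hq0 hq1, ← htc]
  have h6 := mul_partialFrac (q := q) (q ^ (2 * h) * ζ)
  have h7 : ∀ k : ℕ, (q : ℂ) ^ (2 * (h + k)) * ζ = (q : ℂ) ^ (2 * k) * ((q ^ (2 * h) * ζ : ℝ) : ℂ) := by
    intro k
    rw [htc, mul_add, zpow_add₀ hq, ← zpow_natCast _ (2 * k)]
    push_cast
    ring
  simp only [← h7] at h6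
  rw [← h6]
  ring

theorem exists_gaussInt_eq_ofReal {ζ : ℝ} (hζ : 0 < ζ) : ∃ r : ℝ, 0 < r ∧ gaussInt q ζ = r := by
  have h0 := pow_pos hq0 4
  have h1 := pow_four_lt_one hq0 hq1
  have hs : Summable (jackTerm q (gaussFun q) ζ) := by
    have := absInt_pow_mul_gaussFun hq0 hq1 0
    simp only [pow_zero, one_mul] at this
    exact (this.summable_jackTerm hζ.ne' hq0).of_norm
  let T : ℤ → ℝ := fun h => 2 * (1 - q ^ 2) * (q ^ (2 * h) * ζ) *
      (∑' k, bigCoeff (q ^ 4) k * ((q ^ (2 * h) * ζ) ^ 2) ^ k)⁻¹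
  have hT : jackTerm q (gaussFun q) ζ = fun h => (T h : ℂ) := by
    funext h
    rw [jackTerm_gaussFun hq0, bigE_ofReal]
    simp only [T]
    push_cast
    rfl
  have hpos : ∀ h, 0 < T h := by
    intro h
    have h2 : 0 < q ^ (2 * h) * ζ := mul_pos (zpow_pos hq0 _) hζ
    have h3 := bigE_re_pos h0 h1 (x := (q ^ (2 * h) * ζ) ^ 2) (by nlinarith)
    rw [bigE_ofReal, Complex.ofReal_re] at h3
    have h4 : 0 < 1 - q ^ 2 := sub_pos.2 (pow_lt_one₀ hq0.le hq1 two_ne_zero)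
    positivity
  rw [hT, Complex.summable_ofReal] at hs
  refine ⟨∑' h, T h, hs.tsum_pos (fun h => (hpos h).le) 0 (hpos 0), ?_⟩
  rw [gaussInt, jack, hT, Complex.ofReal_tsum]

theorem exists_gaussInt_ne : ∃ t : ℝ, 0 < t ∧ gaussInt q (q * t) ≠ gaussInt q t := by
  obtain ⟨t, ht, hne⟩ := exists_cauchySum_ne hq0 hq1
  refine ⟨t, ht, fun h => hne ?_⟩
  obtain ⟨r, hr, hrt⟩ := exists_gaussInt_eq_ofReal hq0 hq1 ht
  have h2 : gaussInt q t ≠ 0 := hrt ▸ Complex.ofReal_ne_zero.2 hr.ne'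
  rw [gaussInt_eq hq0 hq1 (mul_pos hq0 ht), gaussInt_eq hq0 hq1 ht, Complex.ofReal_mul] at h
  rw [gaussInt_eq hq0 hq1 ht] at h2
  exact mul_left_cancel₀ (left_ne_zero_of_mul h2) h

end

end BraidedFourier

end

noncomputable section

namespace BraidedFourier

/-! ### Scalar multiples -/

section
variable {n : ℕ} {q : ℝ}

theorem IsIntegrableContinuation.smul {f : Series n} {φ : (Fin n → ℂ) → ℂ}
    (h : IsIntegrableContinuation q f φ) (c : ℂ) :
    IsIntegrableContinuation q (c • f) fun z => c * φ z := by
  obtain ⟨⟨⟨r, hr, hs⟩, U, hU, h0, hA⟩, hJ⟩ := h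
  refine ⟨⟨⟨r, hr, fun z hz => ?_⟩, U, hU, h0, fun z hz => ?_⟩, fun z hz ε => ?_⟩
  · rw [term_smul]
    exact (hs z hz).mul_left c
  · exact analyticAt_const.mul (hA z hz)
  · refine ((hJ z hz ε).mul_left ‖c‖).congr fun k => ?_
    rw [norm_mul]
    ring

theorem ClassR.smul {f : Series n} (h : ClassR q f) (c : ℂ) : ClassR q (c • f) := by
  intro E
  obtain ⟨φ, hφ⟩ := h E
  rw [mulW_smul_left, evenPart_smul]
  exact ⟨_, hφ.smul c⟩

theorem jackson_smul (c : ℂ) (φ : (Fin n → ℂ) → ℂ) (z : Fin n → ℝ) :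
    jackson q (fun w => c * φ w) z = c * jackson q φ z := by
  simp only [jackson, ← tsum_mul_left, jacksonTerm, Finset.mul_sum]
  exact tsum_congr fun k => Finset.sum_congr rfl fun ε _ => mul_left_comm _ _ _

theorem xIntegral_smul {f : Series n} (h : XIntegrable q f) (c : ℂ) (s : Fin n → ℕ)
    (z : Fin n → ℝ) : xIntegral q s (c • f) z = c * xIntegral q s f z := by
  obtain ⟨φ, hφ⟩ := h
  rw [xIntegral_eq hφ, xIntegral_eq (hφ.smul c), jackson_smul]

theorem transformFS_smul {f : Series n} (h : ClassR q f) (c : ℂ) (z : Fin n → ℝ) :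
    transformFS q (c • f) z = c • transformFS q f z := by
  funext E
  simp only [transformFS, antipode, Pi.smul_apply, smul_eq_mul, xIntegral', mulW_smul_left,
    evenPart_smul, xIntegral_smul (h E)]
  ring

variable {σ : Equiv.Perm (Fin n)} {γ : Fin n → ℝ}

theorem ClassS.smul {g : Series n} (h : ClassS q σ γ g) (c : ℂ) : ClassS q σ γ (c • g) := by
  intro E
  obtain ⟨v, hv⟩ := h E
  rw [mulW_smul_right]
  exact ⟨_, hv.smul c⟩

theorem transformG_smul {g : Series n} (h : ClassS q σ γ g) (c : ℂ) :
    transformG q σ γ (c • g) = c • transformG q σ γ g := by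
  funext E
  obtain ⟨v, hv⟩ := h E
  rw [Pi.smul_apply, transformG, transformG, mulW_smul_right, hv.loIntegral_eq,
    (hv.smul c).loIntegral_eq, smul_eq_mul]
  ring

end

/-! ### The constant -/

section
variable {n : ℕ} {q : ℝ} (hq0 : 0 < q) (hq1 : q < 1) (β : Fin n → ZMod 2) (σ : Equiv.Perm (Fin n))
include hq0 hq1

theorem plancherel_eq {z : Fin n → ℝ} (hz : ∀ j, z j ≠ 0) : plancherel q β σ z =
    (∏ j : Fin n, gaussInt q (q ^ (n - 1 - (j : ℕ) + lowerSum β j) * z j)) * loConst q σ := by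
  rw [plancherel, xIntegral_gaussX hq0 hq1 _ hz,
    (hasLOIntegral_gaussD hq0 hq1 σ β).loIntegral_eq]

end

theorem lowerSum_add_single {m : ℕ} (β : Fin (m + 1) → ZMod 2) (i : Fin m) :
    (lowerSum (β + Pi.single 0 1) i.succ : ZMod 2) = lowerSum β i.succ + 1 := by
  simp only [lowerSum]
  push_cast
  simp only [ZMod.natCast_zmod_val, Pi.add_apply, Finset.sum_add_distrib]
  rw [Finset.sum_eq_single (0 : Fin (m + 1)) (f := fun x => (Pi.single 0 1 : Fin (m + 1) → ZMod 2) x)]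
  · simp
  · intro b _ hb
    simp [hb]
  · intro h
    exact absurd (Finset.mem_Iio.2 (Fin.succ_pos i)) h

/-- Adding `1` to the first parity changes the lattice in all other variables. -/
theorem exists_plancherel_ne {n : ℕ} {q : ℝ} (hq0 : 0 < q) (hq1 : q < 1) (β : Fin n → ZMod 2)
    (σ : Equiv.Perm (Fin n)) (hn : 2 ≤ n) : ∃ (β' : Fin n → ZMod 2) (z : Fin n → ℝ),
      (∀ j, z j ≠ 0) ∧ plancherel q β' σ z ≠ plancherel q β σ z := by
  obtain ⟨m, rfl⟩ : ∃ m, n = m + 1 + 1 := ⟨n - 2, by omega⟩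
  obtain ⟨t, ht, hne⟩ := exists_gaussInt_ne hq0 hq1
  obtain ⟨r, hr, hrt⟩ := exists_gaussInt_eq_ofReal hq0 hq1 ht
  obtain ⟨s, hs, hst⟩ := exists_gaussInt_eq_ofReal hq0 hq1 (mul_pos hq0 ht)
  let e : Fin (m + 1 + 1) → ℕ := fun j => m + 1 + 1 - 1 - (j : ℕ) + lowerSum β j
  -- At this point all Gaussian integrals for `β` have the bound `t`. For `β'` the first one is
  -- unchanged and the others are equivalent to the bound `qt`.
  let z : Fin (m + 1 + 1) → ℝ := fun j => (q ^ e j)⁻¹ * t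
  have hz : ∀ j, z j ≠ 0 := fun j => (mul_pos (inv_pos.2 (pow_pos hq0 _)) ht).ne'
  have hez : ∀ j, q ^ e j * z j = t := fun j => mul_inv_cancel_left₀ (pow_pos hq0 _).ne' t
  refine ⟨β + Pi.single 0 1, z, hz, ?_⟩
  rw [plancherel_eq hq0 hq1 _ _ hz, plancherel_eq hq0 hq1 _ _ hz]
  intro h
  have h1 := mul_right_cancel₀ (loConst_ne_zero hq0 hq1 σ) h
  have h2 : ∀ j : Fin (m + 1 + 1), gaussInt q (q ^ (m + 1 + 1 - 1 - (j : ℕ) + lowerSum β j) * z j) = r := fun j => by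
    rw [← hrt, ← hez j]
  have h3 : gaussInt q (q ^ (m + 1 + 1 - 1 - ((0 : Fin (m + 1 + 1)) : ℕ) +
      lowerSum (β + Pi.single 0 1) 0) * z 0) = r := by
    have h0 : Finset.Iio (0 : Fin (m + 1 + 1)) = ∅ := by ext j; simp
    rw [← h2 0, lowerSum, lowerSum, h0]
    rfl
  have h4 : ∀ i : Fin (m + 1), gaussInt q (q ^ (m + 1 + 1 - 1 - (i.succ : ℕ) +
      lowerSum (β + Pi.single 0 1) i.succ) * z i.succ) = s := by
    intro i
    have hqt : q * t = q ^ (e i.succ + 1) * z i.succ := by rw [pow_succ', mul_assoc, hez]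
    rw [← hst, hqt]
    refine gaussInt_congr hq0 ?_ _
    simp only [e, Nat.cast_add, lowerSum_add_single]
    push_cast
    ring
  rw [Finset.prod_congr rfl fun j _ => h2 j, Fin.prod_univ_succ, h3,
    Finset.prod_congr rfl fun i _ => h4 i, Fin.prod_const, Fin.prod_const, pow_succ' _ (m + 1)] at h1
  have h5 := mul_left_cancel₀ (Complex.ofReal_ne_zero.2 hr.ne') h1
  -- Positivity of both integrals lets the power be removed.
  have h6 : s ^ (m + 1) = r ^ (m + 1) := by exact_mod_cast h5
  exact hne (by rw [hst, hrt, (pow_left_inj₀ hs.le hr.le m.succ_ne_zero).1 h6])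

end BraidedFourier

end

/-! ### The inversion theorem -/

theorem mainTheorem1 (n : ℕ) (q : ℝ) (hq0 : 0 < q) (hq1 : q < 1)
    (β : Fin n → ZMod 2) (σ : Equiv.Perm (Fin n)) :
    -- the two factors of the constant are defined
    BraidedFourier.XIntegrable q (BraidedFourier.gaussX n q) ∧
    BraidedFourier.LOIntegrable q σ (BraidedFourier.latticeGammaTilde q β σ)
      (BraidedFourier.gaussD n q) ∧
    -- `F_S ∘ G''` is defined on the first class and is the constant times the identity
    (∀ p : Fin n → Polynomial ℂ, (∀ j, BraidedFourier.HasParity (p j) (β j)) →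
      BraidedFourier.ClassS q σ (BraidedFourier.latticeGamma q β σ) (BraidedFourier.dClass q p) ∧
      BraidedFourier.ClassR q (BraidedFourier.transformG q σ (BraidedFourier.latticeGamma q β σ)
        (BraidedFourier.dClass q p)) ∧
      ∀ z : Fin n → ℝ, (∀ j, z j ≠ 0) →
        BraidedFourier.transformFS q (BraidedFourier.transformG q σ
            (BraidedFourier.latticeGamma q β σ) (BraidedFourier.dClass q p)) z =
          BraidedFourier.plancherel q β σ z • BraidedFourier.dClass q p) ∧
    -- `(id ⊗ G'') F_S` is defined on the second class and is the constant times the identity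
    (∀ p : Fin n → Polynomial ℂ, (∀ j, BraidedFourier.HasParity (p j) (β j)) →
      BraidedFourier.ClassR q (BraidedFourier.xClass q p) ∧
      ∀ z : Fin n → ℝ, (∀ j, z j ≠ 0) →
        BraidedFourier.ClassS q σ (BraidedFourier.latticeGamma q β σ)
          (BraidedFourier.transformFS q (BraidedFourier.xClass q p) z) ∧
        BraidedFourier.transformG q σ (BraidedFourier.latticeGamma q β σ)
            (BraidedFourier.transformFS q (BraidedFourier.xClass q p) z) =
          BraidedFourier.plancherel q β σ z • BraidedFourier.xClass q p) ∧
    -- for `n ≥ 2` the constant depends on the parity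
    (2 ≤ n → ∃ (β' : Fin n → ZMod 2) (z : Fin n → ℝ), (∀ j, z j ≠ 0) ∧
      BraidedFourier.plancherel q β' σ z ≠ BraidedFourier.plancherel q β σ z) := by
  have hS := fun p hp => BraidedFourier.classS_dClass (p := p) hq0 hq1 σ (β := β) hp
  refine ⟨BraidedFourier.xIntegrable_gaussX n hq0 hq1,
    ⟨_, BraidedFourier.hasLOIntegral_gaussD hq0 hq1 σ β⟩, fun p hp => ⟨hS p hp, ?_, fun z hz => ?_⟩,
    fun p hp => ⟨BraidedFourier.classR_xClass hq0 hq1 p, fun z hz => ?_⟩,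
    BraidedFourier.exists_plancherel_ne hq0 hq1 β σ⟩
  · rw [BraidedFourier.transformG_dClass hq0 hq1 σ hp]
    exact (BraidedFourier.classR_xClass hq0 hq1 _).smul _
  · rw [BraidedFourier.transformG_dClass hq0 hq1 σ hp,
      BraidedFourier.transformFS_smul (BraidedFourier.classR_xClass hq0 hq1 _),
      BraidedFourier.transformFS_xClass hq0 hq1 hp hz, BraidedFourier.plancherel_eq hq0 hq1 β σ hz,
      smul_smul, mul_comm]
  -- Preimages under `polyMap` reduce this composition to the two formulas used for the first one.
  · choose r hr hrp using fun j => BraidedFourier.exists_polyMap_eq hq0 (hp j)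
    obtain rfl : (fun j => BraidedFourier.polyMap q (r j)) = p := funext hrp
    rw [BraidedFourier.transformFS_xClass hq0 hq1 hr hz,
      BraidedFourier.transformG_smul (hS r hr), BraidedFourier.transformG_dClass hq0 hq1 σ hr,
      BraidedFourier.plancherel_eq hq0 hq1 β σ hz, smul_smul]
    exact ⟨(hS r hr).smul _, rfl⟩
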